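/- Let $n\ge 0$ and $N\ge 1$ be integers, $h>0$, $T=Nh$, $x_0,\xi_0\in\mathbb R^n$, and let $f,g:\mathbb R^n\times\mathbb R^n\to\mathbb R^n$ be bounded and of class $C^1$. Consider the impulsive delay system $dx(t)=f(x(t),x(t-h))\,dt+g(x(t),x(t-h))\,d\mu(t)$ on $[0,T]$, $x(0)=x_0$, $x=\xi_0$ on $[-h,0[$. Superscripts $\mp$ denote left and right limits; for an increasing map $A:[0,a]\to[0,b]$ with $A(0)=0$, $A(a)=b$ we set $A^-(0):=0$, $A^+(a):=b$, and its *right inverse* is $B:[0,b]\to[0,a]$ with $B(0)=0$, $B(b)=a$, $B(r)=\inf\{s\in[0,a]:A(s)>r\}$ for $0<r<b$. For a measure $\nu$, $\nu^c$ denotes its continuous (atomless) component. **Extended processes.** An impulsive control $(\mu,\{w^r\}_{r\in[0,h]})$ consists of a finite Borel measure $\mu$ on $[0,T]$ and measurable functions $w^r=(w^r_1,\dots,w^r_N):[0,1]\to[0,\infty[^N$ with: (i) for $r\in[0,h]$, $\sum_i w_i^r(s)=\sum_i\int_0^1w_i^r$ for a.e. $s\in[0,1]$; (ii) for $r\in]0,h[$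 and $1\le i\le N$, $\int_0^1w_i^r=\mu(\{r+(i-1)h\})$; (iii) for $0\le i\le N$, $\int_0^1[w^h_i+w^0_{i+1}]=\mu(\{ih\})$, where $w^h_0\equiv0$, $w^0_{N+1}\equiv 0$. An extended process is a triple $(x,\mu,\{w^r\})$ with $(\mu,\{w^r\})$ an impulsive control and $x:[-h,T]\to\mathbb R^n$ of bounded variation such that $x=\xi_0$ on $[-h,0[$, $x(0)=x_0$, $x((i-1)h)=\zeta_i^0(1)$ for $1<i\le N$, $x(T)=\zeta_N^h(1)$, and for $1\le i\le N$ and $t\in](i-1)h,ih[$ $$x(t)=\zeta_i^0(1)+\int_{(i-1)h}^t f(x(t'),x(t'-h))\,dt'+\int_{[(i-1)h,t]}g(x(t'),x(t'-h))\,d\mu^c(t')+\sum_{r\in]0,t-(i-1)h]}\bigl(\zeta_i^r(1)-x^-(r+(i-1)h)\bigr).$$ Here, for $r\in[0,h]$, $\zeta^r_1,\dots,\zeta^r_N:[0,1]\to\mathbb R^n$ are absolutely continuous with $\frac{d}{ds}\zeta_i^r=w_i^r\,g(\zeta_i^r,\zeta_{i-1}^r)$ a.e. on $[0,1]$, $\zeta_i^r(0)=x^-(r+(i-1)h)$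 if $r\in]0,h]$, $\zeta_i^0(0)=\zeta_{i-1}^h(1)$, where $\zeta_0^r(s)=\xi_0$ except that $\zeta_0^h(1)=x_0$. Extended processes whose $x$ and $\mu$ are equal and whose $w_i^r$ agree a.e. on $[0,1]$, for all $r\in[0,h]$ and $1\le i\le N$, are identified. **Reparameterized processes.** A reparameterized process $(S,\{y_i\}_{i=0}^N,\{\alpha_i\}_{i=1}^N)$ consists of $S>0$, $\alpha_i\in L^\infty(0,S)$ with $\alpha_i\ge0$ and $\sum_i\alpha_i\le1$ a.e., $\int_0^S(1-\sum_i\alpha_i)\,ds=h$, the function $y_0=\xi_0$ on $[0,S[$, $y_0(S)=x_0$, and absolutely continuous $y_1,\dots,y_N:[0,S]\to\mathbb R^n$ with $y_{i+1}(0)=y_i(S)$ for $0\le i\le N-1$ and, for $1\le i\le N$, $\dot y_i=(1-\sum_j\alpha_j)f(y_i,y_{i-1})+\alpha_i\,g(y_i,y_{i-1})$ a.e. on $[0,S]$. Each $\alpha_i$ is taken up to null sets. **From extended to reparameterized processes.** Given an extended process $(x,\mu,\{w^r\})$ with jump functions $\zeta_i^r$, let $\mu_i$ $(1\le i\le N)$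 be the measure on $[0,h]$ with $\mu_i([0,r])=\int_0^1w_i^0+\mu(](i-1)h,r+(i-1)h])$ for $r\in[0,h[$ and $\mu_i([0,h])=\int_0^1w_i^0+\mu(](i-1)h,ih[)+\int_0^1w_i^h$. Let $\phi(0)=0$, $\phi(r)=r+\sum_i\mu_i([0,r])$ for $r\in]0,h]$, $S=\phi(h)$; let $\eta:[0,S]\to[0,h]$ be the right inverse of $\phi$, $\{r_j\}$ the set of discontinuity points of $\phi$ in $[0,h]$ (those with $\phi^-(r_j)<\phi^+(r_j)$), $D=\bigcup_j[\phi^-(r_j),\phi^+(r_j)]$, $\lambda_j(s)=\frac{s-\phi^-(r_j)}{\phi^+(r_j)-\phi^-(r_j)}$, and $m_i^c$ the Radon–Nikodym derivative of $\mu_i^c$ with respect to $d\phi$, the measure on $[0,h]$ associated with $\phi$. Set $\alpha_i(s)=m_i^c(\eta(s))$ for a.e. $s\in[0,S]\setminus D$ and $\alpha_i(s)=\frac{1}{\phi^+(r_j)-\phi^-(r_j)}w_i^{r_j}(\lambda_j(s))$ for a.e. $s\in[\phi^-(r_j),\phi^+(r_j)]$. Let $y_0=\xi_0$ on $[0,S[$,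 $y_0(S)=x_0$ and, for $1\le i\le N$, $y_1(0)=x_0$, $y_i(0)=\zeta_{i-1}^h(1)$ if $i>1$, $y_i(S)=\zeta_i^h(1)$, $y_i(s)=x((i-1)h+\eta(s))$ for $s\in]0,S[\setminus D$, and $y_i(s)=\zeta_i^{r_j}(\lambda_j(s))$ for $s\in]0,S[\cap[\phi^-(r_j),\phi^+(r_j)]$. Write $\mathcal I(x,\mu,\{w^r\})=(S,\{y_i\},\{\alpha_i\})$. **From reparameterized to extended processes.** Given a reparameterized process $(S,\{y_i\},\{\alpha_i\})$, let $\psi(s)=\int_0^s(1-\sum_i\alpha_i)$ on $[0,S]$ and let $\sigma:[0,h]\to[0,S]$ be its right inverse. Let $\tilde\psi(s)=(i-1)h+\psi(s-(i-1)S)$, $\tilde y(s)=y_i(s-(i-1)S)$ for $s\in[(i-1)S,iS]$, and $\tilde\alpha(s)=\alpha_i(s-(i-1)S)$ for a.e. $s\in[(i-1)S,iS[$ $(1\le i\le N)$, and let $\tilde\sigma:[0,T]\to[0,NS]$ be the right inverse of $\tilde\psi$. Let $\mu$ be the measure on $[0,T]$ with $\mu([0,t])=\int_0^{\tilde\sigma^+(t)}\tilde\alpha(s)\,ds$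 for $t\in[0,T]$; let $x(t)=\tilde y(\tilde\sigma(t))$ for $t\in[0,T]$, $x(t)=\xi_0$ for $t\in[-h,0[$; and for $r\in[0,h]$, $1\le i\le N$ and a.e. $s\in[0,1]$ let $w_i^r(s)=(\sigma^+(r)-\sigma^-(r))\,\alpha_i\bigl(\sigma^-(r)+s(\sigma^+(r)-\sigma^-(r))\bigr)$. Write $\mathcal J(S,\{y_i\},\{\alpha_i\})=(x,\mu,\{w^r\})$. **Claim.** $\mathcal I$ is a well-defined map from the set of extended processes to the set of reparameterized processes, $\mathcal J$ is a well-defined map from the set of reparameterized processes to the set of extended processes, $\mathcal I$ is bijective, and $\mathcal I^{-1}=\mathcal J$. -/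

import Mathlib

open MeasureTheory Set Function

namespace ImpulsiveDelay

noncomputable section

/-! ### Conventions

The state space is `ℝⁿ`, the horizon is `T = N * h`. The paper's segment indices `1, …, N` are the
elements `i : Fin N` (so the `i`-th segment is `[i * h, (i + 1) * h]`), and a family indexed by
`0, …, N` is indexed by `Fin (N + 1)`; the members belonging to segment `i` and to its predecessor
are those with index `i.succ` and `i.castSucc`. Functions on an interval are total functions on `ℝ`
whose values outside the interval are ignored. -/

/-- The state space `ℝⁿ` with its Euclidean norm. -/
abbrev State (n : ℕ) : Type := EuclideanSpace ℝ (Fin n)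

/-- The continuous (that is, atomless) component of a measure on the line. -/
def contPart (μ : Measure ℝ) : Measure ℝ := μ.restrict {t | μ {t} = 0}

/-- The right inverse `B : [0, b] → [0, a]` of an increasing function `A : [0, a] → [0, b]`:
`B 0 = 0`, `B b = a` and `B r = inf {s ∈ [0, a] | A s > r}` for `0 < r < b`. It is extended by the
constants `0` and `a` to the left and right of `[0, b]`, which makes its left limit at `0` equal to
`0` and its right limit at `b` equal to `a`. -/
def rightInverse (A : ℝ → ℝ) (a b : ℝ) (r : ℝ) : ℝ :=
  if r ≤ 0 then 0 else if b ≤ r then a else sInf {s | s ∈ Icc 0 a ∧ r < A s}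

/-! ### Impulsive controls and extended processes -/

/-- An impulsive control: a finite Borel measure `μ` on `[0, N * h]` together with attached controls
`w r = (w r i)_i : [0, 1] → [0, ∞[ ^ N`, for `r ∈ [0, h]`. In `atom_node` the index `k` runs over
`0, …, N`; the `k`-th entry of the `Fin.cons` is the attached control at `r = h` of the segment that
ends at `k * h` (zero for `k = 0`), and the `k`-th entry of the `Fin.snoc` is the attached control at
`r = 0` of the segment that starts at `k * h` (zero for `k = N`). -/
structure IsImpulsiveControl (N : ℕ) (h : ℝ) (μ : Measure ℝ) (w : ℝ → Fin N → ℝ → ℝ) : Prop where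
  finite : IsFiniteMeasure μ
  support : μ (Icc 0 (N * h))ᶜ = 0
  measurable : ∀ r ∈ Icc 0 h, ∀ i, AEMeasurable (w r i) (volume.restrict (Icc 0 1))
  nonneg : ∀ r ∈ Icc 0 h, ∀ i, ∀ s ∈ Icc (0 : ℝ) 1, 0 ≤ w r i s
  sum_const : ∀ r ∈ Icc 0 h, ∀ᵐ s ∂volume.restrict (Icc (0 : ℝ) 1),
    ∑ i, w r i s = ∑ i, ∫ s' in (0 : ℝ)..1, w r i s'
  atom_interior : ∀ r ∈ Ioo 0 h, ∀ i : Fin N,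
    ∫ s in (0 : ℝ)..1, w r i s = μ.real {r + (i : ℕ) * h}
  atom_node : ∀ k : Fin (N + 1),
    ∫ s in (0 : ℝ)..1, ((Fin.cons (fun _ => 0) (w h) : Fin (N + 1) → ℝ → ℝ) k s +
      (Fin.snoc (w 0) (fun _ => 0) : Fin (N + 1) → ℝ → ℝ) k s) = μ.real {((k : ℕ) : ℝ) * h}

/-- The functions `ζ r k : [0, 1] → ℝⁿ`, `k = 0, …, N`, `r ∈ [0, h]`, which describe the evolution of
the state during the jumps: absolutely continuous solutions of the coupled differential equations
driven by the attached controls. -/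
structure IsJumpFamily {n N : ℕ} (h : ℝ) (g : State n × State n → State n) (x₀ ξ₀ : State n)
    (x : ℝ → State n) (w : ℝ → Fin N → ℝ → ℝ) (ζ : ℝ → Fin (N + 1) → ℝ → State n) : Prop where
  zero : ∀ r ∈ Icc 0 h, ∀ s ∈ Icc (0 : ℝ) 1, ζ r 0 s = if s = 1 ∧ r = h then x₀ else ξ₀
  abs_cont : ∀ r ∈ Icc 0 h, ∀ i : Fin N, AbsolutelyContinuousOnInterval (ζ r i.succ) 0 1
  ode : ∀ r ∈ Icc 0 h, ∀ i : Fin N, ∀ᵐ s ∂volume.restrict (Icc (0 : ℝ) 1),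
    HasDerivAt (ζ r i.succ) (w r i s • g (ζ r i.succ s, ζ r i.castSucc s)) s
  init_pos : ∀ r ∈ Ioc 0 h, ∀ i : Fin N, ζ r i.succ 0 = leftLim x (r + (i : ℕ) * h)
  init_zero : ∀ i : Fin N, ζ 0 i.succ 0 = ζ h i.castSucc 1

/-- `x` is an extended state trajectory for the impulsive control `(μ, w)`, with `ζ` describing its
jumps. -/
structure IsTrajectory {n N : ℕ} (h : ℝ) (f g : State n × State n → State n) (x₀ ξ₀ : State n)
    (x : ℝ → State n) (μ : Measure ℝ) (w : ℝ → Fin N → ℝ → ℝ)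
    (ζ : ℝ → Fin (N + 1) → ℝ → State n) : Prop where
  jumps : IsJumpFamily h g x₀ ξ₀ x w ζ
  history : ∀ t ∈ Ico (-h) 0, x t = ξ₀
  start : x 0 = x₀
  node : ∀ i : Fin N, 0 < (i : ℕ) → x ((i : ℕ) * h) = ζ 0 i.succ 1
  inside : ∀ i : Fin N, ∀ t ∈ Ioo ((i : ℕ) * h) (((i : ℕ) + 1) * h),
    x t = ζ 0 i.succ 1
      + (∫ t' in ((i : ℕ) * h)..t, f (x t', x (t' - h)))
      + (∫ t' in Icc ((i : ℕ) * h) t, g (x t', x (t' - h)) ∂(contPart μ))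
      + ∑' r : Ioc 0 (t - (i : ℕ) * h), (ζ r i.succ 1 - leftLim x (r + (i : ℕ) * h))
  terminal : x (N * h) = ζ h (Fin.last N) 1

/-- A representative of an extended process. -/
structure PreExtendedProcess {n : ℕ} (N : ℕ) (h : ℝ) (f g : State n × State n → State n)
    (x₀ ξ₀ : State n) where
  x : ℝ → State n
  μ : Measure ℝ
  w : ℝ → Fin N → ℝ → ℝ
  bounded_variation : BoundedVariationOn x (Icc (-h) (N * h))
  control : IsImpulsiveControl N h μ w
  trajectory : ∃ ζ, IsTrajectory h f g x₀ ξ₀ x μ w ζ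

/-! ### Reparameterized processes -/

/-- A representative of a reparameterized process. -/
structure PreReparamProcess {n : ℕ} (N : ℕ) (h : ℝ) (f g : State n × State n → State n)
    (x₀ ξ₀ : State n) where
  S : ℝ
  y : Fin (N + 1) → ℝ → State n
  α : Fin N → ℝ → ℝ
  S_pos : 0 < S
  essBdd : ∀ i, MemLp (α i) ⊤ (volume.restrict (Icc 0 S))
  nonneg : ∀ᵐ s ∂volume.restrict (Icc 0 S), ∀ i, 0 ≤ α i s
  sum_le : ∀ᵐ s ∂volume.restrict (Icc 0 S), ∑ i, α i s ≤ 1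
  abs_cont : ∀ i : Fin N, AbsolutelyContinuousOnInterval (y i.succ) 0 S
  ode : ∀ i : Fin N, ∀ᵐ s ∂volume.restrict (Icc 0 S),
    HasDerivAt (y i.succ) ((1 - ∑ j, α j s) • f (y i.succ s, y i.castSucc s)
      + α i s • g (y i.succ s, y i.castSucc s)) s
  y_zero : ∀ s ∈ Ico 0 S, y 0 s = ξ₀
  y_zero_end : y 0 S = x₀
  link : ∀ i : Fin N, y i.succ 0 = y i.castSucc S
  time : ∫ s in (0 : ℝ)..S, (1 - ∑ i, α i s) = h

section Processes

variable {n N : ℕ} {h : ℝ} {f g : State n × State n → State n} {x₀ ξ₀ : State n}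

/-- Two representatives give the same extended process when the trajectories agree on `[-h, N * h]`,
the measures agree, and the attached controls agree almost everywhere on `[0, 1]`. -/
instance : Setoid (PreExtendedProcess N h f g x₀ ξ₀) where
  r P P' := EqOn P.x P'.x (Icc (-h) (N * h)) ∧ P.μ = P'.μ ∧
    ∀ r ∈ Icc 0 h, ∀ i, P.w r i =ᵐ[volume.restrict (Icc 0 1)] P'.w r i
  iseqv :=
    { refl := fun _ => ⟨fun _ _ => rfl, rfl, fun _ _ _ => ae_eq_rfl⟩
      symm := fun H => ⟨H.1.symm, H.2.1.symm, fun r hr i => (H.2.2 r hr i).symm⟩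
      trans := fun H H' => ⟨H.1.trans H'.1, H.2.1.trans H'.2.1,
        fun r hr i => (H.2.2 r hr i).trans (H'.2.2 r hr i)⟩ }

/-- Two representatives give the same reparameterized process when they have the same `S`, the same
arcs `y` on `[0, S]`, and controls `α` which agree almost everywhere on `[0, S]`. -/
instance : Setoid (PreReparamProcess N h f g x₀ ξ₀) where
  r Q Q' := Q.S = Q'.S ∧ (∀ k, EqOn (Q.y k) (Q'.y k) (Icc 0 Q.S)) ∧
    ∀ i, Q.α i =ᵐ[volume.restrict (Icc 0 Q.S)] Q'.α i
  iseqv :=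
    { refl := fun _ => ⟨rfl, fun _ _ _ => rfl, fun _ => ae_eq_rfl⟩
      symm := fun {Q Q'} H => ⟨H.1.symm, H.1 ▸ fun k => (H.2.1 k).symm, H.1 ▸ fun i => (H.2.2 i).symm⟩
      trans := fun {Q Q' Q''} H H' => ⟨H.1.trans H'.1,
        fun k => (H.2.1 k).trans (by rw [H.1]; exact H'.2.1 k),
        fun i => (H.2.2 i).trans (by rw [H.1]; exact H'.2.2 i)⟩ }

end Processes

/-- Extended processes `(x, μ, {w r})`, the attached controls being taken up to null sets. -/
def ExtendedProcess {n : ℕ} (N : ℕ) (h : ℝ) (f g : State n × State n → State n)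
    (x₀ ξ₀ : State n) : Type :=
  Quotient (inferInstance : Setoid (PreExtendedProcess N h f g x₀ ξ₀))

/-- Reparameterized processes `(S, {y_i}, {α_i})`, the controls `α_i ∈ L^∞(0, S)` being taken up to
null sets. -/
def ReparamProcess {n : ℕ} (N : ℕ) (h : ℝ) (f g : State n × State n → State n)
    (x₀ ξ₀ : State n) : Type :=
  Quotient (inferInstance : Setoid (PreReparamProcess N h f g x₀ ξ₀))

/-! ### From extended to reparameterized processes -/

section Forward

variable {N : ℕ} (h : ℝ) (μ : Measure ℝ) (w : ℝ → Fin N → ℝ → ℝ)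

/-- The measure `μ_i` on `[0, h]`: the part of `μ` on the open segment `]i * h, (i + 1) * h[` shifted
to `]0, h[`, with the atoms prescribed by the attached controls added at `0` and `h`. -/
def segMeasure (i : Fin N) : Measure ℝ :=
  ENNReal.ofReal (∫ s in (0 : ℝ)..1, w 0 i s) • Measure.dirac 0
    + (μ.restrict (Ioo ((i : ℕ) * h) (((i : ℕ) + 1) * h))).map (fun t => t - (i : ℕ) * h)
    + ENNReal.ofReal (∫ s in (0 : ℝ)..1, w h i s) • Measure.dirac h

/-- The change of variable `φ` on `[0, h]`, `φ 0 = 0` and `φ r = r + ∑ μ_i [0, r]` for `0 < r ≤ h`,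
extended by the constants `0` and `φ h` to the left and right of `[0, h]`. -/
def phi (r : ℝ) : ℝ :=
  if r ≤ 0 then 0 else min r h + ∑ i, (segMeasure h μ w i).real (Icc 0 r)

/-- The measure `dφ` on `[0, h]` associated with the increasing function `φ`. -/
def phiMeasure : Measure ℝ := volume.restrict (Icc 0 h) + ∑ i, segMeasure h μ w i

/-- The right inverse `η : [0, S] → [0, h]` of `φ`, where `S = φ h`. -/
def eta : ℝ → ℝ := rightInverse (phi h μ w) h (phi h μ w h)

/-- The discontinuity points of `φ` in `[0, h]`. -/
def phiJumps : Set ℝ := {r | r ∈ Icc 0 h ∧ leftLim (phi h μ w) r < rightLim (phi h μ w) r}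

/-- The union of the intervals `[φ⁻ r, φ⁺ r]` over the discontinuity points `r` of `φ`. -/
def jumpSet : Set ℝ :=
  ⋃ r ∈ phiJumps h μ w, Icc (leftLim (phi h μ w) r) (rightLim (phi h μ w) r)

/-- The affine map of `[φ⁻ r, φ⁺ r]` onto `[0, 1]`. -/
def phiRescale (r s : ℝ) : ℝ :=
  (s - leftLim (phi h μ w) r) / (rightLim (phi h μ w) r - leftLim (phi h μ w) r)

/-- The Radon–Nikodym derivative of the continuous component of `μ_i` with respect to `dφ`. -/
def contDensity (i : Fin N) (r : ℝ) : ℝ :=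
  ((contPart (segMeasure h μ w i)).rnDeriv (phiMeasure h μ w) r).toReal

lemma segMeasure_Icc [IsFiniteMeasure μ] (i : Fin N) (hw : 0 ≤ ∫ s in (0 : ℝ)..1, w 0 i s)
    {r : ℝ} (hr : r ∈ Ico 0 h) :
    (segMeasure h μ w i).real (Icc 0 r) = (∫ s in (0 : ℝ)..1, w 0 i s)
      + μ.real (Ioc ((i : ℕ) * h) (r + (i : ℕ) * h)) := by
  have hset : (fun t : ℝ => t - (i : ℕ) * h) ⁻¹' Icc 0 r ∩ Ioo ((i : ℕ) * h) (((i : ℕ) + 1) * h)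
      = Ioc ((i : ℕ) * h) (r + (i : ℕ) * h) := by
    ext t
    simp only [mem_inter_iff, mem_preimage, mem_Icc, mem_Ioo, mem_Ioc]
    have := hr.2
    constructor
    · rintro ⟨⟨h1, h2⟩, h3, h4⟩; exact ⟨h3, by linarith⟩
    · rintro ⟨h1, h2⟩; exact ⟨⟨by linarith, by linarith⟩, h1, by linarith⟩
  have hm : Measurable (fun t : ℝ => t - (i : ℕ) * h) := by fun_prop
  rw [Measure.real, segMeasure, Measure.add_apply, Measure.add_apply, Measure.smul_apply,
    Measure.smul_apply, Measure.map_apply hm measurableSet_Icc,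
    Measure.restrict_apply (hm measurableSet_Icc), hset, Measure.dirac_apply' _ measurableSet_Icc,
    Measure.dirac_apply' _ measurableSet_Icc]
  simp [hr.1, hr.2, ENNReal.toReal_add, hw, Measure.real]

lemma segMeasure_total [IsFiniteMeasure μ] (i : Fin N) (hh : 0 < h)
    (hw : 0 ≤ ∫ s in (0 : ℝ)..1, w 0 i s) (hw' : 0 ≤ ∫ s in (0 : ℝ)..1, w h i s) :
    (segMeasure h μ w i).real (Icc 0 h) = (∫ s in (0 : ℝ)..1, w 0 i s)
      + μ.real (Ioo ((i : ℕ) * h) (((i : ℕ) + 1) * h)) + ∫ s in (0 : ℝ)..1, w h i s := by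
  have hset : (fun t : ℝ => t - (i : ℕ) * h) ⁻¹' Icc 0 h ∩ Ioo ((i : ℕ) * h) (((i : ℕ) + 1) * h)
      = Ioo ((i : ℕ) * h) (((i : ℕ) + 1) * h) := by
    ext t
    simp only [mem_inter_iff, mem_preimage, mem_Icc, mem_Ioo]
    constructor
    · rintro ⟨_, h3⟩; exact h3
    · rintro ⟨h1, h2⟩; exact ⟨⟨by linarith, by linarith⟩, h1, h2⟩
  have hm : Measurable (fun t : ℝ => t - (i : ℕ) * h) := by fun_prop
  rw [Measure.real, segMeasure, Measure.add_apply, Measure.add_apply, Measure.smul_apply,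
    Measure.smul_apply, Measure.map_apply hm measurableSet_Icc,
    Measure.restrict_apply (hm measurableSet_Icc), hset, Measure.dirac_apply' _ measurableSet_Icc,
    Measure.dirac_apply' _ measurableSet_Icc]
  simp [hh.le, ENNReal.toReal_add, hw, hw', Measure.real]

instance [IsFiniteMeasure μ] (i : Fin N) : IsFiniteMeasure (segMeasure h μ w i) := by
  refine ⟨?_⟩
  rw [segMeasure, Measure.add_apply, Measure.add_apply, Measure.smul_apply, Measure.smul_apply]
  simp [ENNReal.add_lt_top, measure_lt_top]

/-- `dφ` has `φ` as its distribution function on `]0, h]`. -/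
lemma phiMeasure_Icc [IsFiniteMeasure μ] {r : ℝ} (hr : r ∈ Ioc 0 h) :
    (phiMeasure h μ w).real (Icc 0 r) = phi h μ w r := by
  have hI : Icc 0 r ∩ Icc 0 h = Icc 0 r := inter_eq_left.2 (Icc_subset_Icc_right hr.2)
  have hv : (volume.restrict (Icc (0 : ℝ) h)) (Icc 0 r) = ENNReal.ofReal r := by
    rw [Measure.restrict_apply measurableSet_Icc, hI, Real.volume_Icc, sub_zero]
  rw [Measure.real, phiMeasure, Measure.add_apply, hv, phi, if_neg (not_le.2 hr.1), min_eq_left hr.2,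
    Measure.finsetSum_apply, ENNReal.toReal_add ENNReal.ofReal_ne_top
      (ENNReal.sum_ne_top.2 fun i _ => measure_ne_top _ _), ENNReal.toReal_ofReal hr.1.le,
    ENNReal.toReal_sum fun i _ => measure_ne_top _ _]
  rfl

end Forward

/-- `Q` is the reparameterized process constructed from the extended process `P` (on the level of
representatives). -/
structure IsReparamOf {n N : ℕ} {h : ℝ} {f g : State n × State n → State n} {x₀ ξ₀ : State n}
    (P : PreExtendedProcess N h f g x₀ ξ₀) (Q : PreReparamProcess N h f g x₀ ξ₀) : Prop where
  S_eq : Q.S = phi h P.μ P.w h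
  control_off : ∀ i, ∀ᵐ s ∂volume.restrict (Icc 0 Q.S \ jumpSet h P.μ P.w),
    Q.α i s = contDensity h P.μ P.w i (eta h P.μ P.w s)
  control_on : ∀ i, ∀ r ∈ phiJumps h P.μ P.w,
    ∀ᵐ s ∂volume.restrict (Icc (leftLim (phi h P.μ P.w) r) (rightLim (phi h P.μ P.w) r)),
      Q.α i s = 1 / (rightLim (phi h P.μ P.w) r - leftLim (phi h P.μ P.w) r)
        * P.w r i (phiRescale h P.μ P.w r s)
  arcs : ∃ ζ, IsTrajectory h f g x₀ ξ₀ P.x P.μ P.w ζ ∧ ∀ i : Fin N,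
    Q.y i.succ 0 = (if (i : ℕ) = 0 then x₀ else ζ h i.castSucc 1) ∧
    Q.y i.succ Q.S = ζ h i.succ 1 ∧
    (∀ s ∈ Ioo 0 Q.S \ jumpSet h P.μ P.w,
      Q.y i.succ s = P.x ((i : ℕ) * h + eta h P.μ P.w s)) ∧
    ∀ r ∈ phiJumps h P.μ P.w,
      ∀ s ∈ Ioo 0 Q.S ∩ Icc (leftLim (phi h P.μ P.w) r) (rightLim (phi h P.μ P.w) r),
        Q.y i.succ s = ζ r i.succ (phiRescale h P.μ P.w r s)

/-! ### From reparameterized to extended processes -/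

section Backward

variable {n N : ℕ} {h : ℝ} {f g : State n × State n → State n} {x₀ ξ₀ : State n}

/-- The change of variable `ψ : [0, S] → [0, h]`. -/
def PreReparamProcess.psi (Q : PreReparamProcess N h f g x₀ ξ₀) (s : ℝ) : ℝ :=
  ∫ s' in (0 : ℝ)..s, (1 - ∑ i, Q.α i s')

/-- The right inverse `σ : [0, h] → [0, S]` of `ψ`. -/
def PreReparamProcess.sigma (Q : PreReparamProcess N h f g x₀ ξ₀) : ℝ → ℝ :=
  rightInverse Q.psi Q.S h

/-- `P` is the extended process constructed from the reparameterized process `Q` (on the level of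
representatives). Here `ψt`, `yt`, `αt` are the functions on `[0, N * S]` obtained by concatenating
`(i * h + ψ)_i`, `(y_i)_i`, `(α_i)_i`, and `σt : [0, N * h] → [0, N * S]` is the right inverse of
`ψt`. -/
def IsExtendedOf (Q : PreReparamProcess N h f g x₀ ξ₀) (P : PreExtendedProcess N h f g x₀ ξ₀) :
    Prop :=
  ∃ (ψt : ℝ → ℝ) (yt : ℝ → State n) (αt : ℝ → ℝ) (σt : ℝ → ℝ),
    (∀ i : Fin N, ∀ s ∈ Icc ((i : ℕ) * Q.S) (((i : ℕ) + 1) * Q.S),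
      ψt s = (i : ℕ) * h + Q.psi (s - (i : ℕ) * Q.S)) ∧
    (∀ i : Fin N, ∀ s ∈ Icc ((i : ℕ) * Q.S) (((i : ℕ) + 1) * Q.S),
      yt s = Q.y i.succ (s - (i : ℕ) * Q.S)) ∧
    (∀ i : Fin N, ∀ᵐ s ∂volume.restrict (Ico ((i : ℕ) * Q.S) (((i : ℕ) + 1) * Q.S)),
      αt s = Q.α i (s - (i : ℕ) * Q.S)) ∧
    σt = rightInverse ψt (N * Q.S) (N * h) ∧
    (∀ t ∈ Icc 0 (N * h), P.μ.real (Icc 0 t) = ∫ s in (0 : ℝ)..rightLim σt t, αt s) ∧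
    (∀ t ∈ Icc 0 (N * h), P.x t = yt (σt t)) ∧
    (∀ t ∈ Ico (-h) 0, P.x t = ξ₀) ∧
    ∀ r ∈ Icc 0 h, ∀ i, ∀ᵐ s ∂volume.restrict (Icc (0 : ℝ) 1),
      P.w r i s = (rightLim Q.sigma r - leftLim Q.sigma r)
        * Q.α i (leftLim Q.sigma r + s * (rightLim Q.sigma r - leftLim Q.sigma r))

/-- The reparameterized process `q` is obtained from the extended process `p`. -/
def ReparamOf (p : ExtendedProcess N h f g x₀ ξ₀) (q : ReparamProcess N h f g x₀ ξ₀) : Prop :=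
  ∃ (P : PreExtendedProcess N h f g x₀ ξ₀) (Q : PreReparamProcess N h f g x₀ ξ₀),
    Quotient.mk _ P = p ∧ Quotient.mk _ Q = q ∧ IsReparamOf P Q

/-- The extended process `p` is obtained from the reparameterized process `q`. -/
def ExtendedOf (q : ReparamProcess N h f g x₀ ξ₀) (p : ExtendedProcess N h f g x₀ ξ₀) : Prop :=
  ∃ (Q : PreReparamProcess N h f g x₀ ξ₀) (P : PreExtendedProcess N h f g x₀ ξ₀),
    Quotient.mk _ Q = q ∧ Quotient.mk _ P = p ∧ IsExtendedOf Q P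

end Backward

end

end ImpulsiveDelay

/-! Both constructions are the same change of time. For a reparameterized process put `u = 1 - ∑
α_i` and let `ψ` be the primitive of `u`, a continuous nondecreasing map of `[0, S]` onto `[0, h]`
with right inverse `σ`. The level set of `ψ` at `r` is the interval from `σ⁻(r)` to `σ⁺(r)`, and
only countably many of these intervals are nondegenerate. The image of `u ds` under `ψ` is Lebesgue
measure on `[0, h]`. The condition that ties the controls to an impulsive control is that the image
of `α_i ds` be `μ_i` (`IsMatching`). Since `u + ∑ α_i = 1`, the image of `ds` is then `dφ`, and a
comparison of distribution functions gives `φ = σ`, hence `η = ψ` on `[0, S]` (`IsMatching.phi_eq`,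
`IsMatching.eta_eq`). So the jumps of `φ` are the flat parts of `ψ`. Off the flat parts `σ` undoes
`ψ`, and `α_i` is the density of the continuous part of `μ_i` composed with `ψ`
(`IsMatching.contDensity_eq`); on a flat part `u = 0` almost everywhere, so the equation of `y_i`
is, up to an affine rescaling, the equation of the jump function.

The dynamics correspond by `IsClock.integral_decomposition`: the integral of the velocity `u f + α_i
g` over the times between `σ⁺(0)` and `σ⁺(r)` splits into a Lebesgue integral of `f`, an integral of
`g` against the continuous part of the measure, and one term for each flat part. This is the
integral equation of an extended trajectory (`IsMatching.inside_eq`). The delay causes no trouble: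
going back by `h` in the original time means passing from segment `i` to its predecessor at the same
`s`.

All of this is recorded in one relation `IsLinked P Q`, which implies both that `Q` is built from
`P` and that `P` is built from `Q` (`IsLinked.isReparamOf`, `IsLinked.isExtendedOf`). Every `Q` has
a linked `P` (`PreReparamProcess.exists_isLinked`). Every `P` has a linked `Q`
(`PreExtendedProcess.exists_isLinked`), where the controls are assembled from rescaled attached
controls and Radon–Nikodym derivatives (`IsImpulsiveControl.exists_isMatching`) and the arcs are
obtained by integrating a velocity written in terms of the trajectory and its jump functions.

Each construction has at most one result up to equivalence. For reparameterized processes the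
controls are prescribed almost everywhere and Gronwall's inequality then fixes the arcs; this is
where `f` and `g` of class `C¹` are needed (`IsReparamOf.equiv`). For extended processes the
formulas prescribe everything (`IsExtendedOf.equiv`). Two functional relations that share a linked
pair over every point, on either side, are converse to each other, so they are mutually inverse
bijections. -/

open Filter Topology

/-! ### Right inverses of continuous time changes -/

namespace ImpulsiveDelay

/-- A continuous nondecreasing surjection `ψ` of `[0, S]` onto `[0, h]`. -/
structure IsTimeChange (ψ : ℝ → ℝ) (S h : ℝ) : Prop where
  S_pos : 0 < S
  h_pos : 0 < h
  cont : ContinuousOn ψ (Icc 0 S)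
  mono : MonotoneOn ψ (Icc 0 S)
  map_zero : ψ 0 = 0
  map_end : ψ S = h

lemma rightInverse_of_nonpos {A : ℝ → ℝ} {a b r : ℝ} (hr : r ≤ 0) : rightInverse A a b r = 0 :=
  if_pos hr

lemma rightInverse_of_ge {A : ℝ → ℝ} {a b r : ℝ} (hb : 0 < b) (hr : b ≤ r) :
    rightInverse A a b r = a := by
  rw [rightInverse, if_neg (by linarith), if_pos hr]

lemma rightInverse_of_mem {A : ℝ → ℝ} {a b r : ℝ} (hr : r ∈ Ioo 0 b) :
    rightInverse A a b r = sInf {s | s ∈ Icc 0 a ∧ r < A s} := by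
  rw [rightInverse, if_neg (by linarith [hr.1]), if_neg (by linarith [hr.2])]

lemma rightInverse_congr {A B : ℝ → ℝ} {a b : ℝ} (H : EqOn A B (Icc 0 a)) :
    rightInverse A a b = rightInverse B a b := by
  funext r
  have : {s | s ∈ Icc 0 a ∧ r < A s} = {s | s ∈ Icc 0 a ∧ r < B s} := by
    ext s
    simp only [mem_ofPred_eq]
    constructor
    · rintro ⟨h1, h2⟩; exact ⟨h1, H h1 ▸ h2⟩
    · rintro ⟨h1, h2⟩; exact ⟨h1, (H h1).symm ▸ h2⟩
  simp only [rightInverse, this]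

/-- A point below which `A` does not exceed `r`, and beyond which it does, is the value of the right
inverse. -/
lemma rightInverse_eq_of_forall {A : ℝ → ℝ} {a b r c : ℝ} (hr : r ∈ Ioo 0 b) (hc : c ∈ Ico 0 a)
    (H : ∀ s ∈ Icc 0 a, A s ≤ r ↔ s ≤ c) : rightInverse A a b r = c := by
  rw [rightInverse_of_mem hr]
  have : {s | s ∈ Icc 0 a ∧ r < A s} = Ioc c a := by
    ext s
    simp only [mem_ofPred_eq, mem_Ioc]
    constructor
    · rintro ⟨h1, h2⟩
      exact ⟨not_le.1 fun h3 => absurd ((H s h1).2 h3) (not_le.2 h2), h1.2⟩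
    · rintro ⟨h1, h2⟩
      have h3 : s ∈ Icc 0 a := ⟨by linarith [hc.1], h2⟩
      exact ⟨h3, not_le.1 fun h4 => absurd ((H s h3).1 h4) (not_le.2 h1)⟩
  rw [this, csInf_Ioc hc.2]

namespace IsTimeChange

variable {ψ : ℝ → ℝ} {S h : ℝ} (H : IsTimeChange ψ S h)
include H

lemma zero_mem : (0 : ℝ) ∈ Icc 0 S := ⟨le_rfl, H.S_pos.le⟩

lemma end_mem : S ∈ Icc 0 S := ⟨H.S_pos.le, le_rfl⟩

lemma maps {s : ℝ} (hs : s ∈ Icc 0 S) : ψ s ∈ Icc 0 h :=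
  ⟨H.map_zero ▸ H.mono H.zero_mem hs hs.1, H.map_end ▸ H.mono hs H.end_mem hs.2⟩

lemma inv_set_nonempty {r : ℝ} (hr : r < h) : {s | s ∈ Icc 0 S ∧ r < ψ s}.Nonempty :=
  ⟨S, H.end_mem, H.map_end.symm ▸ hr⟩

/-- A Galois connection, from which the order properties of the right inverse follow. If `ψ s > r`,
continuity gives a point `s' ≤ s` whose value lies strictly between `r` and `ψ s`, so the infimum is
smaller than `s`. The values at `0` and `h` are set by convention, hence the open interval. -/
lemma le_inv_iff {r s : ℝ} (hr : r ∈ Ioo 0 h) (hs : s ∈ Icc 0 S) :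
    s ≤ rightInverse ψ S h r ↔ ψ s ≤ r := by
  rw [rightInverse_of_mem hr]
  constructor
  · intro h1
    by_contra! h2
    have hsub : Icc 0 s ⊆ Icc 0 S := Icc_subset_Icc_right hs.2
    obtain ⟨s', hs', e⟩ := intermediate_value_Icc hs.1 (H.cont.mono hsub)
      (show (r + ψ s) / 2 ∈ Icc (ψ 0) (ψ s) by
        rw [H.map_zero]; constructor <;> linarith [hr.1])
    have h3 : sInf {s | s ∈ Icc 0 S ∧ r < ψ s} ≤ s' :=
      csInf_le ⟨0, fun _ hs => hs.1.1⟩ ⟨hsub hs', by linarith⟩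
    have h4 : s' = s := le_antisymm hs'.2 (h1.trans h3)
    rw [h4] at e; linarith
  · intro h1
    refine le_csInf (H.inv_set_nonempty hr.2) fun s' hs' => ?_
    by_contra! h2
    have := H.mono hs'.1 hs h2.le
    linarith [hs'.2]

lemma inv_mem (r : ℝ) : rightInverse ψ S h r ∈ Icc 0 S := by
  rcases le_or_gt r 0 with h0 | h0
  · rw [rightInverse_of_nonpos h0]; exact H.zero_mem
  rcases le_or_gt h r with h1 | h1
  · rw [rightInverse_of_ge H.h_pos h1]; exact H.end_mem
  rw [rightInverse_of_mem ⟨h0, h1⟩]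
  exact ⟨le_csInf (H.inv_set_nonempty h1) fun _ hs => hs.1.1,
    csInf_le ⟨0, fun _ hs => hs.1.1⟩ ⟨H.end_mem, by rwa [H.map_end]⟩⟩

lemma inv_mono : Monotone (rightInverse ψ S h) := by
  intro r r' hrr
  rcases le_or_gt r 0 with h0 | h0
  · rw [rightInverse_of_nonpos h0]; exact (H.inv_mem r').1
  rcases le_or_gt h r' with h1 | h1
  · rw [rightInverse_of_ge H.h_pos h1]; exact (H.inv_mem r).2
  have hr : r ∈ Ioo 0 h := ⟨h0, hrr.trans_lt h1⟩
  have hr' : r' ∈ Ioo 0 h := ⟨h0.trans_le hrr, h1⟩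
  rw [H.le_inv_iff hr' (H.inv_mem r)]
  exact ((H.le_inv_iff hr (H.inv_mem r)).1 le_rfl).trans hrr

-- Extending the right inverse by constants outside its interval makes its one-sided limits at the
-- ends agree with the conventions `A⁻(0) = 0` and `A⁺(a) = b`.
omit H in
lemma inv_leftLim_zero : leftLim (rightInverse ψ S h) 0 = 0 := by
  refine leftLim_eq_of_tendsto ?_
  refine tendsto_const_nhds.congr' ?_
  filter_upwards [self_mem_nhdsWithin] with r hr
  exact (rightInverse_of_nonpos (le_of_lt hr)).symm

lemma inv_rightLim_end : rightLim (rightInverse ψ S h) h = S := by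
  refine rightLim_eq_of_tendsto ?_
  refine tendsto_const_nhds.congr' ?_
  filter_upwards [self_mem_nhdsWithin] with r hr
  exact (rightInverse_of_ge H.h_pos (le_of_lt hr)).symm

lemma inv_leftLim_mem (r : ℝ) : leftLim (rightInverse ψ S h) r ∈ Icc 0 S :=
  ⟨(H.inv_mem (r - 1)).1.trans (H.inv_mono.le_leftLim (by linarith)),
    (H.inv_mono.leftLim_le le_rfl).trans (H.inv_mem r).2⟩

lemma inv_rightLim_mem (r : ℝ) : rightLim (rightInverse ψ S h) r ∈ Icc 0 S :=
  ⟨(H.inv_mem r).1.trans (H.inv_mono.le_rightLim le_rfl),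
    (H.inv_mono.rightLim_le (by linarith)).trans (H.inv_mem (r + 1)).2⟩

/-- Letting `r' ↓ r` in `le_inv_iff` removes the restriction to interior points: with right limits
the Galois connection holds on all of `[0, h]`. The next lemma is its counterpart for left limits.
-/
lemma le_inv_rightLim_iff {r s : ℝ} (hr : r ∈ Icc 0 h) (hs : s ∈ Icc 0 S) :
    s ≤ rightLim (rightInverse ψ S h) r ↔ ψ s ≤ r := by
  rcases hr.2.eq_or_lt with rfl | hrh
  · rw [H.inv_rightLim_end]
    exact ⟨fun _ => (H.maps hs).2, fun _ => hs.2⟩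
  have hev : ∀ᶠ r' in 𝓝[>] r, r' ∈ Ioo r h := Ioo_mem_nhdsGT hrh
  constructor
  · intro h1
    refine ge_of_tendsto (x := 𝓝[>] r) (tendsto_nhdsWithin_of_tendsto_nhds tendsto_id) ?_
    filter_upwards [hev] with r' hr'
    exact (H.le_inv_iff ⟨hr.1.trans_lt hr'.1, hr'.2⟩ hs).1
      (h1.trans (H.inv_mono.rightLim_le hr'.1))
  · intro h1
    refine ge_of_tendsto (H.inv_mono.tendsto_rightLim r) ?_
    filter_upwards [hev] with r' hr'
    exact (H.le_inv_iff ⟨hr.1.trans_lt hr'.1, hr'.2⟩ hs).2 (h1.trans hr'.1.le)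

lemma inv_leftLim_le_iff {r s : ℝ} (hr : r ∈ Icc 0 h) (hs : s ∈ Icc 0 S) :
    leftLim (rightInverse ψ S h) r ≤ s ↔ r ≤ ψ s := by
  rcases hr.1.eq_or_lt with rfl | hr0
  · rw [inv_leftLim_zero]
    exact ⟨fun _ => (H.maps hs).1, fun _ => hs.1⟩
  have hev : ∀ᶠ r' in 𝓝[<] r, r' ∈ Ioo 0 r := Ioo_mem_nhdsLT hr0
  constructor
  · intro h1
    by_contra! h2
    obtain ⟨r', h3, h4⟩ := exists_between h2
    have hr' : r' ∈ Ioo 0 h := ⟨(H.maps hs).1.trans_lt h3, h4.trans_le hr.2⟩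
    have hsub : Icc s S ⊆ Icc 0 S := Icc_subset_Icc_left hs.1
    obtain ⟨s', hs', e⟩ := intermediate_value_Icc hs.2 (H.cont.mono hsub)
      (show r' ∈ Icc (ψ s) (ψ S) by rw [H.map_end]; exact ⟨h3.le, hr'.2.le⟩)
    have h5 := (H.le_inv_iff hr' (hsub hs')).2 e.le
    have h6 : s' ≤ s := h5.trans ((H.inv_mono.le_leftLim h4).trans h1)
    have h7 : s' = s := le_antisymm h6 hs'.1
    rw [h7] at e; linarith
  · intro h1
    refine le_of_tendsto (H.inv_mono.tendsto_leftLim r) ?_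
    filter_upwards [hev] with r' hr'
    by_contra! h2
    have := (H.le_inv_iff ⟨hr'.1, hr'.2.trans_le hr.2⟩ hs).1 h2.le
    linarith [hr'.2]

/-- Right continuity can fail only at `0`, where the value `0` is imposed although `ψ` may be flat
there. This is why `rightLim σ 0`, and not `σ 0`, is the starting point of the integrals over a
segment. -/
lemma inv_rightLim {r : ℝ} (hr : 0 < r) :
    rightLim (rightInverse ψ S h) r = rightInverse ψ S h r := by
  refine le_antisymm ?_ (H.inv_mono.le_rightLim le_rfl)
  rcases le_or_gt h r with h1 | h1
  · rw [rightInverse_of_ge H.h_pos h1]; exact (H.inv_rightLim_mem r).2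
  exact (H.le_inv_iff ⟨hr, h1⟩ (H.inv_rightLim_mem r)).2
    ((H.le_inv_rightLim_iff ⟨hr.le, h1.le⟩ (H.inv_rightLim_mem r)).1 le_rfl)

/-- The level sets of `ψ`. -/
lemma eq_iff {r s : ℝ} (hr : r ∈ Icc 0 h) (hs : s ∈ Icc 0 S) :
    ψ s = r ↔
      s ∈ Icc (leftLim (rightInverse ψ S h) r) (rightLim (rightInverse ψ S h) r) := by
  rw [mem_Icc, H.inv_leftLim_le_iff hr hs, H.le_inv_rightLim_iff hr hs, and_comm,
    le_antisymm_iff]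

lemma Icc_inv_subset (r : ℝ) :
    Icc (leftLim (rightInverse ψ S h) r) (rightLim (rightInverse ψ S h) r) ⊆ Icc 0 S :=
  Icc_subset_Icc (H.inv_leftLim_mem r).1 (H.inv_rightLim_mem r).2

lemma leftLim_le_rightLim (r : ℝ) :
    leftLim (rightInverse ψ S h) r ≤ rightLim (rightInverse ψ S h) r :=
  H.inv_mono.leftLim_le_rightLim le_rfl

lemma comp_inv_leftLim {r : ℝ} (hr : r ∈ Icc 0 h) :
    ψ (leftLim (rightInverse ψ S h) r) = r :=
  (H.eq_iff hr (H.inv_leftLim_mem r)).2 ⟨le_rfl, H.leftLim_le_rightLim r⟩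

lemma comp_inv_rightLim {r : ℝ} (hr : r ∈ Icc 0 h) :
    ψ (rightLim (rightInverse ψ S h) r) = r :=
  (H.eq_iff hr (H.inv_rightLim_mem r)).2 ⟨H.leftLim_le_rightLim r, le_rfl⟩

lemma comp_inv {r : ℝ} (hr : r ∈ Icc 0 h) : ψ (rightInverse ψ S h r) = r :=
  (H.eq_iff hr (H.inv_mem r)).2
    ⟨H.inv_mono.leftLim_le le_rfl, H.inv_mono.le_rightLim le_rfl⟩

lemma inv_rightLim_lt {r : ℝ} (hr : r ∈ Ico 0 h) : rightLim (rightInverse ψ S h) r < S := by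
  refine (H.inv_rightLim_mem r).2.lt_of_ne fun e => ?_
  have := H.comp_inv_rightLim ⟨hr.1, hr.2.le⟩
  rw [e, H.map_end] at this
  linarith [hr.2]

/-- The right inverse of the right inverse of `ψ` is `ψ`. -/
lemma inv_inv {s : ℝ} (hs : s ∈ Icc 0 S) : rightInverse (rightInverse ψ S h) h S s = ψ s := by
  rcases hs.1.eq_or_lt with rfl | h0
  · rw [rightInverse_of_nonpos le_rfl, H.map_zero]
  rcases hs.2.eq_or_lt with rfl | h1
  · rw [rightInverse_of_ge H.S_pos le_rfl, H.map_end]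
  rw [rightInverse_of_mem ⟨h0, h1⟩]
  have hmem : h ∈ {r | r ∈ Icc 0 h ∧ s < rightInverse ψ S h r} :=
    ⟨⟨H.h_pos.le, le_rfl⟩, by rwa [rightInverse_of_ge H.h_pos le_rfl]⟩
  have hbdd : BddBelow {r | r ∈ Icc 0 h ∧ s < rightInverse ψ S h r} := ⟨0, fun _ h => h.1.1⟩
  refine le_antisymm ?_ (le_csInf ⟨h, hmem⟩ fun r hr => ?_)
  · refine le_of_forall_gt_imp_ge_of_dense fun r hr => ?_
    rcases le_or_gt h r with h2 | h2
    · exact (csInf_le hbdd hmem).trans h2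
    have hr0 : r ∈ Ioo 0 h := ⟨(H.maps hs).1.trans_lt hr, h2⟩
    refine csInf_le hbdd ⟨⟨hr0.1.le, hr0.2.le⟩, ?_⟩
    refine ((H.le_inv_iff hr0 hs).2 hr.le).lt_of_ne fun e => ?_
    have := H.comp_inv ⟨hr0.1.le, hr0.2.le⟩
    rw [← e] at this
    linarith
  · by_contra! h2
    have h3 := (H.inv_leftLim_le_iff (r := ψ s) (H.maps hs) hs).2 le_rfl
    have h4 := H.inv_mono.le_leftLim h2
    linarith [hr.2]

/-- The level set of `ψ` through `s` is the interval between the one-sided limits at `ψ s`; without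
a jump it is reduced to `s`. -/
lemma inv_comp {s : ℝ} (hs : s ∈ Icc 0 S) (hn : ¬ leftLim (rightInverse ψ S h) (ψ s)
    < rightLim (rightInverse ψ S h) (ψ s)) : rightInverse ψ S h (ψ s) = s := by
  have h1 := (H.eq_iff (H.maps hs) hs).1 rfl
  have h2 := H.inv_mono.leftLim_le (le_refl (ψ s))
  have h3 := H.inv_mono.le_rightLim (le_refl (ψ s))
  linarith [h1.1, h1.2]

/-- If `ψ s = 0` and there is no jump at `0`, the level set of `0` is `{0}`, which contradicts `0 <
s`; symmetrically at the other end. -/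
lemma comp_mem_Ioo {s : ℝ} (hs : s ∈ Ioo 0 S) (hn : ¬ leftLim (rightInverse ψ S h) (ψ s)
    < rightLim (rightInverse ψ S h) (ψ s)) : ψ s ∈ Ioo 0 h := by
  have hs' : s ∈ Icc 0 S := ⟨hs.1.le, hs.2.le⟩
  have hmem := H.maps hs'
  have hlev := (H.eq_iff hmem hs').1 rfl
  have heq := le_antisymm (H.leftLim_le_rightLim (ψ s)) (not_lt.1 hn)
  refine ⟨hmem.1.lt_of_ne fun e0 => ?_, hmem.2.lt_of_ne fun e0 => ?_⟩
  · rw [← e0] at hlev heq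
    rw [inv_leftLim_zero] at heq
    linarith [hlev.2, hs.1]
  · rw [e0] at hlev heq
    rw [H.inv_rightLim_end] at heq
    linarith [hlev.1, hs.2]

/-- The flat parts of `ψ`. -/
lemma countable_jumps :
    {r | leftLim (rightInverse ψ S h) r < rightLim (rightInverse ψ S h) r}.Countable := by
  refine H.inv_mono.countable_not_continuousAt.mono ?_
  intro r hr hc
  rw [H.inv_mono.continuousAt_iff_leftLim_eq_rightLim] at hc
  exact absurd hc (ne_of_lt hr)

end IsTimeChange

end ImpulsiveDelay

/-! ### Absolutely continuous functions, Gronwall's inequality, functions of bounded variation -/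

namespace ImpulsiveDelay

section AbsolutelyContinuous

variable {E : Type*} [NormedAddCommGroup E] [NormedSpace ℝ E]

lemma lipschitzOnWith_add_integral {F : ℝ → E} {a b C : ℝ} (c : E)
    (hF : IntegrableOn F (Icc a b)) (hC : ∀ᵐ s ∂volume.restrict (Icc a b), ‖F s‖ ≤ C) :
    LipschitzOnWith C.toNNReal (fun s => c + ∫ t in a..s, F t) (Icc a b) := by
  refine LipschitzOnWith.of_dist_le_mul fun s hs t ht => ?_
  have hI : ∀ {p q : ℝ}, p ∈ Icc a b → q ∈ Icc a b → IntervalIntegrable F volume p q := by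
    intro p q hp hq
    rw [intervalIntegrable_iff]
    refine hF.mono_set (uIoc_subset_uIcc.trans ?_)
    exact (convex_Icc a b).ordConnected.uIcc_subset hp hq
  have ha : a ∈ Icc a b := ⟨le_rfl, hs.1.trans hs.2⟩
  rw [dist_add_left, dist_eq_norm, intervalIntegral.integral_interval_sub_left (hI ha hs) (hI ha ht)]
  refine (intervalIntegral.norm_integral_le_of_norm_le_const_ae (C := C) ?_).trans ?_
  · rw [ae_restrict_iff' measurableSet_Icc] at hC
    filter_upwards [hC] with r hr hr'
    exact hr ((convex_Icc a b).ordConnected.uIcc_subset ht hs (uIoc_subset_uIcc hr'))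
  · rw [Real.dist_eq]
    exact mul_le_mul_of_nonneg_right (Real.le_coe_toNNReal C) (abs_nonneg _)

variable [CompleteSpace E]

lemma ae_hasDerivAt_add_integral {F : ℝ → E} {a b : ℝ} (c : E) (hab : a ≤ b)
    (hF : IntegrableOn F (Icc a b)) :
    ∀ᵐ s ∂volume.restrict (Icc a b), HasDerivAt (fun s => c + ∫ t in a..s, F t) (F s) s := by
  have hI : IntervalIntegrable F volume a b := by
    rw [intervalIntegrable_iff_integrableOn_Icc_of_le hab]; exact hF
  rw [ae_restrict_iff' measurableSet_Icc]
  filter_upwards [hI.ae_hasDerivAt_integral] with s hs hs'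
  rw [uIcc_of_le hab] at hs
  exact (hs hs' a ⟨le_rfl, hab⟩).const_add c

/-- Measurability of `F` comes for free, because `F` agrees almost everywhere with `deriv y`. -/
lemma integrableOn_of_ae_hasDerivAt {y F : ℝ → E} {a b C : ℝ}
    (hd : ∀ᵐ s ∂volume.restrict (Icc a b), HasDerivAt y (F s) s)
    (hC : ∀ᵐ s ∂volume.restrict (Icc a b), ‖F s‖ ≤ C) : IntegrableOn F (Icc a b) := by
  refine Integrable.of_bound ?_ C hC
  refine (aestronglyMeasurable_deriv y (volume.restrict (Icc a b))).congr ?_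
  exact hd.mono fun s hs => hs.deriv

/-- The fundamental theorem of calculus for an absolutely continuous function with essentially bounded
derivative. -/
lemma eq_add_integral_of_ae_hasDerivAt {y F : ℝ → E} {a b C : ℝ} (hab : a ≤ b)
    (hy : AbsolutelyContinuousOnInterval y a b)
    (hd : ∀ᵐ s ∂volume.restrict (Icc a b), HasDerivAt y (F s) s)
    (hC : ∀ᵐ s ∂volume.restrict (Icc a b), ‖F s‖ ≤ C) {s : ℝ} (hs : s ∈ Icc a b) :
    y s = y a + ∫ t in a..s, F t := by
  have hF := integrableOn_of_ae_hasDerivAt hd hC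
  have hL := lipschitzOnWith_add_integral 0 hF hC
  rw [← uIcc_of_le hab] at hL
  have hD := ae_hasDerivAt_add_integral 0 hab hF
  rw [ae_restrict_iff' measurableSet_Icc] at hd hD
  -- The difference of `y` and the primitive of `F` is absolutely continuous with derivative zero
  -- almost everywhere, hence constant.
  obtain ⟨K, hK⟩ := (hy.sub hL.absolutelyContinuousOnInterval).const_of_ae_hasDerivAt_zero (by
    rw [uIcc_of_le hab]
    filter_upwards [hd, hD] with s h1 h2 h3
    simpa using (h1 h3).sub (h2 h3))
  rw [uIcc_of_le hab] at hK
  have h1 := hK s hs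
  have h2 := hK a ⟨le_rfl, hab⟩
  simp only [Pi.sub_apply, intervalIntegral.integral_same, zero_add, sub_zero] at h1 h2
  rw [h2, ← h1]; abel

lemma lipschitzOnWith_of_ae_hasDerivAt {y F : ℝ → E} {a b C : ℝ} (hab : a ≤ b)
    (hy : AbsolutelyContinuousOnInterval y a b)
    (hd : ∀ᵐ s ∂volume.restrict (Icc a b), HasDerivAt y (F s) s)
    (hC : ∀ᵐ s ∂volume.restrict (Icc a b), ‖F s‖ ≤ C) :
    LipschitzOnWith C.toNNReal y (Icc a b) := by
  intro s hs t ht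
  rw [eq_add_integral_of_ae_hasDerivAt hab hy hd hC hs,
    eq_add_integral_of_ae_hasDerivAt hab hy hd hC ht]
  exact lipschitzOnWith_add_integral (y a) (integrableOn_of_ae_hasDerivAt hd hC) hC hs ht

/-- Gronwall's inequality in integral form, without inhomogeneous term. -/
lemma eq_zero_of_le_integral {u : ℝ → ℝ} {S K : ℝ} (hu : ContinuousOn u (Icc 0 S))
    (h0 : ∀ s ∈ Icc 0 S, 0 ≤ u s) (h : ∀ s ∈ Icc 0 S, u s ≤ K * ∫ t in (0 : ℝ)..s, u t) {s : ℝ}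
    (hs : s ∈ Icc 0 S) : u s = 0 := by
  have hS : 0 ≤ S := hs.1.trans hs.2
  have hint : ∀ {t}, t ∈ Icc 0 S → IntervalIntegrable u volume 0 t := fun {t} ht => by
    refine ContinuousOn.intervalIntegrable ?_
    rw [uIcc_of_le ht.1]; exact hu.mono (Icc_subset_Icc_right ht.2)
  have hU0 : ∀ t ∈ Icc 0 S, 0 ≤ ∫ r in (0 : ℝ)..t, u r := fun t ht =>
    intervalIntegral.integral_nonneg ht.1 fun r hr => h0 r ⟨hr.1, hr.2.trans ht.2⟩
  have hder : ∀ t ∈ Ico 0 S, HasDerivWithinAt (fun t => ∫ r in (0 : ℝ)..t, u r) (u t) (Ici t) t := by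
    intro t ht
    have ht' : t ∈ Icc 0 S := ⟨ht.1, ht.2.le⟩
    have hc : ContinuousWithinAt u (Ioi t) t :=
      (hu t ht').mono_of_mem_nhdsWithin
        (mem_of_superset (Ioo_mem_nhdsGT ht.2) fun r hr => ⟨ht.1.trans hr.1.le, hr.2.le⟩)
    refine intervalIntegral.integral_hasDerivWithinAt_right (hint ht') (t := Ioi t) ?_ hc
    refine ⟨Ioo t S, Ioo_mem_nhdsGT ht.2, ?_⟩
    exact ((hu.mono fun r hr => ⟨ht.1.trans hr.1.le, hr.2.le⟩).aestronglyMeasurable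
      measurableSet_Ioo)
  have hcont : ContinuousOn (fun t => ∫ r in (0 : ℝ)..t, u r) (Icc 0 S) := by
    have := intervalIntegral.continuousOn_primitive_interval' (hint ⟨hS, le_rfl⟩)
      (left_mem_uIcc)
    rwa [uIcc_of_le hS] at this
  -- Gronwall is applied to the primitive `U` of `u`: it vanishes at `0` and its right derivative
  -- `u` is at most `K * U`. Then `U = 0`, and the hypothesis forces `u = 0`.
  have key := norm_le_gronwallBound_of_norm_deriv_right_le (δ := 0) (K := K) (ε := 0) hcont hder
    (by simp) (fun t ht => by
      have ht' : t ∈ Icc 0 S := ⟨ht.1, ht.2.le⟩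
      rw [Real.norm_of_nonneg (h0 t ht'), Real.norm_of_nonneg (hU0 t ht'), add_zero]
      exact h t ht') s hs
  rw [gronwallBound_ε0_δ0, Real.norm_of_nonneg (hU0 s hs)] at key
  have h1 := h s hs
  have h2 : (∫ r in (0 : ℝ)..s, u r) = 0 := le_antisymm key (hU0 s hs)
  rw [h2, mul_zero] at h1
  exact le_antisymm h1 (h0 s hs)

end AbsolutelyContinuous

/-- A function of bounded variation on a compact interval agrees there with a measurable function. -/
lemma exists_measurable_eqOn {n : ℕ} {x : ℝ → State n} {a b : ℝ} (hab : a ≤ b)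
    (hx : BoundedVariationOn x (Icc a b)) : ∃ x', Measurable x' ∧ EqOn x x' (Icc a b) := by
  refine ⟨fun t => x (projIcc a b hab t), ?_, fun t ht => by
    simp [projIcc_of_mem hab ht]⟩
  -- Each coordinate is a difference of functions monotone on the interval; composing with the
  -- monotone projection onto the interval makes them monotone on the whole line, hence measurable.
  have hcoord : ∀ j, Measurable fun t => x (projIcc a b hab t) j := by
    intro j
    have hL : LipschitzWith 1 (fun v : State n => v j) := LipschitzWith.of_dist_le_mul fun v v' => by
      simpa [Real.dist_eq, dist_eq_norm] using PiLp.norm_apply_le (v - v') j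
    have hb : BoundedVariationOn (fun t => x t j) (Icc a b) := hL.comp_boundedVariationOn hx
    obtain ⟨p, q, hp, hq, e⟩ := hb.locallyBoundedVariationOn.exists_monotoneOn_sub_monotoneOn
    have hp' : Monotone fun t => p (projIcc a b hab t) := fun t t' htt =>
      hp (projIcc a b hab t).2 (projIcc a b hab t').2 (monotone_projIcc hab htt)
    have hq' : Monotone fun t => q (projIcc a b hab t) := fun t t' htt =>
      hq (projIcc a b hab t).2 (projIcc a b hab t').2 (monotone_projIcc hab htt)
    have : (fun t => x (projIcc a b hab t) j)
        = fun t => p (projIcc a b hab t) - q (projIcc a b hab t) := by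
      funext t
      exact congrFun e (projIcc a b hab t)
    rw [this]
    exact hp'.measurable.sub hq'.measurable
  exact (MeasurableEquiv.toLp 2 (Fin n → ℝ)).measurable.comp (measurable_pi_iff.2 hcoord)

end ImpulsiveDelay

/-! ### Densities on `[0, S]` and their images under a time change -/

namespace ImpulsiveDelay

/-- A measurable function on `[0, S]` with values in `[0, 1]` (up to null sets). -/
structure IsRate (β : ℝ → ℝ) (S : ℝ) : Prop where
  meas : AEMeasurable β (volume.restrict (Icc 0 S))
  nonneg : ∀ᵐ s ∂volume.restrict (Icc 0 S), 0 ≤ β s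
  le_one : ∀ᵐ s ∂volume.restrict (Icc 0 S), β s ≤ 1

namespace IsRate

variable {β : ℝ → ℝ} {S : ℝ} (H : IsRate β S)
include H

lemma norm_le : ∀ᵐ s ∂volume.restrict (Icc 0 S), ‖β s‖ ≤ 1 := by
  filter_upwards [H.nonneg, H.le_one] with s h0 h1
  rwa [Real.norm_of_nonneg h0]

lemma integrableOn : IntegrableOn β (Icc 0 S) :=
  Integrable.of_bound H.meas.aestronglyMeasurable 1 H.norm_le

lemma intervalIntegrable {a b : ℝ} (ha : a ∈ Icc 0 S) (hb : b ∈ Icc 0 S) :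
    IntervalIntegrable β volume a b := by
  rw [intervalIntegrable_iff]
  exact H.integrableOn.mono_set
    (uIoc_subset_uIcc.trans ((convex_Icc 0 S).ordConnected.uIcc_subset ha hb))

lemma ofReal_integral {A : Set ℝ} (hA : A ⊆ Icc 0 S) :
    ENNReal.ofReal (∫ s in A, β s) = ∫⁻ s in A, ENNReal.ofReal (β s) :=
  ofReal_integral_eq_lintegral_ofReal (H.integrableOn.mono_set hA)
    (ae_mono (Measure.restrict_mono hA le_rfl) H.nonneg)

end IsRate

lemma isRate_one (S : ℝ) : IsRate (fun _ => 1) S :=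
  ⟨aemeasurable_const, by simp, by simp⟩

/-- The image under `ψ` of the measure on `[0, S]` with density `β`. -/
noncomputable def pushDensity (ψ β : ℝ → ℝ) (S : ℝ) : Measure ℝ :=
  ((volume.restrict (Icc 0 S)).withDensity (fun s => ENNReal.ofReal (β s))).map ψ

section PushDensity

variable {ψ β : ℝ → ℝ} {S : ℝ}

lemma aemeasurable_of_restrict (hψ : AEMeasurable ψ (volume.restrict (Icc 0 S))) (β : ℝ → ℝ) :
    AEMeasurable ψ ((volume.restrict (Icc 0 S)).withDensity (fun s => ENNReal.ofReal (β s))) :=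
  hψ.mono_ac (withDensity_absolutelyContinuous _ _)

lemma pushDensity_apply (hψ : AEMeasurable ψ (volume.restrict (Icc 0 S))) {E : Set ℝ}
    (hE : MeasurableSet E) :
    pushDensity ψ β S E = ∫⁻ s in ψ ⁻¹' E ∩ Icc 0 S, ENNReal.ofReal (β s) := by
  rw [pushDensity, Measure.map_apply_of_aemeasurable (aemeasurable_of_restrict hψ β) hE,
    withDensity_apply', Measure.restrict_restrict' measurableSet_Icc]

lemma pushDensity_apply_ofReal (hψ : AEMeasurable ψ (volume.restrict (Icc 0 S)))
    (hβ : IsRate β S) {E : Set ℝ} (hE : MeasurableSet E) :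
    pushDensity ψ β S E = ENNReal.ofReal (∫ s in ψ ⁻¹' E ∩ Icc 0 S, β s) := by
  rw [pushDensity_apply hψ hE, hβ.ofReal_integral inter_subset_right]

lemma setIntegral_rate_nonneg (hβ : IsRate β S) {A : Set ℝ} (hA : A ⊆ Icc 0 S) :
    0 ≤ ∫ s in A, β s :=
  setIntegral_nonneg_of_ae_restrict (ae_mono (Measure.restrict_mono hA le_rfl) hβ.nonneg)

lemma pushDensity_real (hψ : AEMeasurable ψ (volume.restrict (Icc 0 S)))
    (hβ : IsRate β S) {E : Set ℝ} (hE : MeasurableSet E) :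
    (pushDensity ψ β S).real E = ∫ s in ψ ⁻¹' E ∩ Icc 0 S, β s := by
  rw [Measure.real, pushDensity_apply_ofReal hψ hβ hE,
    ENNReal.toReal_ofReal (setIntegral_rate_nonneg hβ inter_subset_right)]

lemma isFiniteMeasure_pushDensity (hψ : AEMeasurable ψ (volume.restrict (Icc 0 S)))
    (hβ : IsRate β S) : IsFiniteMeasure (pushDensity ψ β S) :=
  ⟨by rw [pushDensity_apply_ofReal hψ hβ MeasurableSet.univ]; exact ENNReal.ofReal_lt_top⟩

lemma pushDensity_compl (hψ : AEMeasurable ψ (volume.restrict (Icc 0 S))) {E : Set ℝ}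
    (hE : MeasurableSet E) (hm : ∀ s ∈ Icc 0 S, ψ s ∈ E) : pushDensity ψ β S Eᶜ = 0 := by
  rw [pushDensity_apply hψ hE.compl]
  have : ψ ⁻¹' Eᶜ ∩ Icc 0 S = ∅ := by
    ext s
    simp only [mem_inter_iff, mem_preimage, mem_compl_iff, mem_empty_iff_false, iff_false]
    exact fun h => h.1 (hm s h.2)
  rw [this]; simp

lemma setIntegral_pushDensity {F : Type*} [NormedAddCommGroup F] [NormedSpace ℝ F]
    (hψ : AEMeasurable ψ (volume.restrict (Icc 0 S)))
    (hβ : IsRate β S) {E : Set ℝ} (hE : MeasurableSet E) {k : ℝ → F}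
    (hk : AEStronglyMeasurable k (pushDensity ψ β S)) :
    ∫ r in E, k r ∂(pushDensity ψ β S) = ∫ s in ψ ⁻¹' E ∩ Icc 0 S, β s • k (ψ s) := by
  rw [pushDensity, setIntegral_map hE hk (aemeasurable_of_restrict hψ β), restrict_withDensity',
    Measure.restrict_restrict' measurableSet_Icc,
    integral_withDensity_eq_integral_toReal_smul₀ _ (by simp)]
  · have : ∀ᵐ s ∂volume.restrict (ψ ⁻¹' E ∩ Icc 0 S), 0 ≤ β s :=
      ae_mono (Measure.restrict_mono (inter_subset_right : ψ ⁻¹' E ∩ Icc 0 S ⊆ _) le_rfl)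
      hβ.nonneg
    refine integral_congr_ae (this.mono fun s hs => ?_)
    simp only [ENNReal.toReal_ofReal hs]
  · exact (hβ.meas.mono_measure (Measure.restrict_mono inter_subset_right le_rfl)).ennreal_ofReal

end PushDensity

namespace IsTimeChange

variable {ψ : ℝ → ℝ} {S h : ℝ} (H : IsTimeChange ψ S h)
include H

lemma aemeasurable : AEMeasurable ψ (volume.restrict (Icc 0 S)) :=
  H.cont.aemeasurable measurableSet_Icc

lemma preimage_singleton {r : ℝ} (hr : r ∈ Icc 0 h) : ψ ⁻¹' {r} ∩ Icc 0 S =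
    Icc (leftLim (rightInverse ψ S h) r) (rightLim (rightInverse ψ S h) r) := by
  ext s
  constructor
  · rintro ⟨h1, h2⟩; exact (H.eq_iff hr h2).1 h1
  · intro h1
    have h2 := H.Icc_inv_subset r h1
    exact ⟨(H.eq_iff hr h2).2 h1, h2⟩

lemma preimage_Icc {r : ℝ} (hr : r ∈ Icc 0 h) : ψ ⁻¹' Icc 0 r ∩ Icc 0 S =
    Icc 0 (rightLim (rightInverse ψ S h) r) := by
  ext s
  constructor
  · rintro ⟨h1, h2⟩; exact ⟨h2.1, (H.le_inv_rightLim_iff hr h2).2 h1.2⟩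
  · intro h1
    have h2 : s ∈ Icc 0 S := ⟨h1.1, h1.2.trans (H.inv_rightLim_mem r).2⟩
    exact ⟨⟨(H.maps h2).1, (H.le_inv_rightLim_iff hr h2).1 h1.2⟩, h2⟩

lemma preimage_Ioc {r r' : ℝ} (hr : r ∈ Icc 0 h) (hr' : r' ∈ Icc 0 h) : ψ ⁻¹' Ioc r r' ∩ Icc 0 S =
    Ioc (rightLim (rightInverse ψ S h) r) (rightLim (rightInverse ψ S h) r') := by
  ext s
  constructor
  · rintro ⟨h1, h2⟩
    exact ⟨not_le.1 fun h3 => absurd ((H.le_inv_rightLim_iff hr h2).1 h3) (not_le.2 h1.1),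
      (H.le_inv_rightLim_iff hr' h2).2 h1.2⟩
  · intro h1
    have h2 : s ∈ Icc 0 S :=
      ⟨(H.inv_rightLim_mem r).1.trans h1.1.le, h1.2.trans (H.inv_rightLim_mem r').2⟩
    exact ⟨⟨not_le.1 fun h3 => absurd ((H.le_inv_rightLim_iff hr h2).2 h3) (not_le.2 h1.1),
      (H.le_inv_rightLim_iff hr' h2).1 h1.2⟩, h2⟩

lemma pushDensity_singleton {β : ℝ → ℝ} (hβ : IsRate β S) {r : ℝ} (hr : r ∈ Icc 0 h) :
    (pushDensity ψ β S).real {r} = ∫ s in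
      leftLim (rightInverse ψ S h) r..rightLim (rightInverse ψ S h) r, β s := by
  rw [pushDensity_real H.aemeasurable hβ (measurableSet_singleton r), H.preimage_singleton hr,
    integral_Icc_eq_integral_Ioc, intervalIntegral.integral_of_le (H.leftLim_le_rightLim r)]

end IsTimeChange

/-- A rate `u` whose primitive maps `[0, S]` onto `[0, h]`. -/
structure IsClock (u : ℝ → ℝ) (S h : ℝ) : Prop extends IsRate u S where
  S_pos : 0 < S
  h_pos : 0 < h
  time : ∫ s in (0 : ℝ)..S, u s = h

/-- The primitive of `u` vanishing at `0`. -/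
noncomputable def primitive (u : ℝ → ℝ) (s : ℝ) : ℝ := ∫ t in (0 : ℝ)..s, u t

namespace IsClock

variable {u : ℝ → ℝ} {S h : ℝ} (H : IsClock u S h)
include H

lemma isTimeChange : IsTimeChange (primitive u) S h where
  S_pos := H.S_pos
  h_pos := H.h_pos
  map_zero := by simp [primitive]
  map_end := H.time
  cont := by
    have hL := lipschitzOnWith_add_integral 0 H.integrableOn H.norm_le
    simp only [zero_add] at hL
    exact hL.continuousOn
  mono := by
    intro s hs t ht hst
    have h0 : (0 : ℝ) ∈ Icc 0 S := ⟨le_rfl, H.S_pos.le⟩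
    have := intervalIntegral.integral_add_adjacent_intervals (H.intervalIntegrable h0 hs)
      (H.intervalIntegrable hs ht)
    have h2 : 0 ≤ ∫ r in s..t, u r := by
      rw [intervalIntegral.integral_of_le hst]
      exact setIntegral_rate_nonneg H.toIsRate fun r hr => ⟨hs.1.trans hr.1.le, hr.2.trans ht.2⟩
    simp only [primitive]
    linarith

/-- The substitution `r = ψ s`, `dr = u ds`, checked on distribution functions: the set `ψ ≤ r` is
the interval from `0` to `σ⁺(r)`, over which `u` has integral `ψ (σ⁺(r)) = r`. -/
lemma pushDensity_primitive : pushDensity (primitive u) u S = volume.restrict (Icc 0 h) := by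
  have HT := H.isTimeChange
  have := isFiniteMeasure_pushDensity HT.aemeasurable H.toIsRate
  refine Measure.ext_of_Iic _ _ fun r => ?_
  rcases lt_or_ge r 0 with hr | hr
  · have h1 : primitive u ⁻¹' Iic r ∩ Icc 0 S = ∅ := by
      ext s
      simp only [mem_inter_iff, mem_preimage, mem_Iic, mem_empty_iff_false, iff_false]
      rintro ⟨h1, h2⟩
      linarith [(HT.maps h2).1]
    have h2 : Iic r ∩ Icc 0 h = ∅ := by
      ext s
      simp only [mem_inter_iff, mem_Iic, mem_Icc, mem_empty_iff_false, iff_false]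
      rintro ⟨h1, h2, _⟩
      linarith
    rw [pushDensity_apply HT.aemeasurable measurableSet_Iic, Measure.restrict_apply measurableSet_Iic,
      h1, h2]
    simp
  · have hm : min r h ∈ Icc 0 h := ⟨le_min hr H.h_pos.le, min_le_right _ _⟩
    have h1 : primitive u ⁻¹' Iic r ∩ Icc 0 S = primitive u ⁻¹' Icc 0 (min r h) ∩ Icc 0 S := by
      ext s
      simp only [mem_inter_iff, mem_preimage, mem_Iic, mem_Icc (a := (0 : ℝ)) (b := min r h), le_min_iff]
      constructor
      · rintro ⟨h1, h2⟩; exact ⟨⟨(HT.maps h2).1, h1, (HT.maps h2).2⟩, h2⟩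
      · rintro ⟨h1, h2⟩; exact ⟨h1.2.1, h2⟩
    have h2 : Iic r ∩ Icc 0 h = Icc 0 (min r h) := by
      ext s
      simp only [mem_inter_iff, mem_Iic, mem_Icc, le_min_iff]
      tauto
    rw [pushDensity_apply_ofReal HT.aemeasurable H.toIsRate measurableSet_Iic,
      Measure.restrict_apply measurableSet_Iic, h1, h2, HT.preimage_Icc hm, Real.volume_Icc, sub_zero,
      integral_Icc_eq_integral_Ioc, ← intervalIntegral.integral_of_le (HT.inv_rightLim_mem _).1]
    congr 1
    exact HT.comp_inv_rightLim hm

/-- The primitive is constant on its level set, so the nonnegative `u` has integral zero there. For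
`u = 1 - ∑ α_i` this says that the controls sum to one during a jump. -/
lemma ae_eq_zero {r : ℝ} (hr : r ∈ Icc 0 h) : ∀ᵐ s ∂volume.restrict
    (Icc (leftLim (rightInverse (primitive u) S h) r) (rightLim (rightInverse (primitive u) S h) r)),
      u s = 0 := by
  have HT := H.isTimeChange
  have hsub := HT.Icc_inv_subset r
  have h0 : (0 : ℝ) ∈ Icc 0 S := ⟨le_rfl, H.S_pos.le⟩
  have hI := intervalIntegral.integral_add_adjacent_intervals
    (H.intervalIntegrable h0 (HT.inv_leftLim_mem r))
    (H.intervalIntegrable (HT.inv_leftLim_mem r) (HT.inv_rightLim_mem r))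
  have e1 := HT.comp_inv_leftLim hr
  have e2 := HT.comp_inv_rightLim hr
  simp only [primitive] at e1 e2 hI
  have e3 : (∫ s in leftLim (rightInverse (primitive u) S h) r..
      rightLim (rightInverse (primitive u) S h) r, u s) = 0 := by
    linarith
  rw [intervalIntegral.integral_of_le (HT.leftLim_le_rightLim r), ← integral_Icc_eq_integral_Ioc] at e3
  exact (setIntegral_eq_zero_iff_of_nonneg_ae
    (ae_mono (Measure.restrict_mono hsub le_rfl) H.nonneg) (H.integrableOn.mono_set hsub)).1 e3

end IsClock

/-! ### Atoms -/

lemma measure_eq_zero_of_countable {m : Measure ℝ} {A : Set ℝ} (hA : A.Countable)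
    (h0 : ∀ a ∈ A, m {a} = 0) : m A = 0 := by
  rw [← biUnion_of_singleton A]
  exact (measure_biUnion_null_iff hA).2 h0

lemma countable_atoms (m : Measure ℝ) [IsFiniteMeasure m] : {t | m {t} = 0}ᶜ.Countable := by
  refine (Measure.countable_meas_pos_of_disjoint_iUnion (μ := m) (As := fun t : ℝ => {t})
    (fun t => measurableSet_singleton t) (fun a b hab => by simpa using hab)).mono ?_
  intro t ht
  exact pos_iff_ne_zero.2 ht

/-- The continuous component is obtained by removing any countable set that contains all atoms. -/
lemma contPart_eq_restrict_compl {m : Measure ℝ} [IsFiniteMeasure m] {A : Set ℝ}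
    (hA : A.Countable) (h : ∀ t ∉ A, m {t} = 0) : contPart m = m.restrict Aᶜ := by
  refine Measure.restrict_congr_set ?_
  have hsub : Aᶜ ⊆ {t | m {t} = 0} := fun t ht => h t ht
  refine EventuallyEq.symm (ae_eq_set.2 ⟨by rw [sdiff_eq_empty.2 hsub]; simp, ?_⟩)
  refine measure_eq_zero_of_countable (hA.mono fun t ht => ?_) fun t ht => ht.1
  exact not_not.1 ht.2

lemma contPart_singleton (m : Measure ℝ) (t : ℝ) : contPart m {t} = 0 := by
  rw [contPart, Measure.restrict_apply (measurableSet_singleton t)]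
  by_cases h : m {t} = 0
  · exact measure_mono_null inter_subset_left h
  · have : {t} ∩ {t | m {t} = 0} = ∅ := by
      ext s
      simp only [mem_inter_iff, mem_singleton_iff, mem_ofPred_eq, mem_empty_iff_false, iff_false]
      rintro ⟨rfl, h'⟩; exact h h'
    rw [this]; simp

end ImpulsiveDelay

/-! ### Decomposition of integrals along a time change -/

namespace ImpulsiveDelay

/-- For the measure with density `b`, measurability of `k` says nothing where `b` vanishes; but the
product is zero there, so nothing is lost after multiplication. -/
lemma IsRate.aestronglyMeasurable_smul {E : Type*} [NormedAddCommGroup E] [NormedSpace ℝ E]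
    {b : ℝ → ℝ} {S : ℝ} (hb : IsRate b S) {k : ℝ → E} (hk : AEStronglyMeasurable k
      ((volume.restrict (Icc 0 S)).withDensity (fun s => ENNReal.ofReal (b s)))) :
    AEStronglyMeasurable (fun s => b s • k s) (volume.restrict (Icc 0 S)) := by
  rw [withDensity_congr_ae (g := fun s => ((hb.meas.mk b s).toNNReal : ENNReal))
    (hb.meas.ae_eq_mk.mono fun s hs => by
      change ENNReal.ofReal (b s) = ENNReal.ofReal _
      rw [hs]),
    aestronglyMeasurable_withDensity_iff hb.meas.measurable_mk.real_toNNReal] at hk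
  refine hk.congr ?_
  filter_upwards [hb.meas.ae_eq_mk, hb.nonneg] with s h1 h2
  rw [← h1, Real.coe_toNNReal _ h2]

namespace IsTimeChange

variable {ψ : ℝ → ℝ} {S h : ℝ} (H : IsTimeChange ψ S h)
include H

lemma preimage_inter_eq_biUnion {B : Set ℝ} (hB : B ⊆ Icc 0 h) : ψ ⁻¹' B ∩ Icc 0 S =
    ⋃ r ∈ B, Icc (leftLim (rightInverse ψ S h) r) (rightLim (rightInverse ψ S h) r) := by
  ext s
  simp only [mem_iUnion, exists_prop, mem_inter_iff, mem_preimage]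
  constructor
  · rintro ⟨h1, h2⟩; exact ⟨ψ s, h1, (H.eq_iff (hB h1) h2).1 rfl⟩
  · rintro ⟨r, h1, h2⟩
    have h3 := H.Icc_inv_subset r h2
    rw [(H.eq_iff (hB h1) h3).2 h2]
    exact ⟨h1, h3⟩

lemma measurableSet_preimage_of_countable {B : Set ℝ} (hB : B ⊆ Icc 0 h) (hc : B.Countable) :
    MeasurableSet (ψ ⁻¹' B ∩ Icc 0 S) := by
  rw [H.preimage_inter_eq_biUnion hB]
  exact MeasurableSet.biUnion hc fun _ _ => measurableSet_Icc

lemma pushDensity_singleton_eq_zero {β : ℝ → ℝ} {r : ℝ}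
    (hr : ¬ leftLim (rightInverse ψ S h) r < rightLim (rightInverse ψ S h) r) :
    pushDensity ψ β S {r} = 0 := by
  rw [pushDensity_apply H.aemeasurable (measurableSet_singleton r)]
  by_cases h1 : r ∈ Icc 0 h
  · rw [H.preimage_singleton h1, le_antisymm (H.leftLim_le_rightLim r) (not_lt.1 hr), Icc_self]
    simp
  · have : ψ ⁻¹' {r} ∩ Icc 0 S = ∅ := by
      ext s
      simp only [mem_inter_iff, mem_preimage, mem_singleton_iff, mem_empty_iff_false, iff_false]
      rintro ⟨rfl, h2⟩; exact h1 (H.maps h2)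
    rw [this]; simp

lemma integral_preimage_countable {E : Type*} [NormedAddCommGroup E] [NormedSpace ℝ E] {F : ℝ → E}
    (hF : IntegrableOn F (Icc 0 S)) {B : Set ℝ} (hB : B ⊆ Icc 0 h) (hc : B.Countable) :
    ∫ s in ψ ⁻¹' B ∩ Icc 0 S, F s = ∑' r : B, ∫ s in
      leftLim (rightInverse ψ S h) r..rightLim (rightInverse ψ S h) r, F s := by
  have := hc.to_subtype
  have hI : IntegrableOn F (⋃ r : B, Icc (leftLim (rightInverse ψ S h) r)
      (rightLim (rightInverse ψ S h) r)) :=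
    hF.mono_set (iUnion_subset fun r => H.Icc_inv_subset r)
  rw [H.preimage_inter_eq_biUnion hB, biUnion_eq_iUnion,
    integral_iUnion (fun r => measurableSet_Icc) ?_ hI]
  · refine tsum_congr fun r => ?_
    rw [integral_Icc_eq_integral_Ioc, intervalIntegral.integral_of_le (H.leftLim_le_rightLim _)]
  · intro r r' hrr
    refine Set.disjoint_left.2 fun s h1 h2 => hrr (Subtype.ext ?_)
    have h3 := H.Icc_inv_subset r h1
    rw [← (H.eq_iff (hB r.2) h3).2 h1, ← (H.eq_iff (hB r'.2) h3).2 h2]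

end IsTimeChange

lemma tsum_subtype_eq_of_forall_eq_zero {E : Type*} [AddCommMonoid E] [TopologicalSpace E]
    {A B : Set ℝ} (hBA : B ⊆ A) (f : ℝ → E) (h0 : ∀ r ∈ A, r ∉ B → f r = 0) :
    ∑' r : A, f r = ∑' r : B, f r := by
  rw [tsum_subtype, tsum_subtype]
  refine tsum_congr fun r => ?_
  by_cases hB : r ∈ B
  · rw [indicator_of_mem hB, indicator_of_mem (hBA hB)]
  · rw [indicator_of_notMem hB]
    by_cases hA : r ∈ A
    · rw [indicator_of_mem hA, h0 r hA hB]
    · rw [indicator_of_notMem hA]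

/-- Decomposition of an integral over `[0, S]` into a part which is an integral with respect to the
Lebesgue measure on `[0, h]`, a part which is an integral with respect to the continuous component of
the image measure, and a sum over the flat parts of the change of variable. -/
lemma IsClock.integral_decomposition {u β : ℝ → ℝ} {S h : ℝ} (H : IsClock u S h) (hβ : IsRate β S)
    {E : Type*} [NormedAddCommGroup E] [NormedSpace ℝ E] {F kf kg : ℝ → E} {C : ℝ}
    (hF : IntegrableOn F (Icc 0 S))
    (hkf : AEStronglyMeasurable kf (volume.restrict (Icc 0 h)))
    (hkg : AEStronglyMeasurable kg (pushDensity (primitive u) β S))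
    (hkfC : ∀ r, ‖kf r‖ ≤ C) (hkgC : ∀ r, ‖kg r‖ ≤ C)
    (hFk : ∀ᵐ s ∂volume.restrict (Icc 0 S),
      ¬ leftLim (rightInverse (primitive u) S h) (primitive u s)
        < rightLim (rightInverse (primitive u) S h) (primitive u s) →
      F s = u s • kf (primitive u s) + β s • kg (primitive u s))
    {r : ℝ} (hr : r ∈ Icc 0 h) :
    ∫ s in rightLim (rightInverse (primitive u) S h) 0..
        rightLim (rightInverse (primitive u) S h) r, F s
      = (∫ t in (0 : ℝ)..r, kf t)
        + (∫ t in Icc 0 r, kg t ∂contPart (pushDensity (primitive u) β S))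
        + ∑' q : Ioc 0 r, ∫ s in leftLim (rightInverse (primitive u) S h) q..
            rightLim (rightInverse (primitive u) S h) q, F s := by
  have HT := H.isTimeChange
  have h0 : (0 : ℝ) ∈ Icc 0 h := ⟨le_rfl, H.h_pos.le⟩
  set ψ := primitive u with hψ
  set σ := rightInverse ψ S h with hσ
  set A : Set ℝ := {q | leftLim σ q < rightLim σ q} with hA
  have hAc : A.Countable := HT.countable_jumps
  have hsub : Ioc 0 r ⊆ Icc 0 h := fun q hq => ⟨hq.1.le, hq.2.trans hr.2⟩
  have hB : Ioc 0 r ∩ A ⊆ Icc 0 h := inter_subset_left.trans hsub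
  have hBc : (Ioc 0 r ∩ A).Countable := hAc.mono inter_subset_right
  have hG : MeasurableSet (Ioc 0 r \ A) := measurableSet_Ioc.diff hAc.measurableSet
  -- These times are the preimage of `]0, r]`. Cut along the jump set `A`, it is a countable union
  -- of flat parts, which yields the sum, and a remainder on which `F` has the product form of
  -- `hFk`.
  have hIeq : Ioc (rightLim σ 0) (rightLim σ r)
      = (ψ ⁻¹' (Ioc 0 r ∩ A) ∩ Icc 0 S) ∪ (ψ ⁻¹' (Ioc 0 r \ A) ∩ Icc 0 S) := by
    rw [← HT.preimage_Ioc h0 hr, ← union_inter_distrib_right, ← preimage_union, inter_union_sdiff]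
  have hDm := HT.measurableSet_preimage_of_countable hB hBc
  have hdisj : Disjoint (ψ ⁻¹' (Ioc 0 r ∩ A) ∩ Icc 0 S) (ψ ⁻¹' (Ioc 0 r \ A) ∩ Icc 0 S) :=
    Set.disjoint_left.2 fun s h1 h2 => h2.1.2 h1.1.2
  have hGm : MeasurableSet (ψ ⁻¹' (Ioc 0 r \ A) ∩ Icc 0 S) := by
    have : ψ ⁻¹' (Ioc 0 r \ A) ∩ Icc 0 S
        = Ioc (rightLim σ 0) (rightLim σ r) \ (ψ ⁻¹' (Ioc 0 r ∩ A) ∩ Icc 0 S) := by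
      rw [hIeq, union_sdiff_left, hdisj.symm.sdiff_eq_left]
    rw [this]
    exact measurableSet_Ioc.diff hDm
  rw [intervalIntegral.integral_of_le (HT.inv_mono.rightLim hr.1), hIeq,
    setIntegral_union hdisj hGm (hF.mono_set inter_subset_right) (hF.mono_set inter_subset_right),
    HT.integral_preimage_countable hF hB hBc, add_comm]
  congr 1
  · have hfin := isFiniteMeasure_pushDensity HT.aemeasurable hβ
    have hsm : ψ ⁻¹' (Ioc 0 r \ A) ∩ Icc 0 S ⊆ Icc 0 S := inter_subset_right
    have hmono := Measure.restrict_mono hsm (le_refl (volume : Measure ℝ))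
    have hkf' : AEStronglyMeasurable kf (pushDensity ψ u S) := by
      rw [H.pushDensity_primitive]; exact hkf
    have hcomp : ∀ {k : ℝ → E} {b : ℝ → ℝ}, IsRate b S → AEStronglyMeasurable k (pushDensity ψ b S) →
        (∀ r, ‖k r‖ ≤ C) → IntegrableOn (fun s => b s • k (ψ s)) (Icc 0 S) := by
      intro k b hb hk hkC
      have h1 : AEStronglyMeasurable (fun s => b s • k (ψ s)) (volume.restrict (Icc 0 S)) := by
        have h2 : AEStronglyMeasurable (fun s => k (ψ s))
            ((volume.restrict (Icc 0 S)).withDensity (fun s => ENNReal.ofReal (b s))) :=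
          hk.comp_aemeasurable (aemeasurable_of_restrict HT.aemeasurable b)
        exact hb.aestronglyMeasurable_smul h2
      refine Integrable.of_bound h1 C ?_
      filter_upwards [hb.norm_le] with s hs
      rw [norm_smul]
      have := norm_nonneg (k (ψ s))
      nlinarith [hkC (ψ s), norm_nonneg (b s)]
    have e1 : ∫ s in ψ ⁻¹' (Ioc 0 r \ A) ∩ Icc 0 S, F s = ∫ s in ψ ⁻¹' (Ioc 0 r \ A) ∩ Icc 0 S,
        (u s • kf (ψ s) + β s • kg (ψ s)) := by
      refine integral_congr_ae ?_
      have h2 := ae_restrict_mem (μ := volume) hGm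
      filter_upwards [ae_mono hmono hFk, h2] with s hs hs'
      exact hs hs'.1.2
    rw [e1, integral_add ((hcomp H.toIsRate hkf' hkfC).mono_set hsm)
      ((hcomp hβ hkg hkgC).mono_set hsm), ← setIntegral_pushDensity HT.aemeasurable H.toIsRate hG hkf',
      ← setIntegral_pushDensity HT.aemeasurable hβ hG hkg, H.pushDensity_primitive]
    -- On the remainder both integrals are taken over `]0, r]` minus `A`. Removing the countable `A`
    -- does not affect Lebesgue measure; since all atoms of the image measure lie in `A`, it turns
    -- that measure into its continuous part.
    congr 1
    · rw [Measure.restrict_restrict hG, inter_eq_left.2 (sdiff_subset.trans hsub),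
        intervalIntegral.integral_of_le hr.1]
      refine setIntegral_congr_set (ae_eq_set.2 ⟨?_, ?_⟩)
      · rw [sdiff_eq_empty.2 sdiff_subset]; simp
      · rw [Set.sdiff_sdiff_right_self]
        exact (hAc.mono inter_subset_right).measure_zero _
    · rw [integral_Icc_eq_integral_Ioc' (contPart_singleton _ _),
        contPart_eq_restrict_compl hAc (fun t ht => HT.pushDensity_singleton_eq_zero ht),
        Measure.restrict_restrict measurableSet_Ioc, sdiff_eq]
  · exact (tsum_subtype_eq_of_forall_eq_zero inter_subset_left
      (fun q => ∫ s in leftLim σ q..rightLim σ q, F s) fun q hq hq' => by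
        have : leftLim σ q = rightLim σ q :=
          le_antisymm (HT.leftLim_le_rightLim q) (not_lt.1 fun h => hq' ⟨hq, h⟩)
        simp [this]).symm

end ImpulsiveDelay

/-! ### The change of variable `φ` as a right inverse, and the controls as densities -/

namespace ImpulsiveDelay

lemma lintegral_pushDensity {ψ β : ℝ → ℝ} {S : ℝ}
    (hψ : AEMeasurable ψ (volume.restrict (Icc 0 S)))
    (hβ : IsRate β S) {k : ℝ → ENNReal} (hk : Measurable k) :
    ∫⁻ r, k r ∂pushDensity ψ β S
      = ∫⁻ s in Icc 0 S, ENNReal.ofReal (β s) * k (ψ s) := by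
  rw [pushDensity, lintegral_map' hk.aemeasurable (aemeasurable_of_restrict hψ β),
    lintegral_withDensity_eq_lintegral_mul₀ hβ.meas.ennreal_ofReal
      (g := fun s => k (ψ s)) (hk.comp_aemeasurable hψ)]
  rfl

lemma pushDensity_one {ψ : ℝ → ℝ} {S : ℝ} :
    pushDensity ψ (fun _ => 1) S = (volume.restrict (Icc 0 S)).map ψ := by
  rw [pushDensity]
  simp only [ENNReal.ofReal_one]
  congr 1
  exact withDensity_one

lemma pushDensity_add_sum {N : ℕ} {ψ : ℝ → ℝ} {S : ℝ} {α : Fin N → ℝ → ℝ}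
    (hψ : AEMeasurable ψ (volume.restrict (Icc 0 S)))
    (hα : ∀ i, IsRate (α i) S) (hu : IsRate (fun s => 1 - ∑ i, α i s) S) :
    pushDensity ψ (fun s => 1 - ∑ i, α i s) S + ∑ i, pushDensity ψ (α i) S
      = pushDensity ψ (fun _ => 1) S := by
  ext E hE
  simp only [Measure.add_apply, Measure.finsetSum_apply, pushDensity_apply hψ hE]
  have hm : ∀ {b}, IsRate b S →
      AEMeasurable (fun s => ENNReal.ofReal (b s)) (volume.restrict (ψ ⁻¹' E ∩ Icc 0 S)) :=
    fun hb => (hb.meas.mono_measure (Measure.restrict_mono inter_subset_right le_rfl)).ennreal_ofReal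
  rw [← lintegral_finsetSum' _ fun i _ => hm (hα i), ← lintegral_add_left' (hm hu)]
  have hmono := Measure.restrict_mono (inter_subset_right : ψ ⁻¹' E ∩ Icc 0 S ⊆ _)
    (le_refl (volume : Measure ℝ))
  have h1 : ∀ᵐ s ∂volume.restrict (ψ ⁻¹' E ∩ Icc 0 S), ∀ i, 0 ≤ α i s :=
    ae_all_iff.2 fun i => ae_mono hmono (hα i).nonneg
  have h2 : ∀ᵐ s ∂volume.restrict (ψ ⁻¹' E ∩ Icc 0 S), 0 ≤ 1 - ∑ i, α i s := ae_mono hmono hu.nonneg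
  refine lintegral_congr_ae ?_
  filter_upwards [h1, h2] with s h3 h4
  rw [← ENNReal.ofReal_sum_of_nonneg fun i _ => h3 i,
    ← ENNReal.ofReal_add h4 (Finset.sum_nonneg fun i _ => h3 i)]
  simp

section Matching

variable {N : ℕ} {h S : ℝ} {μ : Measure ℝ} {w : ℝ → Fin N → ℝ → ℝ} {α : Fin N → ℝ → ℝ}

/-- The image measures under the change of variable `ψ` of the controls `α i` are the measures `μ_i` of
an impulsive control. -/
structure IsMatching (h : ℝ) (μ : Measure ℝ) (w : ℝ → Fin N → ℝ → ℝ) (S : ℝ)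
    (α : Fin N → ℝ → ℝ) : Prop where
  finite : IsFiniteMeasure μ
  rate : ∀ i, IsRate (α i) S
  clock : IsClock (fun s => 1 - ∑ i, α i s) S h
  seg : ∀ i, segMeasure h μ w i = pushDensity (primitive fun s => 1 - ∑ i, α i s) (α i) S

namespace IsMatching

variable (M : IsMatching h μ w S α)
include M

/-- The densities `1 - ∑ α_i` and `α_i` add up to one, and their images are Lebesgue measure and the
`μ_i`, whose sum is `dφ`. -/
lemma phiMeasure_eq : phiMeasure h μ w
    = pushDensity (primitive fun s => 1 - ∑ i, α i s) (fun _ => 1) S := by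
  rw [← pushDensity_add_sum M.clock.isTimeChange.aemeasurable M.rate M.clock.toIsRate,
    M.clock.pushDensity_primitive, phiMeasure]
  simp only [M.seg]

/-- For `0 < r ≤ h`, `φ r` is the mass of `[0, r]`, that is the length of the set `ψ ≤ r`, which is
`σ⁺(r) = σ r`. At `0`, where right continuity may fail, both functions vanish by convention. -/
lemma phi_eq : phi h μ w = rightInverse (primitive fun s => 1 - ∑ i, α i s) S h := by
  have HT := M.clock.isTimeChange
  have := M.finite
  have key : ∀ r ∈ Ioc 0 h, phi h μ w r = rightInverse (primitive fun s => 1 - ∑ i, α i s) S h r := by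
    intro r hr
    rw [← phiMeasure_Icc h μ w hr, M.phiMeasure_eq,
      pushDensity_real HT.aemeasurable (isRate_one S) measurableSet_Icc,
      HT.preimage_Icc ⟨hr.1.le, hr.2⟩, HT.inv_rightLim hr.1]
    simp [(HT.inv_mem r).1]
  funext r
  rcases le_or_gt r 0 with h0 | h0
  · rw [phi, if_pos h0, rightInverse_of_nonpos h0]
  rcases le_or_gt r h with h1 | h1
  · exact key r ⟨h0, h1⟩
  · rw [rightInverse_of_ge M.clock.h_pos h1.le, ← rightInverse_of_ge (A := primitive fun s => 1 -
      ∑ i, α i s) (a := S) M.clock.h_pos le_rfl, ← key h ⟨M.clock.h_pos, le_rfl⟩, phi, phi,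
      if_neg (not_le.2 h0), if_neg (not_le.2 M.clock.h_pos), min_eq_right h1.le, min_self]
    congr 1
    refine Finset.sum_congr rfl fun i _ => ?_
    rw [M.seg, pushDensity_real HT.aemeasurable (M.rate i) measurableSet_Icc,
      pushDensity_real HT.aemeasurable (M.rate i) measurableSet_Icc]
    congr 2
    ext s
    simp only [mem_inter_iff, mem_preimage]
    constructor
    · rintro ⟨_, h2⟩; exact ⟨HT.maps h2, h2⟩
    · rintro ⟨h3, h2⟩; exact ⟨⟨h3.1, h3.2.trans h1.le⟩, h2⟩

lemma phi_end : phi h μ w h = S := by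
  rw [M.phi_eq, rightInverse_of_ge M.clock.h_pos le_rfl]

lemma eta_eq {s : ℝ} (hs : s ∈ Icc 0 S) :
    eta h μ w s = primitive (fun s => 1 - ∑ i, α i s) s := by
  rw [eta, M.phi_end, M.phi_eq, M.clock.isTimeChange.inv_inv hs]

lemma mem_phiJumps {r : ℝ} : r ∈ phiJumps h μ w ↔ r ∈ Icc 0 h ∧
    leftLim (rightInverse (primitive fun s => 1 - ∑ i, α i s) S h) r
      < rightLim (rightInverse (primitive fun s => 1 - ∑ i, α i s) S h) r := by
  rw [phiJumps, M.phi_eq]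
  rfl

lemma mem_jumpSet {s : ℝ} (hs : s ∈ Icc 0 S) : s ∈ jumpSet h μ w ↔
    leftLim (rightInverse (primitive fun s => 1 - ∑ i, α i s) S h)
        (primitive (fun s => 1 - ∑ i, α i s) s)
      < rightLim (rightInverse (primitive fun s => 1 - ∑ i, α i s) S h)
        (primitive (fun s => 1 - ∑ i, α i s) s) := by
  have HT := M.clock.isTimeChange
  simp only [jumpSet, mem_iUnion, exists_prop, M.mem_phiJumps]
  rw [M.phi_eq]
  constructor
  · rintro ⟨r, ⟨h1, h2⟩, h3⟩
    rwa [(HT.eq_iff h1 hs).2 h3]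
  · intro h1
    exact ⟨_, ⟨HT.maps hs, h1⟩, (HT.eq_iff (HT.maps hs) hs).1 rfl⟩

lemma countable_phiJumps : (phiJumps h μ w).Countable := by
  refine M.clock.isTimeChange.countable_jumps.mono ?_
  intro r hr
  exact (M.mem_phiJumps.1 hr).2

lemma measurableSet_jumpSet : MeasurableSet (jumpSet h μ w) :=
  MeasurableSet.biUnion M.countable_phiJumps fun _ _ => measurableSet_Icc

/-- The controls are recovered from the Radon–Nikodym derivatives. -/
lemma contDensity_eq (i : Fin N) : ∀ᵐ s ∂volume.restrict (Icc 0 S), s ∉ jumpSet h μ w →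
    contDensity h μ w i (primitive (fun s => 1 - ∑ i, α i s) s) = α i s := by
  have HT := M.clock.isTimeChange
  have hfin := isFiniteMeasure_pushDensity HT.aemeasurable (M.rate i)
  have hfin1 := isFiniteMeasure_pushDensity HT.aemeasurable (isRate_one S)
  set ψ := primitive fun s => 1 - ∑ i, α i s with hψ
  set σ := rightInverse ψ S h with hσ
  set A : Set ℝ := {q | leftLim σ q < rightLim σ q} with hA
  have hAc : A.Countable := HT.countable_jumps
  set a' := (M.rate i).meas.mk (α i)
  have ha' : α i =ᵐ[volume.restrict (Icc 0 S)] a' := (M.rate i).meas.ae_eq_mk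
  -- The candidate density is `α_i ∘ σ` off the jump set: there `σ (ψ s) = s`, so composing it with
  -- `ψ` gives back `α_i`. It is measurable because `σ` is monotone.
  set a : ℝ → ENNReal := Aᶜ.indicator fun r => ENNReal.ofReal (a' (σ r)) with ha
  have ham : Measurable a :=
    (((M.rate i).meas.measurable_mk.comp HT.inv_mono.measurable).ennreal_ofReal).indicator
      hAc.measurableSet.compl
  have hval : ∀ s ∈ Icc 0 S, ψ s ∉ A → a (ψ s) = ENNReal.ofReal (a' s) := by
    intro s hs hn
    have e : σ (ψ s) = s := HT.inv_comp hs hn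
    rw [ha, indicator_of_mem (show ψ s ∈ Aᶜ from hn), e]
  have e1 : contPart (segMeasure h μ w i) = (phiMeasure h μ w).withDensity a := by
    rw [M.seg, M.phiMeasure_eq,
      contPart_eq_restrict_compl hAc (fun t ht => HT.pushDensity_singleton_eq_zero ht)]
    ext E hE
    rw [Measure.restrict_apply hE, withDensity_apply _ hE, ← lintegral_indicator hE,
      ← lintegral_indicator_one (hE.inter hAc.measurableSet.compl),
      lintegral_pushDensity HT.aemeasurable (M.rate i)
        (measurable_one.indicator (hE.inter hAc.measurableSet.compl)),
      lintegral_pushDensity HT.aemeasurable (isRate_one S) (ham.indicator hE)]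
    refine lintegral_congr_ae ?_
    filter_upwards [ha', ae_restrict_mem measurableSet_Icc] with s h1 h2
    by_cases h3 : ψ s ∈ E
    · by_cases h4 : ψ s ∈ A
      · rw [indicator_of_notMem (show ψ s ∉ E ∩ Aᶜ from fun h => h.2 h4), indicator_of_mem h3, ha,
          indicator_of_notMem (show ψ s ∉ Aᶜ from fun h => h h4)]
        simp
      · rw [indicator_of_mem (show ψ s ∈ E ∩ Aᶜ from ⟨h3, h4⟩), indicator_of_mem h3, hval s h2 h4,
          h1]
        simp
    · rw [indicator_of_notMem (show ψ s ∉ E ∩ Aᶜ from fun h => h3 h.1), indicator_of_notMem h3]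
      simp
  have hfin2 : IsFiniteMeasure (phiMeasure h μ w) := by rw [M.phiMeasure_eq]; exact hfin1
  -- Uniqueness of the Radon–Nikodym derivative holds almost everywhere for `dφ`; as `dφ` is the
  -- image of Lebesgue measure, the null set pulls back along `ψ` to a null set of `[0, S]`.
  have e2 := Measure.rnDeriv_withDensity (phiMeasure h μ w) ham
  rw [← e1, M.phiMeasure_eq, pushDensity_one] at e2
  have e3 := ae_of_ae_map HT.aemeasurable e2
  filter_upwards [e3, ha', (M.rate i).nonneg, ae_restrict_mem measurableSet_Icc] with s h1 h2 h3 h4 h5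
  rw [M.mem_jumpSet h4] at h5
  rw [contDensity, M.phiMeasure_eq, pushDensity_one, h1, hval s h4 h5, ← h2, ENNReal.toReal_ofReal h3]

end IsMatching

/-- A measure on `[0, N * h]` is the sum of its atoms at the nodes and its restrictions to the open
segments. -/
lemma eq_sum_nodes_add_sum_segments (hh : 0 < h) (hμ : μ (Icc 0 (N * h))ᶜ = 0) :
    μ = ∑ k : Fin (N + 1), μ {((k : ℕ) : ℝ) * h} • Measure.dirac (((k : ℕ) : ℝ) * h)
      + ∑ i : Fin N, μ.restrict (Ioo ((i : ℕ) * h) (((i : ℕ) + 1) * h)) := by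
  have hdisj : ∀ {a b : ℕ} {t : ℝ}, t ∈ Ioo (a * h) ((a + 1) * h) → t ∈ Ioo (b * h) ((b + 1) * h) →
      a ≤ b := by
    intro a b t h1 h2
    by_contra! h3
    have : ((b : ℝ) + 1) ≤ a := by exact_mod_cast h3
    nlinarith [h1.1, h2.2]
  set nodes : Set ℝ := ⋃ k : Fin (N + 1), {((k : ℕ) : ℝ) * h}
  set segs : Set ℝ := ⋃ i : Fin N, Ioo ((i : ℕ) * h) (((i : ℕ) + 1) * h)
  have hns : Disjoint nodes segs := by
    refine Set.disjoint_left.2 fun t h1 h2 => ?_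
    simp only [nodes, segs, mem_iUnion, mem_singleton_iff] at h1 h2
    obtain ⟨k, rfl⟩ := h1
    obtain ⟨i, h3, h4⟩ := h2
    have h5 : (i : ℕ) < (k : ℕ) := by exact_mod_cast lt_of_mul_lt_mul_right h3 hh.le
    have h6 : (k : ℕ) < (i : ℕ) + 1 := by exact_mod_cast lt_of_mul_lt_mul_right h4 hh.le
    omega
  have hsub : (nodes ∪ segs)ᶜ ⊆ (Icc 0 (N * h))ᶜ := by
    refine compl_subset_compl.2 fun t ht => ?_
    set k := ⌊t / h⌋₊ with hk
    have h1 : (k : ℝ) * h ≤ t := by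
      rw [← le_div_iff₀ hh]; exact Nat.floor_le (div_nonneg ht.1 hh.le)
    have h2 : t < ((k : ℝ) + 1) * h := by
      rw [← div_lt_iff₀ hh]; exact Nat.lt_floor_add_one _
    have h3 : k ≤ N := by
      have : (k : ℝ) ≤ N := le_of_mul_le_mul_right (h1.trans ht.2) hh
      exact_mod_cast this
    rcases h1.eq_or_lt with h4 | h4
    · exact Or.inl (mem_iUnion.2 ⟨⟨k, by omega⟩, h4.symm⟩)
    · have h5 : k < N := by
        have : (k : ℝ) < N := lt_of_mul_lt_mul_right (h4.trans_le ht.2) hh.le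
        exact_mod_cast this
      exact Or.inr (mem_iUnion.2 ⟨⟨k, h5⟩, h4, h2⟩)
  have hmN : MeasurableSet nodes := MeasurableSet.iUnion fun _ => measurableSet_singleton _
  have hmS : MeasurableSet segs := MeasurableSet.iUnion fun _ => measurableSet_Ioo
  have e0 : μ = μ.restrict (nodes ∪ segs) :=
    (Measure.restrict_eq_self_of_ae_mem (measure_mono_null hsub hμ)).symm
  conv_lhs => rw [e0, Measure.restrict_union hns hmS]
  congr 1
  · rw [Measure.restrict_iUnion _ fun k => measurableSet_singleton _, Measure.sum_fintype]
    · exact Finset.sum_congr rfl fun k _ => Measure.restrict_singleton _ _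
    · intro k k' hkk
      refine Set.disjoint_singleton.2 fun e => hkk (Fin.ext ?_)
      exact_mod_cast mul_right_cancel₀ hh.ne' e
  · rw [Measure.restrict_iUnion _ fun k => measurableSet_Ioo, Measure.sum_fintype]
    intro i j hij
    refine Set.disjoint_left.2 fun t h1 h2 => hij (Fin.ext ?_)
    exact le_antisymm (hdisj h1 h2) (hdisj h2 h1)

end Matching

/-- The measure of an impulsive control is the sum of the translates of the measures `μ_i`. -/
lemma IsImpulsiveControl.eq_sum_map_segMeasure {N : ℕ} {h : ℝ} {μ : Measure ℝ}
    {w : ℝ → Fin N → ℝ → ℝ} (hh : 0 < h) (H : IsImpulsiveControl N h μ w) :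
    μ = ∑ i : Fin N, (segMeasure h μ w i).map (fun t => t + (i : ℕ) * h) := by
  have := H.finite
  have h0m : (0 : ℝ) ∈ Icc 0 h := ⟨le_rfl, hh.le⟩
  have hhm : h ∈ Icc 0 h := ⟨hh.le, le_rfl⟩
  have hseg : ∀ i : Fin N, (segMeasure h μ w i).map (fun t => t + (i : ℕ) * h)
      = ENNReal.ofReal (∫ s in (0 : ℝ)..1, w 0 i s) • Measure.dirac ((i : ℕ) * h)
        + μ.restrict (Ioo ((i : ℕ) * h) (((i : ℕ) + 1) * h))
        + ENNReal.ofReal (∫ s in (0 : ℝ)..1, w h i s) • Measure.dirac (((i : ℕ) + 1) * h) := by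
    intro i
    have hm : Measurable fun t : ℝ => t + (i : ℕ) * h := by fun_prop
    have hm' : Measurable fun t : ℝ => t - (i : ℕ) * h := by fun_prop
    rw [segMeasure, Measure.map_add _ _ hm, Measure.map_add _ _ hm, Measure.map_smul,
      Measure.map_smul, Measure.map_dirac' hm, Measure.map_dirac' hm, Measure.map_map hm hm']
    have : (fun t : ℝ => t + (i : ℕ) * h) ∘ (fun t => t - (i : ℕ) * h) = id := by
      funext t; simp
    rw [this, Measure.map_id, zero_add, show h + (i : ℕ) * h = ((i : ℕ) + 1) * h by ring]
  have hnn : ∀ r ∈ Icc 0 h, ∀ i, 0 ≤ ∫ s in (0 : ℝ)..1, w r i s := fun r hr i =>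
    intervalIntegral.integral_nonneg zero_le_one fun s hs => H.nonneg r hr i s hs
  -- Integrability is not part of the definition of a control: the nonnegative entries have an
  -- almost everywhere constant sum, hence are bounded.
  have hint : ∀ r ∈ Icc 0 h, ∀ i, IntervalIntegrable (w r i) volume 0 1 := by
    intro r hr i
    rw [intervalIntegrable_iff_integrableOn_Icc_of_le zero_le_one]
    refine Integrable.of_bound (H.measurable r hr i).aestronglyMeasurable
      (∑ i, ∫ s' in (0 : ℝ)..1, w r i s') ?_
    filter_upwards [H.sum_const r hr, ae_restrict_mem measurableSet_Icc] with s h1 h2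
    rw [Real.norm_of_nonneg (H.nonneg r hr i s h2), ← h1]
    exact Finset.single_le_sum (f := fun i => w r i s) (fun j _ => H.nonneg r hr j s h2)
      (Finset.mem_univ i)
  -- The atom at a node is the end atom of the segment on its left plus the initial atom of the
  -- segment on its right. The zeros of `Fin.cons` and `Fin.snoc` stand for the missing neighbours
  -- of the first and last nodes.
  have hnode : ∀ k : Fin (N + 1), μ {((k : ℕ) : ℝ) * h}
      = (Fin.cons 0 (fun i => ENNReal.ofReal (∫ s in (0 : ℝ)..1, w h i s)) :
          Fin (N + 1) → ENNReal) k
        + (Fin.snoc (fun i => ENNReal.ofReal (∫ s in (0 : ℝ)..1, w 0 i s)) 0 :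
          Fin (N + 1) → ENNReal) k := by
    intro k
    have h1 := H.atom_node k
    rw [Measure.real] at h1
    rw [← ENNReal.ofReal_toReal (measure_ne_top μ {((k : ℕ) : ℝ) * h}), ← h1]
    have hc : IntervalIntegrable ((Fin.cons (fun _ => 0) (w h) : Fin (N + 1) → ℝ → ℝ) k)
        volume 0 1 ∧ 0 ≤ (∫ s in (0 : ℝ)..1,
          (Fin.cons (fun _ => 0) (w h) : Fin (N + 1) → ℝ → ℝ) k s) ∧
        (Fin.cons 0 (fun i => ENNReal.ofReal (∫ s in (0 : ℝ)..1, w h i s)) :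
          Fin (N + 1) → ENNReal) k = ENNReal.ofReal (∫ s in (0 : ℝ)..1,
          (Fin.cons (fun _ => 0) (w h) : Fin (N + 1) → ℝ → ℝ) k s) := by
      refine Fin.cases ?_ (fun i => ?_) k
      · simp
      · simpa using ⟨hint h hhm i, hnn h hhm i⟩
    have hs : IntervalIntegrable ((Fin.snoc (w 0) (fun _ => 0) : Fin (N + 1) → ℝ → ℝ) k)
        volume 0 1 ∧ 0 ≤ (∫ s in (0 : ℝ)..1,
          (Fin.snoc (w 0) (fun _ => 0) : Fin (N + 1) → ℝ → ℝ) k s) ∧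
        (Fin.snoc (fun i => ENNReal.ofReal (∫ s in (0 : ℝ)..1, w 0 i s)) 0 :
          Fin (N + 1) → ENNReal) k = ENNReal.ofReal (∫ s in (0 : ℝ)..1,
          (Fin.snoc (w 0) (fun _ => 0) : Fin (N + 1) → ℝ → ℝ) k s) := by
      refine Fin.lastCases ?_ (fun i => ?_) k
      · simp
      · simpa using ⟨hint 0 h0m i, hnn 0 h0m i⟩
    rw [intervalIntegral.integral_add hc.1 hs.1, ENNReal.ofReal_add hc.2.1 hs.2.1, hc.2.2, hs.2.2]
  conv_lhs => rw [eq_sum_nodes_add_sum_segments hh H.support]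
  simp only [hseg, hnode, add_smul, Finset.sum_add_distrib]
  -- Dropping the zero entry at each end turns the sum over nodes into two sums over segments, one
  -- for the end atoms and one for the initial atoms.
  rw [Fin.sum_univ_succ, Fin.sum_univ_castSucc (f := fun k => (Fin.snoc (α := fun _ => ENNReal)
    (fun i => ENNReal.ofReal (∫ s in (0 : ℝ)..1, w 0 i s)) 0 k : ENNReal) • Measure.dirac _)]
  simp only [Fin.cons_zero, Fin.cons_succ, Fin.snoc_castSucc, Fin.snoc_last, zero_smul, zero_add,
    add_zero, Fin.val_succ, Fin.val_castSucc, Nat.cast_add, Nat.cast_one]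
  abel

end ImpulsiveDelay

namespace ImpulsiveDelay

/-! ### Affine changes of variable -/

lemma ae_comp_affine {p : ℝ → Prop} (hp : ∀ᵐ s, p s) {c : ℝ} (hc : c ≠ 0) (d : ℝ) :
    ∀ᵐ s, p (d + s * c) := by
  rw [ae_iff] at hp ⊢
  have h1 : volume ((fun s => d + s) ⁻¹' {s | ¬ p s}) = 0 := by
    rw [measure_preimage_add]; exact hp
  have h2 := Real.volume_preimage_mul_right hc ((fun s => d + s) ⁻¹' {s | ¬ p s})
  rw [h1, mul_zero] at h2
  exact h2

lemma ae_Icc_zero_one_of_ae_Icc {a b : ℝ} (hab : a < b) {p : ℝ → Prop}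
    (hp : ∀ᵐ s ∂volume.restrict (Icc a b), p s) :
    ∀ᵐ t ∂volume.restrict (Icc (0 : ℝ) 1), p (a + t * (b - a)) := by
  rw [ae_restrict_iff' measurableSet_Icc] at hp ⊢
  filter_upwards [ae_comp_affine hp (sub_ne_zero.2 hab.ne') a] with t ht ht'
  refine ht ⟨?_, ?_⟩ <;> nlinarith [ht'.1, ht'.2]

lemma ae_Icc_of_ae_Icc_zero_one {a b : ℝ} (hab : a < b) {p : ℝ → Prop}
    (hp : ∀ᵐ t ∂volume.restrict (Icc (0 : ℝ) 1), p t) :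
    ∀ᵐ s ∂volume.restrict (Icc a b), p ((s - a) / (b - a)) := by
  rw [ae_restrict_iff' measurableSet_Icc] at hp ⊢
  have hba : 0 < b - a := sub_pos.2 hab
  filter_upwards [ae_comp_affine hp (inv_ne_zero hba.ne') (-a * (b - a)⁻¹)] with s hs hs'
  have e : -a * (b - a)⁻¹ + s * (b - a)⁻¹ = (s - a) / (b - a) := by field_simp; ring
  rw [e] at hs
  exact hs ⟨div_nonneg (by linarith [hs'.1]) hba.le, (div_le_one hba).2 (by linarith [hs'.2])⟩

/-! ### The clock of a reparameterized process -/

section Reparam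

variable {n N : ℕ} {h : ℝ} {f g : State n × State n → State n} {x₀ ξ₀ : State n}

namespace PreReparamProcess

variable (Q : PreReparamProcess N h f g x₀ ξ₀)

lemma isRate (i : Fin N) : IsRate (Q.α i) Q.S where
  meas := (Q.essBdd i).aestronglyMeasurable.aemeasurable
  nonneg := Q.nonneg.mono fun s hs => hs i
  le_one := by
    filter_upwards [Q.nonneg, Q.sum_le] with s h1 h2
    exact (Finset.single_le_sum (f := fun i => Q.α i s) (fun j _ => h1 j)
      (Finset.mem_univ i)).trans h2

lemma isClock (hh : 0 < h) : IsClock (fun s => 1 - ∑ i, Q.α i s) Q.S h where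
  S_pos := Q.S_pos
  h_pos := hh
  time := Q.time
  meas := aemeasurable_const.sub (Finset.aemeasurable_fun_sum _ fun i _ => (Q.isRate i).meas)
  nonneg := Q.sum_le.mono fun s hs => sub_nonneg.2 hs
  le_one := Q.nonneg.mono fun s hs => by
    have := Finset.sum_nonneg fun i (_ : i ∈ Finset.univ) => hs i
    linarith

lemma isTimeChange (hh : 0 < h) : IsTimeChange Q.psi Q.S h := (Q.isClock hh).isTimeChange

lemma sigma_eq : Q.sigma = rightInverse (primitive fun s => 1 - ∑ i, Q.α i s) Q.S h := rfl

/-- The right-hand side of the differential equation for `y i`. -/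
noncomputable def field (i : Fin N) (s : ℝ) : State n :=
  (1 - ∑ j, Q.α j s) • f (Q.y i.succ s, Q.y i.castSucc s)
    + Q.α i s • g (Q.y i.succ s, Q.y i.castSucc s)

/-- The weights `1 - ∑ α_j` and `α_i` are nonnegative with sum at most one. -/
lemma norm_field_le {C : ℝ} (hf : ∀ p, ‖f p‖ ≤ C) (hg : ∀ p, ‖g p‖ ≤ C) (i : Fin N) :
    ∀ᵐ s ∂volume.restrict (Icc 0 Q.S), ‖Q.field i s‖ ≤ C := by
  filter_upwards [Q.nonneg, Q.sum_le] with s h1 h2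
  have h3 := Finset.single_le_sum (f := fun i => Q.α i s) (fun j _ => h1 j) (Finset.mem_univ i)
  have h4 := h1 i
  have hC : 0 ≤ C := (norm_nonneg _).trans (hf (Q.y i.succ s, Q.y i.castSucc s))
  refine (norm_add_le _ _).trans ?_
  rw [norm_smul, norm_smul, Real.norm_of_nonneg (sub_nonneg.2 h2), Real.norm_of_nonneg h4]
  have h5 := mul_le_mul_of_nonneg_left (hf (Q.y i.succ s, Q.y i.castSucc s)) (sub_nonneg.2 h2)
  have h6 := mul_le_mul_of_nonneg_left (hg (Q.y i.succ s, Q.y i.castSucc s)) h4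
  nlinarith

lemma y_eq {C : ℝ} (hf : ∀ p, ‖f p‖ ≤ C) (hg : ∀ p, ‖g p‖ ≤ C) (i : Fin N) {s : ℝ}
    (hs : s ∈ Icc 0 Q.S) : Q.y i.succ s = Q.y i.succ 0 + ∫ t in (0 : ℝ)..s, Q.field i t :=
  eq_add_integral_of_ae_hasDerivAt Q.S_pos.le (Q.abs_cont i) (Q.ode i) (Q.norm_field_le hf hg i) hs

lemma integrableOn_field {C : ℝ} (hf : ∀ p, ‖f p‖ ≤ C) (hg : ∀ p, ‖g p‖ ≤ C) (i : Fin N) :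
    IntegrableOn (Q.field i) (Icc 0 Q.S) :=
  integrableOn_of_ae_hasDerivAt (Q.ode i) (Q.norm_field_le hf hg i)

lemma lipschitzOnWith_y {C : ℝ} (hf : ∀ p, ‖f p‖ ≤ C) (hg : ∀ p, ‖g p‖ ≤ C) (i : Fin N) :
    LipschitzOnWith C.toNNReal (Q.y i.succ) (Icc 0 Q.S) :=
  lipschitzOnWith_of_ae_hasDerivAt Q.S_pos.le (Q.abs_cont i) (Q.ode i) (Q.norm_field_le hf hg i)

lemma continuousOn_y (i : Fin N) : ContinuousOn (Q.y i.succ) (Icc 0 Q.S) := by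
  have := (Q.abs_cont i).continuousOn
  rwa [uIcc_of_le Q.S_pos.le] at this

lemma exists_norm_y_le (k : Fin (N + 1)) : ∃ R, ∀ s ∈ Icc 0 Q.S, ‖Q.y k s‖ ≤ R := by
  refine Fin.cases ?_ (fun i => ?_) k
  · refine ⟨max ‖ξ₀‖ ‖x₀‖, fun s hs => ?_⟩
    rcases hs.2.eq_or_lt with rfl | h1
    · rw [Q.y_zero_end]; exact le_max_right _ _
    · rw [Q.y_zero s ⟨hs.1, h1⟩]; exact le_max_left _ _
  · exact isCompact_Icc.exists_bound_of_continuousOn (Q.continuousOn_y i)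

/-- The arcs are determined by the controls. -/
lemma y_unique {C : ℝ} (hf : ContDiff ℝ 1 f) (hg : ContDiff ℝ 1 g) (hfC : ∀ p, ‖f p‖ ≤ C)
    (hgC : ∀ p, ‖g p‖ ≤ C) {Q' : PreReparamProcess N h f g x₀ ξ₀} (hS : Q.S = Q'.S)
    (hα : ∀ i, Q.α i =ᵐ[volume.restrict (Icc 0 Q.S)] Q'.α i) (k : Fin (N + 1)) :
    EqOn (Q.y k) (Q'.y k) (Icc 0 Q.S) := by
  induction k using Fin.induction with
  | zero =>
    intro s hs
    rcases hs.2.eq_or_lt with h1 | h1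
    · rw [h1, Q.y_zero_end, hS, Q'.y_zero_end]
    · rw [Q.y_zero s ⟨hs.1, h1⟩, Q'.y_zero s ⟨hs.1, hS ▸ h1⟩]
  | succ i ih =>
    obtain ⟨R₁, hR₁⟩ := Q.exists_norm_y_le i.succ
    obtain ⟨R₂, hR₂⟩ := Q.exists_norm_y_le i.castSucc
    obtain ⟨R₃, hR₃⟩ := Q'.exists_norm_y_le i.succ
    rw [← hS] at hR₃
    -- Functions of class `C¹` are Lipschitz only on compact convex sets; this ball contains both
    -- arcs together with the common delayed arc.
    set B : Set (State n × State n) := Metric.closedBall 0 (max R₁ (max R₂ R₃)) with hB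
    obtain ⟨K₁, hK₁⟩ := hf.contDiffOn.exists_lipschitzOnWith (by decide)
      (convex_closedBall (0 : State n × State n) (max R₁ (max R₂ R₃)))
      (isCompact_closedBall _ _)
    obtain ⟨K₂, hK₂⟩ := hg.contDiffOn.exists_lipschitzOnWith (by decide)
      (convex_closedBall (0 : State n × State n) (max R₁ (max R₂ R₃)))
      (isCompact_closedBall _ _)
    have hm1 : ∀ s ∈ Icc 0 Q.S, (Q.y i.succ s, Q.y i.castSucc s) ∈ B := fun s hs => by
      rw [hB, mem_closedBall_zero_iff, Prod.norm_def]
      exact max_le ((hR₁ s hs).trans (le_max_left _ _))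
        ((hR₂ s hs).trans ((le_max_left _ _).trans (le_max_right _ _)))
    have hm2 : ∀ s ∈ Icc 0 Q.S, (Q'.y i.succ s, Q.y i.castSucc s) ∈ B := fun s hs => by
      rw [hB, mem_closedBall_zero_iff, Prod.norm_def]
      exact max_le ((hR₃ s hs).trans ((le_max_right _ _).trans (le_max_right _ _)))
        ((hR₂ s hs).trans ((le_max_left _ _).trans (le_max_right _ _)))
    have hinit : Q.y i.succ 0 = Q'.y i.succ 0 := by
      rw [Q.link, Q'.link, ← hS]
      exact ih ⟨Q.S_pos.le, le_rfl⟩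
    have hI := Q.integrableOn_field hfC hgC i
    have hI' := Q'.integrableOn_field hfC hgC i
    rw [← hS] at hI'
    have hc' : ContinuousOn (Q'.y i.succ) (Icc 0 Q.S) := by rw [hS]; exact Q'.continuousOn_y i
    have hcn : ContinuousOn (fun s => ‖Q.y i.succ s - Q'.y i.succ s‖) (Icc 0 Q.S) :=
      ((Q.continuousOn_y i).sub hc').norm
    -- By the induction hypothesis the delayed arguments coincide, so only the first argument
    -- contributes to the difference of the fields.
    have hbound : ∀ᵐ s ∂volume.restrict (Icc 0 Q.S), ‖Q.field i s - Q'.field i s‖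
        ≤ (K₁ + K₂) * ‖Q.y i.succ s - Q'.y i.succ s‖ := by
      filter_upwards [Q.nonneg, Q.sum_le, ae_all_iff.2 hα, ae_restrict_mem measurableSet_Icc]
        with s h1 h2 h3 hs
      have h4 := Finset.single_le_sum (f := fun i => Q.α i s) (fun j _ => h1 j) (Finset.mem_univ i)
      have h5 := h1 i
      have h6 := Finset.sum_nonneg fun i (_ : i ∈ Finset.univ) => h1 i
      have e : ∑ j, Q'.α j s = ∑ j, Q.α j s := Finset.sum_congr rfl fun j _ => (h3 j).symm
      have l1 := hK₁.norm_sub_le (hm1 s hs) (hm2 s hs)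
      have l2 := hK₂.norm_sub_le (hm1 s hs) (hm2 s hs)
      rw [Prod.mk_sub_mk, sub_self, Prod.norm_def] at l1 l2
      simp only [norm_zero, norm_nonneg, sup_of_le_left] at l1 l2
      have : Q.field i s - Q'.field i s
          = (1 - ∑ j, Q.α j s) • (f (Q.y i.succ s, Q.y i.castSucc s)
              - f (Q'.y i.succ s, Q.y i.castSucc s))
            + Q.α i s • (g (Q.y i.succ s, Q.y i.castSucc s)
              - g (Q'.y i.succ s, Q.y i.castSucc s)) := by
        rw [field, field, e, ← h3 i, ← ih hs, smul_sub, smul_sub]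
        abel
      rw [this]
      refine (norm_add_le _ _).trans ?_
      rw [norm_smul, norm_smul, Real.norm_of_nonneg (sub_nonneg.2 h2), Real.norm_of_nonneg h5,
        add_mul]
      refine add_le_add ((mul_le_of_le_one_left (norm_nonneg _) (by linarith)).trans l1)
        ((mul_le_of_le_one_left (norm_nonneg _) (by linarith)).trans l2)
    intro s hs
    have key := eq_zero_of_le_integral (K := K₁ + K₂) hcn (fun _ _ => norm_nonneg _)
      (fun s hs => ?_) hs
    · exact sub_eq_zero.1 (norm_eq_zero.1 key)
    · have hsub : Ioc 0 s ⊆ Icc 0 Q.S := fun t ht => ⟨ht.1.le, ht.2.trans hs.2⟩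
      have hii : ∀ {F : ℝ → State n}, IntegrableOn F (Icc 0 Q.S) → IntervalIntegrable F volume 0 s :=
        fun hF => by
          rw [intervalIntegrable_iff_integrableOn_Ioc_of_le hs.1]
          exact hF.mono_set hsub
      rw [Q.y_eq hfC hgC i hs, Q'.y_eq hfC hgC i (hS ▸ hs), hinit, add_sub_add_left_eq_sub,
        ← intervalIntegral.integral_sub (hii hI) (hii hI'), ← intervalIntegral.integral_const_mul]
      refine intervalIntegral.norm_integral_le_of_norm_le hs.1 ?_ ?_
      · rw [ae_restrict_iff' measurableSet_Icc] at hbound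
        filter_upwards [hbound] with t ht ht'
        exact ht (hsub ht')
      · refine ContinuousOn.intervalIntegrable ?_
        rw [uIcc_of_le hs.1]
        exact (hcn.mono (Icc_subset_Icc_right hs.2)).const_smul (K₁ + K₂ : ℝ)

end PreReparamProcess

end Reparam

end ImpulsiveDelay

/-! ### Linked processes; uniqueness of the reparameterization -/

namespace ImpulsiveDelay

section Reparam

variable {n N : ℕ} {h : ℝ} {f g : State n × State n → State n} {x₀ ξ₀ : State n}

/-- The common description of the correspondence between extended and reparameterized processes. -/
structure IsLinked (P : PreExtendedProcess N h f g x₀ ξ₀) (Q : PreReparamProcess N h f g x₀ ξ₀) :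
    Prop where
  matching : IsMatching h P.μ P.w Q.S Q.α
  control : ∀ r ∈ Icc 0 h, ∀ i, ∀ᵐ s ∂volume.restrict (Icc (0 : ℝ) 1),
    P.w r i s = (rightLim Q.sigma r - leftLim Q.sigma r)
      * Q.α i (leftLim Q.sigma r + s * (rightLim Q.sigma r - leftLim Q.sigma r))
  inner : ∀ i : Fin N, ∀ r ∈ Ioo 0 h, P.x (r + (i : ℕ) * h) = Q.y i.succ (Q.sigma r)
  jumps : ∃ ζ, IsTrajectory h f g x₀ ξ₀ P.x P.μ P.w ζ ∧
    ∀ r ∈ Icc 0 h, ∀ i : Fin N, ∀ s ∈ Icc (0 : ℝ) 1,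
      ζ r i.succ s
        = Q.y i.succ (leftLim Q.sigma r + s * (rightLim Q.sigma r - leftLim Q.sigma r))

namespace IsLinked

variable {P : PreExtendedProcess N h f g x₀ ξ₀} {Q : PreReparamProcess N h f g x₀ ξ₀}

/-- Matching identifies `φ` with `σ`, `η` with `ψ`, and the density of the continuous part with the
control. Each clause then only inverts the affine rescaling of a flat part or uses `σ (ψ s) = s` off
the flat parts. -/
lemma isReparamOf (L : IsLinked P Q) (hh : 0 < h) : IsReparamOf P Q := by
  have M := L.matching
  have HT := Q.isTimeChange hh
  have hphi : phi h P.μ P.w = Q.sigma := M.phi_eq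
  refine ⟨M.phi_end.symm, fun i => ?_, fun i r hr => ?_, ?_⟩
  · rw [ae_restrict_iff' (measurableSet_Icc.diff M.measurableSet_jumpSet)]
    have := M.contDensity_eq i
    rw [ae_restrict_iff' measurableSet_Icc] at this
    filter_upwards [this] with s h1 h2
    rw [M.eta_eq h2.1, h1 h2.1 h2.2]
  · have hr' := M.mem_phiJumps.1 hr
    rw [hphi]
    filter_upwards [ae_Icc_of_ae_Icc_zero_one hr'.2 (L.control r hr'.1 i)] with s hs
    rw [phiRescale, hphi]
    have hne : rightLim Q.sigma r - leftLim Q.sigma r ≠ 0 := sub_ne_zero.2 (ne_of_gt hr'.2)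
    rw [← Q.sigma_eq] at hs
    rw [hs, div_mul_cancel₀ _ hne, add_sub_cancel, ← mul_assoc, one_div, inv_mul_cancel₀ hne, one_mul]
  · obtain ⟨ζ, hζ, hζy⟩ := L.jumps
    have hh' : h ∈ Icc 0 h := ⟨hh.le, le_rfl⟩
    have hend : ∀ i : Fin N, ζ h i.succ 1 = Q.y i.succ Q.S := fun i => by
      rw [hζy h hh' i 1 ⟨zero_le_one, le_rfl⟩, one_mul, add_sub_cancel,
        show rightLim Q.sigma h = Q.S from HT.inv_rightLim_end]
    refine ⟨ζ, hζ, fun i => ⟨?_, (hend i).symm, fun s hs => ?_, fun r hr s hs => ?_⟩⟩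
    · rw [Q.link]
      split_ifs with hi
      · have : i.castSucc = 0 := Fin.ext hi
        rw [this, Q.y_zero_end]
      · have h0 : i.castSucc ≠ 0 := fun e => hi (by simpa using congrArg Fin.val e)
        obtain ⟨j, hj⟩ := Fin.exists_succ_eq.2 h0
        rw [← hj, hend]
    · have hs' : s ∈ Icc 0 Q.S := ⟨hs.1.1.le, hs.1.2.le⟩
      have hn := fun hlt => hs.2 ((M.mem_jumpSet hs').2 hlt)
      rw [M.eta_eq hs']
      have := L.inner i (Q.psi s) (HT.comp_mem_Ioo hs.1 hn)
      rw [add_comm] at this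
      refine Eq.trans ?_ this.symm
      exact congrArg _ (HT.inv_comp hs' hn).symm
    · have hr' := M.mem_phiJumps.1 hr
      rw [hphi] at hs
      rw [← Q.sigma_eq] at hr'
      have hpos := sub_pos.2 hr'.2
      rw [phiRescale, hphi, hζy r hr'.1 i _ ⟨div_nonneg (by linarith [hs.2.1]) hpos.le,
        (div_le_one hpos).2 (by linarith [hs.2.2])⟩, div_mul_cancel₀ _ hpos.ne', add_sub_cancel]

end IsLinked

/-- A reparameterized process constructed from an extended process is unique. -/
lemma IsReparamOf.equiv {C : ℝ} (hf : ContDiff ℝ 1 f) (hg : ContDiff ℝ 1 g) (hfC : ∀ p, ‖f p‖ ≤ C)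
    (hgC : ∀ p, ‖g p‖ ≤ C) (hh : 0 < h) {P P' : PreExtendedProcess N h f g x₀ ξ₀}
    {Q Q' : PreReparamProcess N h f g x₀ ξ₀}
    (hPQ : IsReparamOf P Q) (hPQ' : IsReparamOf P' Q') (hP : P ≈ P')
    (hc : (phiJumps h P.μ P.w).Countable) : Q ≈ Q' := by
  obtain ⟨-, hμ, hw⟩ := hP
  -- The functions `φ`, `η`, the jump set and the densities depend on the representative only
  -- through `μ` and the integrals of the attached controls at `0` and `h`.
  have hint : ∀ r ∈ Icc 0 h, ∀ i, ∫ s in (0 : ℝ)..1, P.w r i s = ∫ s in (0 : ℝ)..1, P'.w r i s := by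
    intro r hr i
    rw [intervalIntegral.integral_of_le zero_le_one, intervalIntegral.integral_of_le zero_le_one]
    exact integral_congr_ae (ae_restrict_of_ae_restrict_of_subset Ioc_subset_Icc_self (hw r hr i))
  have hseg : segMeasure h P'.μ P'.w = segMeasure h P.μ P.w := by
    funext i
    rw [segMeasure, segMeasure, hμ, hint 0 ⟨le_rfl, hh.le⟩ i, hint h ⟨hh.le, le_rfl⟩ i]
  have hphi : phi h P'.μ P'.w = phi h P.μ P.w := by
    funext r; simp only [phi, hseg]
  have heta : eta h P'.μ P'.w = eta h P.μ P.w := by simp only [eta, hphi]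
  have hjumps : phiJumps h P'.μ P'.w = phiJumps h P.μ P.w := by simp only [phiJumps, hphi]
  have hset : jumpSet h P'.μ P'.w = jumpSet h P.μ P.w := by simp only [jumpSet, hphi, hjumps]
  have hden : contDensity h P'.μ P'.w = contDensity h P.μ P.w := by
    funext i r; simp only [contDensity, phiMeasure, hseg]
  have hS : Q.S = Q'.S := by rw [hPQ.S_eq, hPQ'.S_eq, hphi]
  have hα : ∀ i, Q.α i =ᵐ[volume.restrict (Icc 0 Q.S)] Q'.α i := by
    intro i
    have hD : MeasurableSet (jumpSet h P.μ P.w) :=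
      MeasurableSet.biUnion hc fun _ _ => measurableSet_Icc
    have h1 : ∀ᵐ s ∂volume.restrict (Icc 0 Q.S \ jumpSet h P.μ P.w), Q.α i s = Q'.α i s := by
      have := hPQ'.control_off i
      rw [hset, hden, heta, ← hS] at this
      filter_upwards [hPQ.control_off i, this] with s h1 h2
      rw [h1, h2]
    have h2 : ∀ᵐ s ∂volume.restrict (jumpSet h P.μ P.w), Q.α i s = Q'.α i s := by
      rw [jumpSet, ae_restrict_biUnion_iff _ hc]
      intro r hr
      have := hPQ'.control_on i r (hjumps ▸ hr)
      rw [hphi] at this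
      have hres : phiRescale h P'.μ P'.w r = phiRescale h P.μ P.w r := by
        funext s; simp only [phiRescale, hphi]
      filter_upwards [hPQ.control_on i r hr, this,
        ae_Icc_of_ae_Icc_zero_one hr.2 (hw r hr.1 i)] with s h1 h2 h3
      rw [h1, h2, hres]
      congr 1
    have h3 := (ae_restrict_union_iff (Icc 0 Q.S \ jumpSet h P.μ P.w) (jumpSet h P.μ P.w) _).2
      ⟨h1, h2⟩
    refine ae_restrict_of_ae_restrict_of_subset (fun s hs => ?_) h3
    by_cases h4 : s ∈ jumpSet h P.μ P.w
    · exact Or.inr h4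
    · exact Or.inl ⟨hs, h4⟩
  -- The arcs are not compared through the jump functions: once the controls agree, the differential
  -- equations determine them.
  exact ⟨hS, Q.y_unique hf hg hfC hgC hS hα, hα⟩

end Reparam

end ImpulsiveDelay

namespace ImpulsiveDelay

/-! ### Concatenation -/

section Concatenation

variable {N : ℕ} {a : ℝ}

lemma exists_mem_segment (hN : 0 < N) (ha : 0 < a) {s : ℝ} (hs : s ∈ Icc 0 (N * a)) :
    ∃ i : Fin N, s ∈ Icc ((i : ℕ) * a) (((i : ℕ) + 1) * a) := by
  rcases hs.2.eq_or_lt with h1 | h1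
  · refine ⟨⟨N - 1, by omega⟩, ?_⟩
    have : ((N - 1 : ℕ) : ℝ) = N - 1 := by rw [Nat.cast_sub hN]; simp
    simp only [this, h1]
    constructor <;> nlinarith
  · have h2 : ⌊s / a⌋₊ < N := by
      rw [Nat.floor_lt (div_nonneg hs.1 ha.le), div_lt_iff₀ ha]; exact h1
    refine ⟨⟨⌊s / a⌋₊, h2⟩, ?_, ?_⟩
    · rw [← le_div_iff₀ ha]; exact Nat.floor_le (div_nonneg hs.1 ha.le)
    · rw [← div_le_iff₀ ha]; exact (Nat.lt_floor_add_one _).le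

lemma exists_mem_segment_Ico (ha : 0 < a) {s : ℝ} (hs : s ∈ Ico 0 (N * a)) :
    ∃ i : Fin N, s ∈ Ico ((i : ℕ) * a) (((i : ℕ) + 1) * a) := by
  have h2 : ⌊s / a⌋₊ < N := by
    rw [Nat.floor_lt (div_nonneg hs.1 ha.le), div_lt_iff₀ ha]; exact hs.2
  refine ⟨⟨⌊s / a⌋₊, h2⟩, ?_, ?_⟩
  · rw [← le_div_iff₀ ha]; exact Nat.floor_le (div_nonneg hs.1 ha.le)
  · rw [← div_lt_iff₀ ha]; exact Nat.lt_floor_add_one _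

lemma segment_mul_le {i j : Fin N} (ha : 0 ≤ a) (hij : i < j) :
    ((i : ℕ) + 1) * a ≤ ((j : ℕ) : ℝ) * a := by
  have : ((i : ℕ) : ℝ) + 1 ≤ (j : ℕ) := by exact_mod_cast hij
  exact mul_le_mul_of_nonneg_right this ha

lemma segment_subset (ha : 0 ≤ a) (i : Fin N) :
    Icc ((i : ℕ) * a) (((i : ℕ) + 1) * a) ⊆ Icc 0 (N * a) := by
  refine Icc_subset_Icc (by positivity) (mul_le_mul_of_nonneg_right ?_ ha)
  exact_mod_cast i.2

lemma eq_of_mem_segment_Ico (ha : 0 ≤ a) {i j : Fin N} {s : ℝ}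
    (hi : s ∈ Ico ((i : ℕ) * a) (((i : ℕ) + 1) * a))
    (hj : s ∈ Ico ((j : ℕ) * a) (((j : ℕ) + 1) * a)) : i = j := by
  rcases lt_trichotomy i j with h1 | h1 | h1
  · have := segment_mul_le ha h1; linarith [hi.2, hj.1]
  · exact h1
  · have := segment_mul_le ha h1; linarith [hj.2, hi.1]

/-- Functions on `[0, a]` with matching end values can be concatenated. -/
lemma exists_concat {E : Type*} (hN : 0 < N) (ha : 0 < a) (v : Fin N → ℝ → E)
    (hv : ∀ i j : Fin N, (j : ℕ) = (i : ℕ) + 1 → v j 0 = v i a) :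
    ∃ V : ℝ → E, ∀ i : Fin N, ∀ s ∈ Icc ((i : ℕ) * a) (((i : ℕ) + 1) * a),
      V s = v i (s - (i : ℕ) * a) := by
  -- The cap `N - 1` assigns the final endpoint `N * a` to the last segment.
  refine ⟨fun s => v ⟨min ⌊s / a⌋₊ (N - 1), by omega⟩ (s - (min ⌊s / a⌋₊ (N - 1) : ℕ) * a),
    fun i s hs => ?_⟩
  have hs0 : 0 ≤ s := (by positivity : (0 : ℝ) ≤ (i : ℕ) * a).trans hs.1
  rcases hs.2.eq_or_lt with h1 | h1
  -- At its right endpoint the formula already uses the next segment; the matching of end values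
  -- makes this harmless, and for the last segment the cap applies.
  · have hf : ⌊s / a⌋₊ = (i : ℕ) + 1 := by
      rw [h1, mul_div_cancel_right₀ _ ha.ne']
      exact_mod_cast Nat.floor_natCast ((i : ℕ) + 1)
    rcases Nat.lt_or_ge ((i : ℕ) + 1) N with h2 | h2
    · have hm : min ⌊s / a⌋₊ (N - 1) = (i : ℕ) + 1 := by omega
      simp only [hm]
      have e1 : s - ((i : ℕ) + 1 : ℕ) * a = 0 := by rw [h1]; push_cast; ring
      have e2 : s - (i : ℕ) * a = a := by rw [h1]; ring
      rw [e1, e2]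
      exact hv i ⟨(i : ℕ) + 1, h2⟩ rfl
    · have hm : min ⌊s / a⌋₊ (N - 1) = (i : ℕ) := by have := i.2; omega
      simp only [hm]
  · have hf : ⌊s / a⌋₊ = (i : ℕ) := by
      rw [Nat.floor_eq_iff (div_nonneg hs0 ha.le), le_div_iff₀ ha, div_lt_iff₀ ha]
      exact ⟨hs.1, h1⟩
    have hm : min ⌊s / a⌋₊ (N - 1) = (i : ℕ) := by have := i.2; omega
    simp only [hm]

lemma lipschitzOnWith_concat {E : Type*} [PseudoMetricSpace E] {V : ℝ → E} {K : NNReal} {M : ℕ}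
    (ha : 0 ≤ a) (hV : ∀ i < M, LipschitzOnWith K V (Icc ((i : ℕ) * a) (((i : ℕ) + 1) * a))) :
    LipschitzOnWith K V (Icc 0 (M * a)) := by
  induction M with
  | zero =>
    simp only [Nat.cast_zero, zero_mul, Icc_self]
    intro s hs t ht
    rw [mem_singleton_iff.1 hs, mem_singleton_iff.1 ht]
    simp
  | succ M ih =>
    have h1 := ih fun i hi => hV i (by omega)
    have h2 := hV M (by omega)
    have hMa : (0 : ℝ) ≤ M * a := by positivity
    have key : ∀ s ∈ Icc (0 : ℝ) ((M + 1 : ℕ) * a), ∀ t ∈ Icc (0 : ℝ) ((M + 1 : ℕ) * a), s ≤ t →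
        dist (V s) (V t) ≤ K * dist s t := by
      intro s hs t ht hst
      push_cast at hs ht
      rcases le_total t (M * a) with h3 | h3
      · exact h1.dist_le_mul s ⟨hs.1, hst.trans h3⟩ t ⟨ht.1, h3⟩
      rcases le_total (M * a) s with h4 | h4
      · exact h2.dist_le_mul s ⟨h4, hs.2⟩ t ⟨h3, ht.2⟩
      have e1 := h1.dist_le_mul s ⟨hs.1, h4⟩ (M * a) ⟨hMa, le_rfl⟩
      have e2 := h2.dist_le_mul (M * a) ⟨le_rfl, h3.trans ht.2⟩ t ⟨h3, ht.2⟩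
      refine (dist_triangle _ (V (M * a)) _).trans ((add_le_add e1 e2).trans ?_)
      rw [Real.dist_eq, Real.dist_eq, Real.dist_eq, abs_of_nonpos (by linarith),
        abs_of_nonpos (by linarith), abs_of_nonpos (by linarith)]
      linarith
    refine LipschitzOnWith.of_dist_le_mul fun s hs t ht => ?_
    rcases le_total s t with h3 | h3
    · exact key s hs t ht h3
    · rw [dist_comm, dist_comm s]; exact key t ht s hs h3

variable {ψ ψt : ℝ → ℝ} {S h : ℝ}

/-- The concatenation of the shifts of a change of variable is a change of variable. -/
lemma IsTimeChange.concat (H : IsTimeChange ψ S h) (hN : 0 < N) {K : NNReal}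
    (hK : LipschitzOnWith K ψ (Icc 0 S))
    (hψt : ∀ i : Fin N, ∀ s ∈ Icc ((i : ℕ) * S) (((i : ℕ) + 1) * S),
      ψt s = (i : ℕ) * h + ψ (s - (i : ℕ) * S)) : IsTimeChange ψt (N * S) (N * h) := by
  have hS := H.S_pos
  have hh := H.h_pos
  have hN' : (0 : ℝ) < N := by exact_mod_cast hN
  have hsh : ∀ {i : Fin N} {s : ℝ}, s ∈ Icc ((i : ℕ) * S) (((i : ℕ) + 1) * S) →
      s - (i : ℕ) * S ∈ Icc 0 S := fun hs => ⟨by linarith [hs.1], by linarith [hs.2]⟩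
  refine ⟨by positivity, by positivity, ?_, ?_, ?_, ?_⟩
  · refine (lipschitzOnWith_concat (K := K) hS.le fun i hi => ?_).continuousOn
    refine LipschitzOnWith.of_dist_le_mul fun s hs t ht => ?_
    rw [hψt ⟨i, hi⟩ s hs, hψt ⟨i, hi⟩ t ht, dist_add_left]
    have := hK.dist_le_mul _ (hsh (i := ⟨i, hi⟩) hs) _ (hsh (i := ⟨i, hi⟩) ht)
    rwa [dist_sub_right] at this
  · intro s hs t ht hst
    obtain ⟨i, hi⟩ := exists_mem_segment hN hS hs
    obtain ⟨j, hj⟩ := exists_mem_segment hN hS ht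
    rw [hψt i s hi]
    rcases lt_trichotomy i j with h1 | rfl | h1
    · rw [hψt j t hj]
      have h2 := segment_mul_le hh.le h1
      linarith [(H.maps (hsh hi)).2, (H.maps (hsh hj)).1]
    · rw [hψt i t hj]
      linarith [H.mono (hsh hi) (hsh hj) (by linarith)]
    · have h2 := segment_mul_le hS.le h1
      have : t = s := le_antisymm (by linarith [hj.2, hi.1]) hst
      rw [this, hψt i s hi]
  · have := hψt ⟨0, hN⟩ 0 ⟨by simp, by simpa using hS.le⟩
    simpa [H.map_zero] using this
  · have hc : ((N - 1 : ℕ) : ℝ) = N - 1 := by rw [Nat.cast_sub hN]; simp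
    have := hψt ⟨N - 1, by omega⟩ (N * S) ⟨by simp only [hc]; nlinarith, by simp only [hc]; linarith⟩
    rw [this]
    simp only [hc]
    rw [show N * S - (N - 1) * S = S by ring, H.map_end]
    ring

/-- The right inverse of a concatenation. -/
lemma IsTimeChange.concat_inv (H : IsTimeChange ψ S h) (hN : 0 < N)
    (hψt : ∀ i : Fin N, ∀ s ∈ Icc ((i : ℕ) * S) (((i : ℕ) + 1) * S),
      ψt s = (i : ℕ) * h + ψ (s - (i : ℕ) * S)) {i : Fin N} {r : ℝ} (hr : r ∈ Ico 0 h)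
    (hpos : 0 < r + (i : ℕ) * h) :
    rightInverse ψt (N * S) (N * h) (r + (i : ℕ) * h)
      = (i : ℕ) * S + rightLim (rightInverse ψ S h) r := by
  have hS := H.S_pos
  have hh := H.h_pos
  have hr' : r ∈ Icc 0 h := ⟨hr.1, hr.2.le⟩
  have h1 : ((i : ℕ) : ℝ) + 1 ≤ N := by exact_mod_cast i.2
  have h2 := H.inv_rightLim_lt hr
  have h3 := (H.inv_rightLim_mem r).1
  -- It suffices that `ψt s ≤ r + i * h` exactly when `s ≤ i * S + σ⁺(r)`, which is checked segment
  -- by segment. The hypothesis `hpos` excludes only the origin of the whole horizon; at an interior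
  -- node, `r = 0` and the right limit is what appears.
  refine rightInverse_eq_of_forall ⟨hpos, ?_⟩ ⟨by positivity, ?_⟩ fun s hs => ?_
  · nlinarith [hr.2]
  · nlinarith
  · obtain ⟨j, hj⟩ := exists_mem_segment hN hS hs
    have hsj : s - (j : ℕ) * S ∈ Icc 0 S := ⟨by linarith [hj.1], by linarith [hj.2]⟩
    rw [hψt j s hj]
    rcases lt_trichotomy i j with h4 | rfl | h4
    · have h5 := segment_mul_le hh.le h4
      have h6 := segment_mul_le hS.le h4
      have h7 := (H.maps hsj).1
      exact ⟨fun h8 => by linarith [hr.2], fun h8 => by linarith [hj.1]⟩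
    · have h5 := H.le_inv_rightLim_iff hr' hsj
      constructor
      · intro h6; linarith [h5.2 (by linarith)]
      · intro h6; linarith [h5.1 (by linarith)]
    · have h5 := segment_mul_le hh.le h4
      have h6 := segment_mul_le hS.le h4
      have h7 := (H.maps hsj).2
      exact ⟨fun h8 => by linarith [hj.2], fun h8 => by linarith [hr.1]⟩

end Concatenation

section Reparam

variable {n N : ℕ} {h : ℝ} {f g : State n × State n → State n} {x₀ ξ₀ : State n}

lemma IsClock.lipschitzOnWith {u : ℝ → ℝ} {S h : ℝ} (H : IsClock u S h) :
    LipschitzOnWith 1 (primitive u) (Icc 0 S) := by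
  have := lipschitzOnWith_add_integral 0 H.integrableOn H.norm_le
  simp only [zero_add, Real.toNNReal_one] at this
  exact this

lemma PreReparamProcess.y_link (Q : PreReparamProcess N h f g x₀ ξ₀) {i j : Fin N}
    (hij : (j : ℕ) = (i : ℕ) + 1) : Q.y j.succ 0 = Q.y i.succ Q.S := by
  rw [Q.link j]
  congr 2
  exact Fin.ext (by simp [hij])

/-- The measure `μ` is the sum of the translates of the images of `α_i ds`, so `μ [0, t]` is the
integral of the concatenated control over the set `ψt ≤ t`, an interval ending at the right limit of
`σt` at `t`. The values of `x` come from `inner` inside the segments and from the jump functions at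
the nodes and at the end. -/
lemma IsLinked.isExtendedOf {P : PreExtendedProcess N h f g x₀ ξ₀}
    {Q : PreReparamProcess N h f g x₀ ξ₀} (L : IsLinked P Q) (hN : 0 < N) (hh : 0 < h) :
    IsExtendedOf Q P := by
  have M := L.matching
  have HT := Q.isTimeChange hh
  have hS := Q.S_pos
  have hNr : (0 : ℝ) < N := by exact_mod_cast hN
  obtain ⟨ψt, hψt⟩ := exists_concat (N := N) (a := Q.S) hN hS (fun i s => (i : ℕ) * h + Q.psi s)
    fun i j hij => by rw [HT.map_zero, HT.map_end, hij]; push_cast; ring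
  obtain ⟨yt, hyt⟩ := exists_concat (N := N) (a := Q.S) hN hS (fun i s => Q.y i.succ s)
    fun i j hij => Q.y_link hij
  have HTt := HT.concat hN (Q.isClock hh).lipschitzOnWith hψt
  obtain ⟨ζ, hζ, hζy⟩ := L.jumps
  -- Half-open segments are disjoint, so that exactly one term of the sum is active.
  set αt : ℝ → ℝ := fun s => ∑ i : Fin N,
    (Ico ((i : ℕ) * Q.S) (((i : ℕ) + 1) * Q.S)).indicator (fun s => Q.α i (s - (i : ℕ) * Q.S)) s
    with hαt
  refine ⟨ψt, yt, αt, _, hψt, hyt, fun i => ?_, rfl, fun t ht => ?_, fun t ht => ?_,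
    hζ.history, L.control⟩
  · filter_upwards [ae_restrict_mem measurableSet_Ico] with s hs
    rw [hαt]
    simp only
    rw [Finset.sum_eq_single i, indicator_of_mem hs]
    · intro j _ hji
      refine indicator_of_notMem (fun hj => hji ?_) _
      exact eq_of_mem_segment_Ico hS.le hj hs
    · simp
  · have hfin := M.finite
    have hfi : ∀ i, IsFiniteMeasure (segMeasure h P.μ P.w i) := fun i => inferInstance
    rw [intervalIntegral.integral_of_le (HTt.inv_rightLim_mem t).1, ← integral_Icc_eq_integral_Ioc,
      ← HTt.preimage_Icc ht]
    have hG : MeasurableSet (ψt ⁻¹' Icc 0 t ∩ Icc 0 (N * Q.S)) := by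
      rw [HTt.preimage_Icc ht]; exact measurableSet_Icc
    set G := ψt ⁻¹' Icc 0 t ∩ Icc 0 (N * Q.S) with hGdef
    have hmI : ∀ i : Fin N, MeasurableSet (Ico ((i : ℕ) * Q.S) (((i : ℕ) + 1) * Q.S)) :=
      fun i => measurableSet_Ico
    have hpre : ∀ i : Fin N, (fun s => s + (i : ℕ) * Q.S) ⁻¹'
        Ico ((i : ℕ) * Q.S) (((i : ℕ) + 1) * Q.S) = Ico 0 Q.S := by
      intro i
      ext s
      simp only [mem_preimage, mem_Ico]
      constructor <;> rintro ⟨h1, h2⟩ <;> constructor <;> linarith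
    have hshift : ∀ (i : Fin N) (B : Set ℝ), MeasurableSet B →
        ∫ s in B, Q.α i (s - (i : ℕ) * Q.S)
          = ∫ s in (fun s => s + (i : ℕ) * Q.S) ⁻¹' B, Q.α i s := by
      intro i B hB
      have h1 := (measurePreserving_add_right volume ((i : ℕ) * Q.S)).setIntegral_preimage_emb
        (MeasurableEquiv.addRight ((i : ℕ) * Q.S)).measurableEmbedding
        (fun s => Q.α i (s - (i : ℕ) * Q.S)) B
      simpa using h1.symm
    have hint : ∀ i : Fin N, IntegrableOn ((Ico ((i : ℕ) * Q.S) (((i : ℕ) + 1) * Q.S)).indicator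
        fun s => Q.α i (s - (i : ℕ) * Q.S)) G := by
      intro i
      refine Integrable.integrableOn ?_
      rw [integrable_indicator_iff (hmI i)]
      have h1 := (measurePreserving_add_right volume ((i : ℕ) * Q.S)).integrableOn_comp_preimage
        (MeasurableEquiv.addRight ((i : ℕ) * Q.S)).measurableEmbedding
        (f := fun s => Q.α i (s - (i : ℕ) * Q.S))
        (s := Ico ((i : ℕ) * Q.S) (((i : ℕ) + 1) * Q.S))
      rw [← h1, hpre]
      have h2 := (Q.isRate i).integrableOn.mono_set (fun s (hs : s ∈ Ico 0 Q.S) => ⟨hs.1, hs.2.le⟩)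
      refine h2.congr_fun (fun s _ => ?_) measurableSet_Ico
      simp
    have hμ := P.control.eq_sum_map_segMeasure hh
    rw [Measure.real, hμ, Measure.finsetSum_apply]
    simp only [hαt]
    rw [integral_finsetSum _ fun i _ => hint i]
    have hmeas : ∀ i : Fin N, Measurable fun t : ℝ => t + (i : ℕ) * h := fun i => by fun_prop
    have hfin' : ∀ i : Fin N, IsFiniteMeasure
        ((segMeasure h P.μ P.w i).map fun t => t + (i : ℕ) * h) := fun i =>
      Measure.isFiniteMeasure_map _ _
    rw [ENNReal.toReal_sum fun i _ => measure_ne_top _ _]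
    refine Finset.sum_congr rfl fun i _ => ?_
    rw [Measure.map_apply (hmeas i) measurableSet_Icc, ← Measure.real,
      show segMeasure h P.μ P.w i = pushDensity Q.psi (Q.α i) Q.S from M.seg i,
      pushDensity_real HT.aemeasurable (M.rate i) (hmeas i measurableSet_Icc),
      setIntegral_indicator (hmI i), hshift i _ (hG.inter (hmI i)), preimage_inter, hpre]
    refine setIntegral_congr_set ?_
    have hIco : (Ico 0 Q.S : Set ℝ) =ᵐ[volume] Icc 0 Q.S := Ico_ae_eq_Icc
    -- Translating segment `i` back to the origin turns the condition `ψt ≤ t` into `ψ s + i * h ≤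
    -- t`, whose control integral is the mass that the `i`-th translate gives to `[0, t]`.
    have e1 : ((fun s => s + (i : ℕ) * Q.S) ⁻¹' G ∩ Ico 0 Q.S : Set ℝ)
        = Q.psi ⁻¹' ((fun t => t + (i : ℕ) * h) ⁻¹' Icc 0 t) ∩ Ico 0 Q.S := by
      ext s
      simp only [mem_inter_iff, mem_preimage, and_congr_left_iff]
      intro hs
      have hmem : s + (i : ℕ) * Q.S ∈ Icc ((i : ℕ) * Q.S) (((i : ℕ) + 1) * Q.S) :=
        ⟨by linarith [hs.1], by linarith [hs.2]⟩
      have := hψt i _ hmem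
      rw [add_sub_cancel_right] at this
      rw [hGdef, mem_inter_iff, mem_preimage, this, add_comm (Q.psi s)]
      exact and_iff_left (segment_subset hS.le i hmem)
    rw [e1]
    exact (EventuallyEq.refl _ _).inter hIco.symm
  · rcases ht.2.eq_or_lt with h1 | h1
    · rw [h1, rightInverse_of_ge HTt.h_pos le_rfl, hζ.terminal]
      obtain ⟨i, hi⟩ : ∃ i : Fin N, (i : ℕ) + 1 = N := ⟨⟨N - 1, by omega⟩, by simp only; omega⟩
      have hi' : ((i : ℕ) : ℝ) + 1 = N := by exact_mod_cast hi
      have hlast : Fin.last N = i.succ := Fin.ext (by simp [hi])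
      rw [hlast, hζy h ⟨hh.le, le_rfl⟩ i 1 ⟨zero_le_one, le_rfl⟩, one_mul, add_sub_cancel,
        show rightLim Q.sigma h = Q.S from HT.inv_rightLim_end,
        hyt i _ ⟨by rw [← hi']; linarith, by rw [← hi']⟩]
      congr 1
      rw [← hi']; ring
    rcases ht.1.eq_or_lt with h0 | h0
    · rw [← h0, rightInverse_of_nonpos le_rfl, hζ.start, hyt ⟨0, hN⟩ 0 ⟨by simp, by simpa using hS.le⟩]
      have := Q.link ⟨0, hN⟩
      rw [show (⟨0, hN⟩ : Fin N).castSucc = 0 from rfl, Q.y_zero_end] at this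
      simpa using this.symm
    obtain ⟨i, hi⟩ := exists_mem_segment_Ico hh ⟨ht.1, h1⟩
    have hr : t - (i : ℕ) * h ∈ Ico 0 h := ⟨by linarith [hi.1], by linarith [hi.2]⟩
    have e := HT.concat_inv hN hψt (i := i) hr (by linarith)
    rw [sub_add_cancel] at e
    have hm := HT.inv_rightLim_mem (t - (i : ℕ) * h)
    rw [e, hyt i _ ⟨by linarith [hm.1], by linarith [hm.2]⟩, add_sub_cancel_left]
    -- At a node the trajectory equals `ζ 0 i.succ 1`, the arc at the end of the flat part at `0`,
    -- in agreement with the right limit supplied by `concat_inv`.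
    rcases hi.1.eq_or_lt with h2 | h2
    · have hi0 : 0 < (i : ℕ) := by
        rcases Nat.eq_zero_or_pos (i : ℕ) with h3 | h3
        · rw [h3] at h2; simp at h2; linarith
        · exact h3
      rw [← h2, hζ.node i hi0, sub_self, hζy 0 ⟨le_rfl, hh.le⟩ i 1 ⟨zero_le_one, le_rfl⟩, one_mul,
        add_sub_cancel]
      rfl
    · have h3 : t - (i : ℕ) * h ∈ Ioo 0 h := ⟨by linarith, hr.2⟩
      have h4 := L.inner i _ h3
      rw [sub_add_cancel] at h4
      rw [h4, HT.inv_rightLim h3.1]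
      rfl

/-- An extended process constructed from a reparameterized process is unique. -/
lemma IsExtendedOf.equiv (hN : 0 < N) (hh : 0 < h) {P P' : PreExtendedProcess N h f g x₀ ξ₀}
    {Q Q' : PreReparamProcess N h f g x₀ ξ₀}
    (hQP : IsExtendedOf Q P) (hQP' : IsExtendedOf Q' P') (hQ : Q ≈ Q') : P ≈ P' := by
  obtain ⟨hS, hy, hα⟩ := hQ
  obtain ⟨ψt, yt, αt, σt, hψt, hyt, hαt, hσt, hμ, hx, hx0, hw⟩ := hQP
  obtain ⟨ψt', yt', αt', σt', hψt', hyt', hαt', hσt', hμ', hx', hx0', hw'⟩ := hQP'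
  rw [← hS] at hψt' hyt' hαt' hσt'
  have HT := Q.isTimeChange hh
  have HTt := HT.concat hN (Q.isClock hh).lipschitzOnWith hψt
  have hSp := Q.S_pos
  have hNr : (0 : ℝ) < N := by exact_mod_cast hN
  have hpsi : EqOn Q.psi Q'.psi (Icc 0 Q.S) := by
    intro s hs
    refine intervalIntegral.integral_congr_ae ?_
    have h1 := ae_all_iff.2 hα
    rw [ae_restrict_iff' measurableSet_Icc] at h1
    filter_upwards [h1] with t ht ht'
    rw [uIoc_of_le hs.1] at ht'
    have := ht ⟨ht'.1.le, ht'.2.trans hs.2⟩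
    simp only [this]
  have hsigma : Q.sigma = Q'.sigma := by
    rw [PreReparamProcess.sigma, PreReparamProcess.sigma, ← hS]
    exact rightInverse_congr hpsi
  have hsh : ∀ {i : Fin N} {s : ℝ}, s ∈ Icc ((i : ℕ) * Q.S) (((i : ℕ) + 1) * Q.S) →
      s - (i : ℕ) * Q.S ∈ Icc 0 Q.S := fun hs => ⟨by linarith [hs.1], by linarith [hs.2]⟩
  have hψe : EqOn ψt ψt' (Icc 0 (N * Q.S)) := by
    intro s hs
    obtain ⟨i, hi⟩ := exists_mem_segment hN hSp hs
    rw [hψt i s hi, hψt' i s hi, hpsi (hsh hi)]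
  have hye : EqOn yt yt' (Icc 0 (N * Q.S)) := by
    intro s hs
    obtain ⟨i, hi⟩ := exists_mem_segment hN hSp hs
    rw [hyt i s hi, hyt' i s hi, hy i.succ (hsh hi)]
  have hσe : σt = σt' := by rw [hσt, hσt']; exact rightInverse_congr hψe
  have hαe : ∀ᵐ s ∂volume.restrict (Ico 0 (N * Q.S)), αt s = αt' s := by
    have hsub : Ico 0 (N * Q.S) ⊆ ⋃ i : Fin N, Ico ((i : ℕ) * Q.S) (((i : ℕ) + 1) * Q.S) :=
      fun s hs => mem_iUnion.2 (exists_mem_segment_Ico hSp hs)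
    refine ae_restrict_of_ae_restrict_of_subset hsub ?_
    rw [ae_restrict_iUnion_iff]
    intro i
    have h1 : ∀ᵐ s ∂volume.restrict (Ico ((i : ℕ) * Q.S) (((i : ℕ) + 1) * Q.S)),
        Q.α i (s - (i : ℕ) * Q.S) = Q'.α i (s - (i : ℕ) * Q.S) := by
      have h2 := hα i
      rw [EventuallyEq, ae_restrict_iff' measurableSet_Icc] at h2
      rw [ae_restrict_iff' measurableSet_Ico]
      filter_upwards [ae_comp_affine h2 one_ne_zero (-((i : ℕ) * Q.S))] with s h3 h4
      rw [mul_one, neg_add_eq_sub] at h3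
      exact h3 (hsh ⟨h4.1, h4.2.le⟩)
    filter_upwards [hαt i, hαt' i, h1] with s h2 h3 h4
    rw [h2, h3, h4]
  refine ⟨?_, ?_, fun r hr i => ?_⟩
  · intro t ht
    rcases lt_or_ge t 0 with h0 | h0
    · rw [hx0 t ⟨ht.1, h0⟩, hx0' t ⟨ht.1, h0⟩]
    · rw [hx t ⟨h0, ht.2⟩, hx' t ⟨h0, ht.2⟩, ← hσe]
      refine hye ?_
      rw [hσt]
      exact HTt.inv_mem t
  · have hf1 := P.control.finite
    have hf2 := P'.control.finite
    have hIcc : ∀ t ∈ Icc 0 (N * h), P.μ (Icc 0 t) = P'.μ (Icc 0 t) := by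
      intro t ht
      rw [← ENNReal.toReal_eq_toReal_iff' (measure_ne_top _ _) (measure_ne_top _ _)]
      change P.μ.real _ = P'.μ.real _
      rw [hμ t ht, hμ' t ht, ← hσe]
      have hm : rightLim σt t ∈ Icc 0 (N * Q.S) := by rw [hσt]; exact HTt.inv_rightLim_mem t
      rw [intervalIntegral.integral_of_le hm.1, intervalIntegral.integral_of_le hm.1,
        integral_Ioc_eq_integral_Ioo, integral_Ioc_eq_integral_Ioo]
      refine integral_congr_ae (ae_restrict_of_ae_restrict_of_subset ?_ hαe)
      exact fun s hs => ⟨hs.1.le, hs.2.trans_le hm.2⟩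
    have hconc : ∀ (m : Measure ℝ), m (Icc 0 (N * h))ᶜ = 0 → ∀ r, m (Iic r)
        = m (Iic r ∩ Icc 0 (N * h)) := fun m hm r => by
      rw [measure_inter_conull' (measure_mono_null (fun s hs => hs.2) hm)]
    refine Measure.ext_of_Iic _ _ fun r => ?_
    rw [hconc _ P.control.support, hconc _ P'.control.support]
    rcases lt_or_ge r 0 with h0 | h0
    · have : Iic r ∩ Icc 0 (N * h) = ∅ := by
        ext s
        simp only [mem_inter_iff, mem_Iic, mem_Icc, mem_empty_iff_false, iff_false]
        rintro ⟨h1, h2, _⟩; linarith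
      rw [this]; simp
    · have : Iic r ∩ Icc 0 (N * h) = Icc 0 (min r (N * h)) := by
        ext s
        simp only [mem_inter_iff, mem_Iic, mem_Icc, le_min_iff]; tauto
      rw [this]
      exact hIcc _ ⟨le_min h0 (by positivity), min_le_right _ _⟩
  · have e := hw' r hr i
    rw [← hsigma] at e
    -- Without a jump at `r` both attached controls carry the factor zero; with a jump, almost
    -- everywhere equality is transported by the affine rescaling.
    rcases (HT.leftLim_le_rightLim r).eq_or_lt with h1 | h1
    · have h1' : leftLim Q.sigma r = rightLim Q.sigma r := h1
      filter_upwards [hw r hr i, e] with s h2 h3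
      rw [h2, h3, h1', sub_self, zero_mul, zero_mul]
    · have h2 : ∀ᵐ s ∂volume.restrict (Icc (leftLim Q.sigma r) (rightLim Q.sigma r)),
          Q.α i s = Q'.α i s :=
        ae_restrict_of_ae_restrict_of_subset (HT.Icc_inv_subset r) (hα i)
      filter_upwards [hw r hr i, e, ae_Icc_zero_one_of_ae_Icc h1 h2] with s h2 h3 h4
      rw [h2, h3]
      congr 1

end Reparam

end ImpulsiveDelay

/-! ### The integral equation of a trajectory in reparameterized time -/

namespace ImpulsiveDelay

/-- As `t` increases to `r + c`, `σ` tends to its left limit while staying in `[0, S]`, where `Y` is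
continuous. So the state just before a jump is the arc at the start of the flat part. -/
lemma IsTimeChange.leftLim_of_comp_inv {E : Type*} [TopologicalSpace E] [T2Space E]
    {ψ : ℝ → ℝ} {S h : ℝ} (H : IsTimeChange ψ S h) {x Y : ℝ → E} {c : ℝ}
    (hY : ContinuousOn Y (Icc 0 S))
    (hx : ∀ r ∈ Ioo 0 h, x (r + c) = Y (rightInverse ψ S h r)) {r : ℝ} (hr : r ∈ Ioc 0 h) :
    leftLim x (r + c) = Y (leftLim (rightInverse ψ S h) r) := by
  refine leftLim_eq_of_tendsto ?_
  have h1 : Tendsto (fun t => t - c) (𝓝[<] (r + c)) (𝓝[<] r) := by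
    refine tendsto_nhdsWithin_iff.2 ⟨?_, ?_⟩
    · refine tendsto_nhdsWithin_of_tendsto_nhds ?_
      have : Tendsto (fun t => t - c) (𝓝 (r + c)) (𝓝 (r + c - c)) :=
        (continuous_id.sub continuous_const).tendsto _
      rwa [add_sub_cancel_right] at this
    · filter_upwards [self_mem_nhdsWithin] with t ht
      have : t < r + c := ht
      simp only [mem_Iio]; linarith
  have h2 : Tendsto (rightInverse ψ S h) (𝓝[<] r)
      (𝓝[Icc 0 S] (leftLim (rightInverse ψ S h) r)) :=
    tendsto_nhdsWithin_iff.2 ⟨H.inv_mono.tendsto_leftLim r, Eventually.of_forall H.inv_mem⟩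
  have h3 := ((hY _ (H.inv_leftLim_mem r)).tendsto.comp h2).comp h1
  refine h3.congr' ?_
  filter_upwards [Ioo_mem_nhdsLT (show c < r + c by linarith [hr.1])] with t ht
  have := hx (t - c) ⟨by linarith [ht.1], by linarith [ht.2, hr.2]⟩
  rw [sub_add_cancel] at this
  exact this.symm

section Segments

variable {N : ℕ} {h : ℝ} {μ : Measure ℝ} {w : ℝ → Fin N → ℝ → ℝ}

lemma segMeasure_apply {i : Fin N} {B : Set ℝ} (hB : MeasurableSet B) :
    segMeasure h μ w i B
      = ENNReal.ofReal (∫ s in (0 : ℝ)..1, w 0 i s) * B.indicator 1 0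
        + μ ((fun t => t - (i : ℕ) * h) ⁻¹' B ∩ Ioo ((i : ℕ) * h) (((i : ℕ) + 1) * h))
        + ENNReal.ofReal (∫ s in (0 : ℝ)..1, w h i s) * B.indicator 1 h := by
  have hm : Measurable (fun t : ℝ => t - (i : ℕ) * h) := by fun_prop
  rw [segMeasure, Measure.add_apply, Measure.add_apply, Measure.smul_apply, Measure.smul_apply,
    Measure.map_apply hm hB, Measure.restrict_apply (hm hB), Measure.dirac_apply' _ hB,
    Measure.dirac_apply' _ hB, smul_eq_mul, smul_eq_mul]

/-- The continuous component of `μ_i` is the translate of the continuous component of `μ`. -/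
lemma map_restrict_contPart_segMeasure [IsFiniteMeasure μ] {i : Fin N} {r : ℝ} (hr : r < h) :
    ((contPart (segMeasure h μ w i)).restrict (Icc 0 r)).map (fun t => t + (i : ℕ) * h)
      = (contPart μ).restrict (Icc ((i : ℕ) * h) (r + (i : ℕ) * h)) := by
  have hm : Measurable (fun t : ℝ => t + (i : ℕ) * h) := by fun_prop
  -- Two countable sets containing all atoms: `A'` adds the node `i * h` to those of `μ`, and `A`
  -- adds `0` and `h`, where `segMeasure` has its own point masses. Off them the two measures are
  -- translates of each other, and `r < h` keeps the next node out.
  set A' : Set ℝ := {t | μ {t} = 0}ᶜ ∪ {((i : ℕ) : ℝ) * h} with hA'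
  have hA'c : A'.Countable := (countable_atoms μ).union (countable_singleton _)
  set A : Set ℝ := (fun t : ℝ => t + (i : ℕ) * h) ⁻¹' A' ∪ {0, h} with hA
  have hAc : A.Countable :=
    (hA'c.preimage (add_left_injective _)).union ((countable_singleton h).insert 0)
  have hsing : ∀ t : ℝ, (fun s : ℝ => s - (i : ℕ) * h) ⁻¹' {t} = {t + (i : ℕ) * h} := by
    intro t; ext s; simp only [mem_preimage, mem_singleton_iff]
    constructor <;> intro h <;> linarith
  have e1 : contPart (segMeasure h μ w i) = (segMeasure h μ w i).restrict Aᶜ := by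
    refine contPart_eq_restrict_compl hAc fun t ht => ?_
    have h0 : (0 : ℝ) ∉ ({t} : Set ℝ) := fun e => ht (Or.inr (Or.inl (mem_singleton_iff.1 e).symm))
    have hh : h ∉ ({t} : Set ℝ) := fun e => ht (Or.inr (Or.inr (mem_singleton_iff.1 e).symm))
    have hμ : μ {t + (i : ℕ) * h} = 0 := not_not.1 fun h1 => ht (Or.inl (Or.inl h1))
    rw [segMeasure_apply (measurableSet_singleton t), indicator_of_notMem h0, indicator_of_notMem hh,
      hsing, mul_zero, mul_zero, zero_add, add_zero]
    exact measure_mono_null inter_subset_left hμ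
  have e2 : contPart μ = μ.restrict A'ᶜ :=
    contPart_eq_restrict_compl hA'c fun t ht => not_not.1 fun h1 => ht (Or.inl h1)
  rw [e1, e2]
  ext E hE
  have hAm := hAc.measurableSet
  have hA'm := hA'c.measurableSet
  rw [Measure.map_apply hm hE, Measure.restrict_apply (hm hE), Measure.restrict_apply hE,
    Measure.restrict_apply ((hm hE).inter measurableSet_Icc),
    Measure.restrict_apply (hE.inter measurableSet_Icc),
    segMeasure_apply (((hm hE).inter measurableSet_Icc).inter hAm.compl),
    indicator_of_notMem (fun h1 => h1.2 (Or.inr (Or.inl rfl))),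
    indicator_of_notMem (fun h1 => h1.2 (Or.inr (Or.inr rfl))), mul_zero, mul_zero, zero_add,
    add_zero]
  congr 1
  ext t
  simp only [mem_inter_iff, mem_preimage, sub_add_cancel, mem_Icc, mem_compl_iff, mem_Ioo, hA,
    mem_union, mem_insert_iff, mem_singleton_iff, not_or]
  constructor
  · rintro ⟨⟨⟨h1, h2, h3⟩, h4, h5, h6⟩, h7, h8⟩
    exact ⟨⟨h1, h7.le, by linarith⟩, h4⟩
  · rintro ⟨⟨h1, h2, h3⟩, h4⟩
    have h5 : t ≠ (i : ℕ) * h := fun e => h4 (Or.inr e)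
    have h6 : (i : ℕ) * h < t := lt_of_le_of_ne h2 h5.symm
    exact ⟨⟨⟨h1, by linarith, by linarith⟩, h4, by linarith [h6] |> fun (h7 : 0 < t - (i : ℕ) * h) =>
      h7.ne', by linarith |> fun (h7 : t - (i : ℕ) * h < h) => h7.ne⟩, h6, by linarith⟩

end Segments

/-- The integral equation of a trajectory, written in terms of the reparameterized time. -/
lemma IsMatching.inside_eq {n N : ℕ} {h S C : ℝ} {μ : Measure ℝ} {w : ℝ → Fin N → ℝ → ℝ}
    {α : Fin N → ℝ → ℝ} (M : IsMatching h μ w S α)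
    {f g : State n × State n → State n} (hf : Continuous f) (hg : Continuous g)
    (hfC : ∀ p, ‖f p‖ ≤ C) (hgC : ∀ p, ‖g p‖ ≤ C) {x : ℝ → State n}
    (hx : BoundedVariationOn x (Icc (-h) (N * h))) {F : ℝ → State n} (hF : IntegrableOn F (Icc 0 S))
    {i : Fin N} {ψ : ℝ → ℝ} (hψ : ψ = primitive fun s => 1 - ∑ i, α i s)
    (hFk : ∀ᵐ s ∂volume.restrict (Icc 0 S),
      ¬ leftLim (rightInverse ψ S h) (ψ s) < rightLim (rightInverse ψ S h) (ψ s) →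
      F s = (1 - ∑ j, α j s) • f (x (ψ s + (i : ℕ) * h), x (ψ s + (i : ℕ) * h - h))
        + α i s • g (x (ψ s + (i : ℕ) * h), x (ψ s + (i : ℕ) * h - h)))
    {r : ℝ} (hr : r ∈ Ico 0 h) :
    (∫ t' in ((i : ℕ) * h)..(r + (i : ℕ) * h), f (x t', x (t' - h)))
      + (∫ t' in Icc ((i : ℕ) * h) (r + (i : ℕ) * h), g (x t', x (t' - h)) ∂(contPart μ))
      + ∑' q : Ioc 0 r, ∫ s in leftLim (rightInverse ψ S h) q..rightLim (rightInverse ψ S h) q, F s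
    = ∫ s in rightLim (rightInverse ψ S h) 0..rightLim (rightInverse ψ S h) r, F s := by
  have := M.finite
  have HT := M.clock.isTimeChange
  rw [← hψ] at HT
  have hh := HT.h_pos
  have hab : -h ≤ N * h := by nlinarith [(Nat.cast_nonneg N : (0 : ℝ) ≤ N)]
  -- The integrands are measurable because `x`, being of bounded variation, agrees with a measurable
  -- function on the whole interval, history included.
  obtain ⟨x', hx'm, hx'⟩ := exists_measurable_eqOn hab hx
  have hi1 : ((i : ℕ) : ℝ) + 1 ≤ N := by exact_mod_cast i.2
  have hi0 : (0 : ℝ) ≤ (i : ℕ) := Nat.cast_nonneg _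
  have hk : ∀ {k : State n × State n → State n}, Continuous k → ∀ q ∈ Icc 0 h,
      k (x' (q + (i : ℕ) * h), x' (q + (i : ℕ) * h - h))
        = k (x (q + (i : ℕ) * h), x (q + (i : ℕ) * h - h)) := by
    intro k _ q hq
    rw [hx' (show q + (i : ℕ) * h ∈ Icc (-h) (N * h) from
        ⟨by nlinarith [hq.1], by nlinarith [hq.2]⟩),
      hx' (show q + (i : ℕ) * h - h ∈ Icc (-h) (N * h) from
        ⟨by nlinarith [hq.1], by nlinarith [hq.2]⟩)]
  have hkm : ∀ {k : State n × State n → State n}, Continuous k →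
      Measurable fun q => k (x' (q + (i : ℕ) * h), x' (q + (i : ℕ) * h - h)) := by
    intro k hk
    have h1 : Measurable fun q : ℝ => x' (q + (i : ℕ) * h) := hx'm.comp (by fun_prop)
    have h2 : Measurable fun q : ℝ => x' (q + (i : ℕ) * h - h) := hx'm.comp (by fun_prop)
    exact hk.measurable.comp (h1.prodMk h2)
  have hkf : AEStronglyMeasurable (fun q => f (x (q + (i : ℕ) * h), x (q + (i : ℕ) * h - h)))
      (volume.restrict (Icc 0 h)) := by
    refine (hkm hf).aestronglyMeasurable.congr ?_
    filter_upwards [ae_restrict_mem measurableSet_Icc] with q hq using hk hf q hq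
  have hkg : AEStronglyMeasurable (fun q => g (x (q + (i : ℕ) * h), x (q + (i : ℕ) * h - h)))
      (pushDensity ψ (α i) S) := by
    refine (hkm hg).aestronglyMeasurable.congr ?_
    have h1 : ∀ᵐ q ∂pushDensity ψ (α i) S, q ∈ Icc 0 h :=
      pushDensity_compl HT.aemeasurable measurableSet_Icc fun s hs => HT.maps hs
    filter_upwards [h1] with q hq using hk hg q hq
  rw [hψ] at hkg hFk ⊢
  have key := M.clock.integral_decomposition (M.rate i) hF hkf hkg (fun _ => hfC _) (fun _ => hgC _)
    hFk (r := r) ⟨hr.1, hr.2.le⟩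
  rw [key]
  congr 2
  · have := intervalIntegral.integral_comp_add_right (a := 0) (b := r)
      (fun t => f (x t, x (t - h))) ((i : ℕ) * h)
    rw [zero_add] at this
    exact this.symm
  · have hm : MeasurableEmbedding (fun t : ℝ => t + (i : ℕ) * h) :=
      (MeasurableEquiv.addRight (((i : ℕ) : ℝ) * h)).measurableEmbedding
    rw [← map_restrict_contPart_segMeasure (w := w) hr.2, hm.integral_map, M.seg i]

/-! ### Sums of translates of measures on `[0, h]` -/

section Translates

variable {N : ℕ} {h : ℝ} {m : Fin N → Measure ℝ}

/-- The sum of the translates of measures on `[0, h]` to the successive segments of `[0, N * h]`. -/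
noncomputable def sumTranslates (h : ℝ) (m : Fin N → Measure ℝ) : Measure ℝ :=
  ∑ i : Fin N, (m i).map (fun t => t + (i : ℕ) * h)

lemma sumTranslates_apply {B : Set ℝ} (hB : MeasurableSet B) :
    sumTranslates h m B = ∑ i : Fin N, m i ((fun t => t + (i : ℕ) * h) ⁻¹' B) := by
  rw [sumTranslates, Measure.finsetSum_apply]
  exact Finset.sum_congr rfl fun i _ => Measure.map_apply (by fun_prop) hB

lemma isFiniteMeasure_sumTranslates (hf : ∀ i, IsFiniteMeasure (m i)) :
    IsFiniteMeasure (sumTranslates h m) := by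
  refine ⟨?_⟩
  rw [sumTranslates_apply MeasurableSet.univ]
  exact ENNReal.sum_lt_top.2 fun i _ => measure_lt_top _ _

variable (hh : 0 < h) (hm : ∀ i, m i (Icc 0 h)ᶜ = 0)
include hh hm

lemma sumTranslates_compl : sumTranslates h m (Icc 0 (N * h))ᶜ = 0 := by
  rw [sumTranslates_apply measurableSet_Icc.compl]
  refine Finset.sum_eq_zero fun i _ => measure_mono_null ?_ (hm i)
  intro t ht ht'
  refine ht ?_
  exact segment_subset hh.le i ⟨by linarith [ht'.1], by linarith [ht'.2]⟩

lemma sumTranslates_inner (i : Fin N) {B : Set ℝ} (hB : MeasurableSet B) (hBs : B ⊆ Ioo 0 h) :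
    sumTranslates h m ((fun t => t - (i : ℕ) * h) ⁻¹' B) = m i B := by
  have hmeas : Measurable (fun t : ℝ => t - (i : ℕ) * h) := by fun_prop
  rw [sumTranslates_apply (hmeas hB), Finset.sum_eq_single i]
  · congr 1
    ext t; simp
  · intro j _ hji
    refine measure_mono_null ?_ (hm j)
    intro t ht ht'
    have h1 := hBs ht
    simp only [mem_Ioo] at h1
    rcases lt_or_gt_of_ne hji with h2 | h2
    · have := segment_mul_le hh.le h2
      linarith [ht'.2, h1.1]
    · have := segment_mul_le hh.le h2
      linarith [ht'.1, h1.2]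
  · simp

lemma sumTranslates_node (k : Fin (N + 1)) : sumTranslates h m {((k : ℕ) : ℝ) * h}
    = (Fin.cons 0 (fun i => m i {h}) : Fin (N + 1) → ENNReal) k
      + (Fin.snoc (fun i => m i {0}) 0 : Fin (N + 1) → ENNReal) k := by
  -- Both entries are rewritten as sums over the segments, so that the claim can be checked one
  -- segment at a time, by comparing `k` with `i` and `i + 1`.
  have h1 : ∀ k : Fin (N + 1), (Fin.cons 0 (fun i => m i {h}) : Fin (N + 1) → ENNReal) k
      = ∑ i : Fin N, if i.succ = k then m i {h} else 0 := by
    intro k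
    refine Fin.cases ?_ (fun j => ?_) k
    · simp
    · simp [Fin.succ_inj]
  have h2 : ∀ k : Fin (N + 1), (Fin.snoc (fun i => m i {0}) 0 : Fin (N + 1) → ENNReal) k
      = ∑ i : Fin N, if i.castSucc = k then m i {0} else 0 := by
    intro k
    refine Fin.lastCases ?_ (fun j => ?_) k
    · simp [Fin.castSucc_ne_last]
    · simp [Fin.castSucc_inj]
  rw [h1, h2, ← Finset.sum_add_distrib, sumTranslates_apply (measurableSet_singleton _)]
  refine Finset.sum_congr rfl fun i _ => ?_
  have hpre : (fun t : ℝ => t + (i : ℕ) * h) ⁻¹' {((k : ℕ) : ℝ) * h}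
      = {((k : ℕ) : ℝ) * h - (i : ℕ) * h} := by
    ext t; simp only [mem_preimage, mem_singleton_iff]
    constructor <;> intro h <;> linarith
  rw [hpre]
  rcases lt_trichotomy (k : ℕ) (i : ℕ) with h3 | h3 | h3
  · have e1 : ¬ i.succ = k := fun e => by have := congrArg Fin.val e; simp at this; omega
    have e2 : ¬ i.castSucc = k := fun e => by have := congrArg Fin.val e; simp at this; omega
    rw [if_neg e1, if_neg e2, add_zero]
    refine measure_mono_null (singleton_subset_iff.2 fun h4 => ?_) (hm i)
    have h5 : ((k : ℕ) : ℝ) < (i : ℕ) := by exact_mod_cast h3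
    nlinarith [h4.1]
  · have e1 : ¬ i.succ = k := fun e => by have := congrArg Fin.val e; simp at this; omega
    have e2 : i.castSucc = k := Fin.ext (by simp [h3])
    rw [if_neg e1, if_pos e2, zero_add, h3, sub_self]
  · rcases Nat.lt_or_ge ((i : ℕ) + 1) (k : ℕ) with h4 | h4
    · have e1 : ¬ i.succ = k := fun e => by have := congrArg Fin.val e; simp at this; omega
      have e2 : ¬ i.castSucc = k := fun e => by have := congrArg Fin.val e; simp at this; omega
      rw [if_neg e1, if_neg e2, add_zero]
      refine measure_mono_null (singleton_subset_iff.2 fun h6 => ?_) (hm i)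
      have h5 : ((i : ℕ) : ℝ) + 1 < (k : ℕ) := by exact_mod_cast h4
      nlinarith [h6.2]
    · have h5 : (k : ℕ) = (i : ℕ) + 1 := by omega
      have e1 : i.succ = k := Fin.ext (by simp [h5])
      have e2 : ¬ i.castSucc = k := fun e => by have := congrArg Fin.val e; simp at this; omega
      rw [if_pos e1, if_neg e2, add_zero, h5]
      push_cast
      rw [show ((i : ℕ) + 1) * h - (i : ℕ) * h = h by ring]

/-- The interior of a segment sees only its own translate. At a node, however, the end mass of one
segment and the initial mass of the next are merged in the sum; the integrals of the attached
controls at `0` and `h` are what separates them again. -/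
lemma segMeasure_sumTranslates {w : ℝ → Fin N → ℝ → ℝ} (hf : ∀ i, IsFiniteMeasure (m i)) (i : Fin N)
    (h0 : ∫ s in (0 : ℝ)..1, w 0 i s = (m i).real {0})
    (h1 : ∫ s in (0 : ℝ)..1, w h i s = (m i).real {h}) :
    segMeasure h (sumTranslates h m) w i = m i := by
  ext B hB
  have hset : (fun t => t - (i : ℕ) * h) ⁻¹' B ∩ Ioo ((i : ℕ) * h) (((i : ℕ) + 1) * h)
      = (fun t => t - (i : ℕ) * h) ⁻¹' (B ∩ Ioo 0 h) := by
    ext t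
    simp only [mem_inter_iff, mem_preimage, mem_Ioo, and_congr_right_iff]
    intro _
    constructor <;> rintro ⟨h1, h2⟩ <;> constructor <;> linarith
  have hpt : ∀ a : ℝ, ENNReal.ofReal ((m i).real {a}) * B.indicator 1 a = m i (B ∩ {a}) := by
    intro a
    rw [Measure.real, ENNReal.ofReal_toReal (measure_ne_top _ _)]
    by_cases ha : a ∈ B
    · rw [indicator_of_mem ha, inter_eq_right.2 (singleton_subset_iff.2 ha)]; simp
    · rw [indicator_of_notMem ha, inter_singleton_eq_empty.2 ha]; simp
  rw [segMeasure_apply hB, hset, sumTranslates_inner hh hm i (hB.inter measurableSet_Ioo)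
    inter_subset_right, h0, h1, hpt, hpt]
  have hI : m i B = m i (B ∩ Icc 0 h) :=
    (measure_inter_conull' (measure_mono_null (fun s hs => hs.2) (hm i))).symm
  have hIcc : Icc 0 h = {0} ∪ Ioo 0 h ∪ {h} := by
    rw [singleton_union, Ioo_insert_left hh, union_singleton, Ico_insert_right hh.le]
  rw [hI, hIcc, inter_union_distrib_left, inter_union_distrib_left,
    measure_union _ (hB.inter (measurableSet_singleton _)),
    measure_union _ (hB.inter measurableSet_Ioo)]
  · refine Set.disjoint_left.2 fun s h2 h3 => ?_
    rw [mem_singleton_iff.1 h2.2] at h3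
    exact lt_irrefl _ h3.2.1
  · refine Set.disjoint_left.2 fun s h2 h3 => ?_
    have e := mem_singleton_iff.1 h3.2
    rcases h2 with h2 | h2
    · rw [mem_singleton_iff.1 h2.2] at e; exact hh.ne e
    · rw [e] at h2; exact lt_irrefl _ h2.2.2

end Translates

end ImpulsiveDelay

/-! ### From reparameterized to extended processes -/

namespace ImpulsiveDelay

section Reparam

variable {n N : ℕ} {h : ℝ} {f g : State n × State n → State n} {x₀ ξ₀ : State n}

namespace PreReparamProcess

variable (Q : PreReparamProcess N h f g x₀ ξ₀)

/-- The attached controls of the extended process constructed from `Q`. -/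
noncomputable def attached (r : ℝ) (i : Fin N) (s : ℝ) : ℝ :=
  (rightLim Q.sigma r - leftLim Q.sigma r)
    -- An attached control must be nonnegative everywhere, whereas `α_i` is so only almost
    -- everywhere; the truncation changes a null set.
    * max (Q.α i (leftLim Q.sigma r + s * (rightLim Q.sigma r - leftLim Q.sigma r))) 0

variable (hh : 0 < h)
include hh

lemma leftLim_le_rightLim_sigma (r : ℝ) : leftLim Q.sigma r ≤ rightLim Q.sigma r :=
  (Q.isTimeChange hh).leftLim_le_rightLim r

/-- A property that holds almost everywhere on `[0, S]` holds almost everywhere on the rescaled flat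
parts of the change of variable. -/
lemma ae_rescale {p : ℝ → Prop} (hp : ∀ᵐ s ∂volume.restrict (Icc 0 Q.S), p s) {r : ℝ}
    (hr : leftLim Q.sigma r < rightLim Q.sigma r) : ∀ᵐ s ∂volume.restrict (Icc (0 : ℝ) 1),
      p (leftLim Q.sigma r + s * (rightLim Q.sigma r - leftLim Q.sigma r)) :=
  ae_Icc_zero_one_of_ae_Icc hr
    (ae_restrict_of_ae_restrict_of_subset ((Q.isTimeChange hh).Icc_inv_subset r) hp)

lemma attached_ae_eq (r : ℝ) (i : Fin N) : ∀ᵐ s ∂volume.restrict (Icc (0 : ℝ) 1),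
    Q.attached r i s = (rightLim Q.sigma r - leftLim Q.sigma r)
      * Q.α i (leftLim Q.sigma r + s * (rightLim Q.sigma r - leftLim Q.sigma r)) := by
  rcases (Q.leftLim_le_rightLim_sigma hh r).eq_or_lt with h1 | h1
  · simp [attached, h1]
  · filter_upwards [Q.ae_rescale hh (Q.isRate i).nonneg h1] with s hs
    rw [attached, max_eq_left hs]

lemma aemeasurable_attached (r : ℝ) (i : Fin N) :
    AEMeasurable (Q.attached r i) (volume.restrict (Icc 0 1)) := by
  rcases (Q.leftLim_le_rightLim_sigma hh r).eq_or_lt with h1 | h1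
  · have : Q.attached r i = fun _ => 0 := by funext s; simp [attached, h1]
    rw [this]; exact aemeasurable_const
  · have hm : Measurable fun s : ℝ => (rightLim Q.sigma r - leftLim Q.sigma r)
        * (Q.isRate i).meas.mk (Q.α i)
          (leftLim Q.sigma r + s * (rightLim Q.sigma r - leftLim Q.sigma r)) :=
      ((Q.isRate i).meas.measurable_mk.comp (by fun_prop)).const_mul _
    refine hm.aemeasurable.congr ?_
    filter_upwards [Q.attached_ae_eq hh r i, Q.ae_rescale hh (Q.isRate i).meas.ae_eq_mk h1]
      with s h2 h3
    rw [h2, h3]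

lemma attached_nonneg (r : ℝ) (i : Fin N) (s : ℝ) : 0 ≤ Q.attached r i s :=
  mul_nonneg (sub_nonneg.2 (Q.leftLim_le_rightLim_sigma hh r)) (le_max_right _ _)

/-- By the affine substitution both sides are the integral of `α_i` over the flat part at level `r`.
-/
lemma integral_attached {r : ℝ} (hr : r ∈ Icc 0 h) (i : Fin N) :
    ∫ s in (0 : ℝ)..1, Q.attached r i s = (pushDensity Q.psi (Q.α i) Q.S).real {r} := by
  have HT := Q.isTimeChange hh
  rw [HT.pushDensity_singleton (Q.isRate i) hr]
  have e : ∫ s in (0 : ℝ)..1, Q.attached r i s = ∫ s in (0 : ℝ)..1,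
      (rightLim Q.sigma r - leftLim Q.sigma r)
        * Q.α i (leftLim Q.sigma r + (rightLim Q.sigma r - leftLim Q.sigma r) * s) := by
    rw [intervalIntegral.integral_of_le zero_le_one, intervalIntegral.integral_of_le zero_le_one]
    refine integral_congr_ae (ae_restrict_of_ae_restrict_of_subset Ioc_subset_Icc_self ?_)
    filter_upwards [Q.attached_ae_eq hh r i] with s hs
    rw [hs, mul_comm s]
  have e2 := intervalIntegral.smul_integral_comp_add_mul (a := 0) (b := 1) (Q.α i)
    (rightLim Q.sigma r - leftLim Q.sigma r) (leftLim Q.sigma r)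
  rw [e, intervalIntegral.integral_const_mul]
  rw [smul_eq_mul, mul_zero, add_zero, mul_one, add_sub_cancel] at e2
  exact e2

/-- The controls sum to one on a flat part, so both sides are equal to its length. -/
lemma sum_attached {r : ℝ} (hr : r ∈ Icc 0 h) : ∀ᵐ s ∂volume.restrict (Icc (0 : ℝ) 1),
    ∑ i, Q.attached r i s = ∑ i, ∫ s' in (0 : ℝ)..1, Q.attached r i s' := by
  have HT := Q.isTimeChange hh
  have hz : ∀ᵐ s ∂volume.restrict (Icc (leftLim Q.sigma r) (rightLim Q.sigma r)),
      1 - ∑ i, Q.α i s = 0 := (Q.isClock hh).ae_eq_zero hr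
  have hsum : ∑ i, ∫ s' in (0 : ℝ)..1, Q.attached r i s'
      = rightLim Q.sigma r - leftLim Q.sigma r := by
    have e : ∀ i, ∫ s in (0 : ℝ)..1, Q.attached r i s
        = ∫ s in leftLim Q.sigma r..rightLim Q.sigma r, Q.α i s := fun i => by
      rw [Q.integral_attached hh hr, HT.pushDensity_singleton (Q.isRate i) hr]; rfl
    simp only [e]
    have hii : ∀ i, IntervalIntegrable (Q.α i) volume (leftLim Q.sigma r) (rightLim Q.sigma r) :=
      fun i => (Q.isRate i).intervalIntegrable (HT.inv_leftLim_mem r) (HT.inv_rightLim_mem r)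
    rw [← intervalIntegral.integral_finsetSum fun i _ => hii i]
    have e2 : ∫ s in leftLim Q.sigma r..rightLim Q.sigma r, ∑ i, Q.α i s
        = ∫ s in leftLim Q.sigma r..rightLim Q.sigma r, (1 : ℝ) := by
      rw [intervalIntegral.integral_of_le (Q.leftLim_le_rightLim_sigma hh r),
        intervalIntegral.integral_of_le (Q.leftLim_le_rightLim_sigma hh r)]
      refine integral_congr_ae (ae_restrict_of_ae_restrict_of_subset Ioc_subset_Icc_self ?_)
      filter_upwards [hz] with s hs
      linarith
    rw [e2]; simp
  rw [hsum]
  rcases (Q.leftLim_le_rightLim_sigma hh r).eq_or_lt with h1 | h1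
  · simp [attached, h1]
  · filter_upwards [ae_all_iff.2 fun i => Q.attached_ae_eq hh r i,
      ae_Icc_zero_one_of_ae_Icc h1 hz] with s h2 h3
    simp only [h2]
    rw [← Finset.mul_sum, ← sub_eq_zero.1 h3, mul_one]

lemma pushDensity_compl_Icc (i : Fin N) : pushDensity Q.psi (Q.α i) Q.S (Icc 0 h)ᶜ = 0 :=
  pushDensity_compl (Q.isTimeChange hh).aemeasurable measurableSet_Icc
    fun _ hs => (Q.isTimeChange hh).maps hs

lemma isFiniteMeasure_pushDensity (i : Fin N) : IsFiniteMeasure (pushDensity Q.psi (Q.α i) Q.S) :=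
  ImpulsiveDelay.isFiniteMeasure_pushDensity (Q.isTimeChange hh).aemeasurable (Q.isRate i)

lemma isImpulsiveControl : IsImpulsiveControl N h
    (sumTranslates h fun i => pushDensity Q.psi (Q.α i) Q.S) Q.attached where
  finite := isFiniteMeasure_sumTranslates (Q.isFiniteMeasure_pushDensity hh)
  support := sumTranslates_compl hh (Q.pushDensity_compl_Icc hh)
  measurable := fun r _ i => Q.aemeasurable_attached hh r i
  nonneg := fun r _ i s _ => Q.attached_nonneg hh r i s
  sum_const := fun r hr => Q.sum_attached hh hr
  atom_interior := fun r hr i => by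
    have h1 := sumTranslates_inner hh (Q.pushDensity_compl_Icc hh) i (measurableSet_singleton r)
      (singleton_subset_iff.2 hr)
    have h2 : (fun t : ℝ => t - (i : ℕ) * h) ⁻¹' {r} = {r + (i : ℕ) * h} := by
      ext s; simp only [mem_preimage, mem_singleton_iff]
      constructor <;> intro h <;> linarith
    rw [h2] at h1
    rw [Q.integral_attached hh ⟨hr.1.le, hr.2.le⟩, Measure.real, Measure.real, h1]
  atom_node := fun k => by
    have hf := Q.isFiniteMeasure_pushDensity hh
    have hint : ∀ r ∈ Icc 0 h, ∀ i, IntervalIntegrable (Q.attached r i) volume 0 1 := by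
      intro r hr i
      rw [intervalIntegrable_iff_integrableOn_Icc_of_le zero_le_one]
      refine Integrable.of_bound (Q.aemeasurable_attached hh r i).aestronglyMeasurable
        (∑ i, ∫ s' in (0 : ℝ)..1, Q.attached r i s') ?_
      filter_upwards [Q.sum_attached hh hr] with s h1
      rw [Real.norm_of_nonneg (Q.attached_nonneg hh r i s), ← h1]
      exact Finset.single_le_sum (f := fun i => Q.attached r i s)
        (fun j _ => Q.attached_nonneg hh r j s) (Finset.mem_univ i)
    have h0m : (0 : ℝ) ∈ Icc 0 h := ⟨le_rfl, hh.le⟩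
    have hhm : h ∈ Icc 0 h := ⟨hh.le, le_rfl⟩
    have hc : IntervalIntegrable ((Fin.cons (fun _ => 0) (Q.attached h) : Fin (N + 1) → ℝ → ℝ) k)
        volume 0 1 ∧ (∫ s in (0 : ℝ)..1,
          (Fin.cons (fun _ => 0) (Q.attached h) : Fin (N + 1) → ℝ → ℝ) k s)
        = ((Fin.cons 0 (fun i => pushDensity Q.psi (Q.α i) Q.S {h}) :
            Fin (N + 1) → ENNReal) k).toReal ∧
        (Fin.cons 0 (fun i => pushDensity Q.psi (Q.α i) Q.S {h}) : Fin (N + 1) → ENNReal) k ≠ ⊤ := by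
      refine Fin.cases ?_ (fun i => ?_) k
      · simp
      · simpa [measure_ne_top] using ⟨hint h hhm i, Q.integral_attached hh hhm i⟩
    have hs : IntervalIntegrable ((Fin.snoc (Q.attached 0) (fun _ => 0) : Fin (N + 1) → ℝ → ℝ) k)
        volume 0 1 ∧ (∫ s in (0 : ℝ)..1,
          (Fin.snoc (Q.attached 0) (fun _ => 0) : Fin (N + 1) → ℝ → ℝ) k s)
        = ((Fin.snoc (fun i => pushDensity Q.psi (Q.α i) Q.S {0}) 0 :
            Fin (N + 1) → ENNReal) k).toReal ∧
        (Fin.snoc (fun i => pushDensity Q.psi (Q.α i) Q.S {0}) 0 : Fin (N + 1) → ENNReal) k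
          ≠ ⊤ := by
      refine Fin.lastCases ?_ (fun i => ?_) k
      · simp
      · simpa [measure_ne_top] using ⟨hint 0 h0m i, Q.integral_attached hh h0m i⟩
    rw [intervalIntegral.integral_add hc.1 hs.1, hc.2.1, hs.2.1, Measure.real,
      sumTranslates_node hh (Q.pushDensity_compl_Icc hh), ENNReal.toReal_add hc.2.2 hs.2.2]

lemma isMatching : IsMatching h (sumTranslates h fun i => pushDensity Q.psi (Q.α i) Q.S)
    Q.attached Q.S Q.α where
  finite := isFiniteMeasure_sumTranslates (Q.isFiniteMeasure_pushDensity hh)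
  rate := Q.isRate
  clock := Q.isClock hh
  seg := fun i => segMeasure_sumTranslates hh (Q.pushDensity_compl_Icc hh)
    (Q.isFiniteMeasure_pushDensity hh) i (Q.integral_attached hh ⟨le_rfl, hh.le⟩ i)
    (Q.integral_attached hh ⟨hh.le, le_rfl⟩ i)

end PreReparamProcess

/-- The jump functions of the extended process constructed from `Q`. -/
noncomputable def PreReparamProcess.jump (Q : PreReparamProcess N h f g x₀ ξ₀) (r : ℝ)
    (k : Fin (N + 1)) (s : ℝ) : State n :=
  Fin.cases (motive := fun _ => State n) (if s = 1 ∧ r = h then x₀ else ξ₀)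
    (fun i => Q.y i.succ (leftLim Q.sigma r + s * (rightLim Q.sigma r - leftLim Q.sigma r))) k

/-- A trajectory whose values at the interior points are those of the arcs of `Q`. -/
structure IsUnfolding (Q : PreReparamProcess N h f g x₀ ξ₀) (x : ℝ → State n) : Prop where
  history : ∀ t ∈ Ico (-h) 0, x t = ξ₀
  start : x 0 = x₀
  node : ∀ i : Fin N, 0 < (i : ℕ) → x ((i : ℕ) * h) = Q.y i.succ (rightLim Q.sigma 0)
  inner : ∀ i : Fin N, ∀ r ∈ Ioo 0 h, x (r + (i : ℕ) * h) = Q.y i.succ (Q.sigma r)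
  terminal : x (N * h) = Q.y (Fin.last N) Q.S
  bounded_variation : BoundedVariationOn x (Icc (-h) (N * h))

/-- The trajectory is the concatenated arc composed with the right inverse of the concatenated time
change, preceded by the constant history. -/
lemma PreReparamProcess.exists_isUnfolding (Q : PreReparamProcess N h f g x₀ ξ₀) (hN : 0 < N)
    (hh : 0 < h) {C : ℝ} (hfC : ∀ p, ‖f p‖ ≤ C) (hgC : ∀ p, ‖g p‖ ≤ C) :
    ∃ x, IsUnfolding Q x := by
  have HT := Q.isTimeChange hh
  have hS := Q.S_pos
  have hNr : (0 : ℝ) < N := by exact_mod_cast hN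
  obtain ⟨ψt, hψt⟩ := exists_concat (N := N) (a := Q.S) hN hS (fun i s => (i : ℕ) * h + Q.psi s)
    fun i j hij => by rw [HT.map_zero, HT.map_end, hij]; push_cast; ring
  obtain ⟨yt, hyt⟩ := exists_concat (N := N) (a := Q.S) hN hS (fun i s => Q.y i.succ s)
    fun i j hij => Q.y_link hij
  have HTt := HT.concat hN (Q.isClock hh).lipschitzOnWith hψt
  have hyL : LipschitzOnWith C.toNNReal yt (Icc 0 (N * Q.S)) := by
    refine lipschitzOnWith_concat hS.le fun i hi => LipschitzOnWith.of_dist_le_mul fun s hs t ht => ?_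
    have hsh : ∀ {s : ℝ}, s ∈ Icc ((i : ℕ) * Q.S) (((i : ℕ) + 1) * Q.S) →
      s - (i : ℕ) * Q.S ∈ Icc 0 Q.S := fun hs => ⟨by linarith [hs.1], by linarith [hs.2]⟩
    rw [hyt ⟨i, hi⟩ s hs, hyt ⟨i, hi⟩ t ht]
    have := (Q.lipschitzOnWith_y hfC hgC ⟨i, hi⟩).dist_le_mul _ (hsh hs) _ (hsh ht)
    rwa [dist_sub_right] at this
  set σt := rightInverse ψt (N * Q.S) (N * h) with hσt
  have hy0 : yt 0 = x₀ := by
    rw [hyt ⟨0, hN⟩ 0 ⟨by simp, by simpa using hS.le⟩]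
    have := Q.link ⟨0, hN⟩
    rw [show (⟨0, hN⟩ : Fin N).castSucc = 0 from rfl, Q.y_zero_end] at this
    simpa using this
  have hval : ∀ i : Fin N, ∀ r ∈ Ico 0 h, 0 < r + (i : ℕ) * h →
      yt (σt (r + (i : ℕ) * h)) = Q.y i.succ (rightLim Q.sigma r) := by
    intro i r hr hpos
    have hm := HT.inv_rightLim_mem r
    rw [hσt, HT.concat_inv hN hψt (i := i) hr hpos,
      hyt i _ ⟨by linarith [hm.1], by linarith [hm.2]⟩, add_sub_cancel_left]
    rfl
  refine ⟨fun t => if t < 0 then ξ₀ else yt (σt t), ⟨fun t ht => if_pos ht.2, ?_, fun i hi => ?_,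
    fun i r hr => ?_, ?_, ?_⟩⟩
  · simp only [lt_irrefl, if_false]
    rw [hσt, rightInverse_of_nonpos le_rfl, hy0]
  · have hpos : 0 < ((i : ℕ) : ℝ) * h := mul_pos (by exact_mod_cast hi) hh
    rw [if_neg (not_lt.2 hpos.le)]
    have := hval i 0 ⟨le_rfl, hh⟩ (by linarith)
    rwa [zero_add] at this
  · have hpos : 0 < r + (i : ℕ) * h := add_pos_of_pos_of_nonneg hr.1 (by positivity)
    simp only [if_neg (not_lt.2 hpos.le)]
    rw [hval i r ⟨hr.1.le, hr.2⟩ hpos]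
    congr 1
    exact HT.inv_rightLim hr.1
  · have hpos : 0 < (N : ℝ) * h := by positivity
    simp only [if_neg (not_lt.2 hpos.le)]
    rw [hσt, rightInverse_of_ge HTt.h_pos le_rfl]
    obtain ⟨i, hi⟩ : ∃ i : Fin N, (i : ℕ) + 1 = N := ⟨⟨N - 1, by omega⟩, by simp only; omega⟩
    have hi' : ((i : ℕ) : ℝ) + 1 = N := by exact_mod_cast hi
    have hlast : Fin.last N = i.succ := Fin.ext (by simp [hi])
    rw [hlast, hyt i _ ⟨by rw [← hi']; linarith, by rw [← hi']⟩]
    congr 1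
    rw [← hi']; ring
  -- Bounded variation: a Lipschitz function of a monotone one. The discontinuity at `0` from `ξ₀`
  -- to `x₀` is absorbed by sending negative times to the extra parameter `-1`; since `-1` is at
  -- distance at least one from `[0, N * S]`, adding `dist ξ₀ x₀` to the Lipschitz constant is
  -- enough.
  · set Y : ℝ → State n := fun s => if s < 0 then ξ₀ else yt s with hY
    set G : ℝ → ℝ := fun t => if t < 0 then -1 else σt t with hG
    set K : NNReal := C.toNNReal + nndist ξ₀ x₀ with hK
    have hKC : (C.toNNReal : ℝ) ≤ K := by rw [hK]; push_cast; linarith [dist_nonneg (x := ξ₀) (y := x₀)]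
    have hYL : LipschitzOnWith K Y ({-1} ∪ Icc 0 (N * Q.S)) := by
      have h1 : ∀ s ∈ Icc 0 (N * Q.S), dist (Y (-1)) (Y s) ≤ K * dist (-1) s := by
        intro s hs
        have e1 : Y (-1) = ξ₀ := if_pos (by norm_num)
        have e2 : Y s = yt s := if_neg (not_lt.2 hs.1)
        have h2 := hyL.dist_le_mul 0 ⟨le_rfl, by positivity⟩ s hs
        rw [hy0, Real.dist_eq, zero_sub, abs_neg, abs_of_nonneg hs.1] at h2
        have h3 := dist_triangle ξ₀ x₀ (yt s)
        rw [e1, e2, Real.dist_eq, abs_of_nonpos (by linarith [hs.1]), hK]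
        push_cast
        have h4 := mul_nonneg (dist_nonneg (x := ξ₀) (y := x₀)) hs.1
        have h5 : (0 : ℝ) ≤ C.toNNReal := NNReal.coe_nonneg _
        nlinarith
      refine LipschitzOnWith.of_dist_le_mul fun s hs t ht => ?_
      rcases hs with hs | hs <;> rcases ht with ht | ht
      · rw [mem_singleton_iff.1 hs, mem_singleton_iff.1 ht]; simp
      · rw [mem_singleton_iff.1 hs]; exact h1 t ht
      · rw [mem_singleton_iff.1 ht, dist_comm, dist_comm s]; exact h1 s hs
      · have e1 : Y s = yt s := if_neg (not_lt.2 hs.1)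
        have e2 : Y t = yt t := if_neg (not_lt.2 ht.1)
        rw [e1, e2]
        exact (hyL.dist_le_mul s hs t ht).trans (mul_le_mul_of_nonneg_right hKC dist_nonneg)
    have hGm : Monotone G := by
      intro t t' htt
      simp only [hG]
      split_ifs with h1 h2 h2
      · exact le_rfl
      · linarith [(HTt.inv_mem t').1]
      · linarith
      · exact HTt.inv_mono htt
    have hmaps : MapsTo G (Icc (-h) (N * h)) ({-1} ∪ Icc 0 (N * Q.S)) := by
      intro t _
      simp only [hG]
      split_ifs
      · exact Or.inl rfl
      · exact Or.inr (HTt.inv_mem t)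
    have hGbv : BoundedVariationOn G (Icc (-h) (N * h)) := by
      have hle : -h ≤ N * h := by nlinarith
      have := (hGm.monotoneOn (Icc (-h) (N * h))).locallyBoundedVariationOn (-h) (N * h)
        ⟨le_rfl, hle⟩ ⟨hle, le_rfl⟩
      rwa [inter_self] at this
    have := hYL.comp_boundedVariationOn hmaps hGbv
    have e : Y ∘ G = fun t => if t < 0 then ξ₀ else yt (σt t) := by
      funext t
      simp only [hY, hG, comp_apply]
      by_cases h1 : t < 0
      · simp [h1]
      · have h2 : ¬ σt t < 0 := not_lt.2 (HTt.inv_mem t).1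
        simp [h1, h2]
    rwa [e] at this

/-- Subtracting the delay `h` from the original time leaves `s` unchanged and moves to the previous
segment, or to the history when `i = 0`. -/
lemma IsUnfolding.eq_of_not_lt {Q : PreReparamProcess N h f g x₀ ξ₀} {x : ℝ → State n}
    (U : IsUnfolding Q x) (hh : 0 < h) (i : Fin N) {s : ℝ} (hs : s ∈ Ioo 0 Q.S)
    (hn : ¬ leftLim Q.sigma (Q.psi s) < rightLim Q.sigma (Q.psi s)) :
    x (Q.psi s + (i : ℕ) * h) = Q.y i.succ s
      ∧ x (Q.psi s + (i : ℕ) * h - h) = Q.y i.castSucc s := by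
  have HT := Q.isTimeChange hh
  have hm := HT.comp_mem_Ioo hs hn
  have hsg : Q.sigma (Q.psi s) = s := HT.inv_comp ⟨hs.1.le, hs.2.le⟩ hn
  have key : ∀ i : Fin N, x (Q.psi s + (i : ℕ) * h) = Q.y i.succ s := fun i => by
    rw [U.inner i _ hm, hsg]
  refine ⟨key i, ?_⟩
  by_cases h0 : (i : ℕ) = 0
  · have e : i.castSucc = 0 := Fin.ext h0
    rw [e, h0, Q.y_zero s ⟨hs.1.le, hs.2⟩]
    exact U.history _ ⟨by simp; linarith [hm.1], by simp; linarith [hm.2]⟩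
  · obtain ⟨j, hj⟩ := Fin.exists_succ_eq.2 (show i.castSucc ≠ 0 from fun e =>
      h0 (by simpa using congrArg Fin.val e))
    have hv : (i : ℕ) = (j : ℕ) + 1 := by simpa using (congrArg Fin.val hj).symm
    rw [← hj, ← key j, hv]
    congr 1
    push_cast; ring

lemma PreReparamProcess.exists_isLinked (Q : PreReparamProcess N h f g x₀ ξ₀) (hN : 0 < N)
    (hh : 0 < h) (hf : Continuous f) (hg : Continuous g) {C : ℝ} (hfC : ∀ p, ‖f p‖ ≤ C)
    (hgC : ∀ p, ‖g p‖ ≤ C) : ∃ P : PreExtendedProcess N h f g x₀ ξ₀, IsLinked P Q := by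
  obtain ⟨x, U⟩ := Q.exists_isUnfolding hN hh hfC hgC
  have HT := Q.isTimeChange hh
  have M := Q.isMatching hh
  have h0m : (0 : ℝ) ∈ Icc 0 h := ⟨le_rfl, hh.le⟩
  have hhm : h ∈ Icc 0 h := ⟨hh.le, le_rfl⟩
  have hs0 : leftLim Q.sigma 0 = 0 := IsTimeChange.inv_leftLim_zero
  have hsh : rightLim Q.sigma h = Q.S := HT.inv_rightLim_end
  have hmem : ∀ r, ∀ s ∈ Icc (0 : ℝ) 1,
      leftLim Q.sigma r + s * (rightLim Q.sigma r - leftLim Q.sigma r) ∈ Icc 0 Q.S := by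
    intro r s hs
    have h1 := Q.leftLim_le_rightLim_sigma hh r
    have hsub : Icc (leftLim Q.sigma r) (rightLim Q.sigma r) ⊆ Icc 0 Q.S := HT.Icc_inv_subset r
    exact hsub ⟨by nlinarith [hs.1], by nlinarith [hs.2]⟩
  have hj : ∀ r (i : Fin N) s, Q.jump r i.succ s
      = Q.y i.succ (leftLim Q.sigma r + s * (rightLim Q.sigma r - leftLim Q.sigma r)) :=
    fun r i s => rfl
  have hj0 : ∀ r s, Q.jump r 0 s = if s = 1 ∧ r = h then x₀ else ξ₀ := fun r s => rfl
  have hj1 : ∀ r (i : Fin N), Q.jump r i.succ 1 = Q.y i.succ (rightLim Q.sigma r) := fun r i => by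
    rw [hj, one_mul, add_sub_cancel]
  have hjend : ∀ k, Q.jump h k 1 = Q.y k Q.S := fun k => by
    refine Fin.cases ?_ (fun i => ?_) k
    · rw [hj0, if_pos ⟨rfl, rfl⟩, Q.y_zero_end]
    · rw [hj1, hsh]
  have hleft : ∀ (i : Fin N), ∀ r ∈ Ioc 0 h, leftLim x (r + (i : ℕ) * h)
      = Q.y i.succ (leftLim Q.sigma r) := fun i r hr =>
    HT.leftLim_of_comp_inv (Q.continuousOn_y i) (fun r hr => U.inner i r hr) hr
  have J : IsJumpFamily h g x₀ ξ₀ x Q.attached Q.jump := by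
    refine ⟨fun r _ s _ => hj0 r s, fun r hr i => ?_, fun r hr i => ?_, fun r hr i => ?_, fun i => ?_⟩
    · have hA : LipschitzWith (rightLim Q.sigma r - leftLim Q.sigma r).toNNReal
          fun s : ℝ => leftLim Q.sigma r + s * (rightLim Q.sigma r - leftLim Q.sigma r) := by
        refine LipschitzWith.of_dist_le_mul fun s t => ?_
        rw [dist_add_left, Real.dist_eq, ← sub_mul, abs_mul, Real.coe_toNNReal _
          (sub_nonneg.2 (Q.leftLim_le_rightLim_sigma hh r)), abs_of_nonneg
          (sub_nonneg.2 (Q.leftLim_le_rightLim_sigma hh r)), Real.dist_eq, mul_comm]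
      refine LipschitzOnWith.absolutelyContinuousOnInterval ((Q.lipschitzOnWith_y hfC hgC i).comp
        hA.lipschitzOnWith fun s hs => ?_)
      rw [uIcc_of_le zero_le_one] at hs
      exact hmem r s hs
    · rcases (Q.leftLim_le_rightLim_sigma hh r).eq_or_lt with h1 | h1
      · refine Eventually.of_forall fun s => ?_
        have e : Q.jump r i.succ = fun _ => Q.y i.succ (leftLim Q.sigma r) := by
          funext s; rw [hj, h1]; simp
        rw [PreReparamProcess.attached, h1, sub_self, zero_mul, zero_smul, e]
        exact hasDerivAt_const _ _
      -- The point `s = 1` is left out because the zeroth jump function at `r = h` takes its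
      -- exceptional value `x₀` there.
      · have hne : ∀ᵐ s ∂volume.restrict (Icc (0 : ℝ) 1), s ≠ 1 :=
          ae_restrict_of_ae (Measure.ae_ne volume 1)
        filter_upwards [Q.ae_rescale hh (Q.ode i) h1, Q.attached_ae_eq hh r i,
          ae_Icc_zero_one_of_ae_Icc h1 ((Q.isClock hh).ae_eq_zero hr), hne,
          ae_restrict_mem measurableSet_Icc] with s h2 h3 h4 h5 h6
        -- On the flat part the clock rate is zero, so only the term with `g` survives; the chain
        -- rule supplies the factor contained in the attached control.
        rw [h4, zero_smul, zero_add] at h2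
        have hd : HasDerivAt (fun s : ℝ =>
            leftLim Q.sigma r + s * (rightLim Q.sigma r - leftLim Q.sigma r))
            (rightLim Q.sigma r - leftLim Q.sigma r) s := by
          simpa using ((hasDerivAt_id s).mul_const
            (rightLim Q.sigma r - leftLim Q.sigma r)).const_add (leftLim Q.sigma r)
        have h7 := h2.scomp s hd
        have hprev : Q.jump r i.castSucc s = Q.y i.castSucc
            (leftLim Q.sigma r + s * (rightLim Q.sigma r - leftLim Q.sigma r)) := by
          by_cases h0 : i.castSucc = 0
          · have h8 : s < 1 := lt_of_le_of_ne h6.2 h5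
            rw [h0, hj0, if_neg fun e => h5 e.1, Q.y_zero]
            refine ⟨(hmem r s h6).1, ?_⟩
            have := (HT.inv_rightLim_mem r).2
            change rightLim Q.sigma r ≤ Q.S at this
            nlinarith
          · obtain ⟨j, hj'⟩ := Fin.exists_succ_eq.2 h0
            rw [← hj', hj]
        rw [h3, hj, hprev, mul_smul]
        exact h7
    · rw [hj, hleft i r hr, zero_mul, add_zero]
    · rw [hj, hjend, hs0, zero_mul, add_zero, Q.link]
  have T : IsTrajectory h f g x₀ ξ₀ x (sumTranslates h fun i => pushDensity Q.psi (Q.α i) Q.S)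
      Q.attached Q.jump := by
    refine ⟨J, U.history, U.start, fun i hi => by rw [U.node i hi, hj1], fun i t ht => ?_, ?_⟩
    · have hr : t - (i : ℕ) * h ∈ Ioo 0 h := ⟨by linarith [ht.1], by linarith [ht.2]⟩
      have hFk : ∀ᵐ s ∂volume.restrict (Icc 0 Q.S),
          ¬ leftLim (rightInverse Q.psi Q.S h) (Q.psi s) < rightLim (rightInverse Q.psi Q.S h) (Q.psi s)
          → Q.field i s = (1 - ∑ j, Q.α j s) • f (x (Q.psi s + (i : ℕ) * h),
              x (Q.psi s + (i : ℕ) * h - h)) + Q.α i s • g (x (Q.psi s + (i : ℕ) * h),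
              x (Q.psi s + (i : ℕ) * h - h)) := by
        have hn0 : ∀ᵐ s ∂volume.restrict (Icc 0 Q.S), s ≠ 0 :=
          ae_restrict_of_ae (Measure.ae_ne volume 0)
        have hnS : ∀ᵐ s ∂volume.restrict (Icc 0 Q.S), s ≠ Q.S :=
          ae_restrict_of_ae (Measure.ae_ne volume Q.S)
        filter_upwards [hn0, hnS, ae_restrict_mem measurableSet_Icc] with s h1 h2 h3 h4
        obtain ⟨e1, e2⟩ := U.eq_of_not_lt hh i (s := s)
          ⟨lt_of_le_of_ne h3.1 h1.symm, lt_of_le_of_ne h3.2 h2⟩ h4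
        rw [e1, e2, PreReparamProcess.field]
      have key := M.inside_eq hf hg hfC hgC U.bounded_variation (Q.integrableOn_field hfC hgC i)
        (i := i) (ψ := Q.psi) rfl hFk ⟨hr.1.le, hr.2⟩
      rw [sub_add_cancel] at key
      have hdiff : ∀ {a b : ℝ}, a ∈ Icc 0 Q.S → b ∈ Icc 0 Q.S →
          ∫ s in a..b, Q.field i s = Q.y i.succ b - Q.y i.succ a := by
        intro a b ha hb
        have hii : ∀ {c}, c ∈ Icc 0 Q.S → IntervalIntegrable (Q.field i) volume 0 c := by
          intro c hc
          rw [intervalIntegrable_iff_integrableOn_Ioc_of_le hc.1]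
          exact (Q.integrableOn_field hfC hgC i).mono_set fun t ht => ⟨ht.1.le, ht.2.trans hc.2⟩
        rw [Q.y_eq hfC hgC i hb, Q.y_eq hfC hgC i ha, add_sub_add_left_eq_sub,
          intervalIntegral.integral_interval_sub_left (hii hb) (hii ha)]
      -- The state before the jump at `q` is the arc at the start of the flat part and `ζ q i.succ
      -- 1` is the arc at its end, so each increment is the integral of the field over the flat
      -- part.
      have hsum : ∑' q : Ioc 0 (t - (i : ℕ) * h),
          (Q.jump q i.succ 1 - leftLim x (q + (i : ℕ) * h))
          = ∑' q : Ioc 0 (t - (i : ℕ) * h), ∫ s in leftLim (rightInverse Q.psi Q.S h) q..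
            rightLim (rightInverse Q.psi Q.S h) q, Q.field i s := by
        refine tsum_congr fun q => ?_
        rw [hdiff (HT.inv_leftLim_mem _) (HT.inv_rightLim_mem _), hj1,
          hleft i q ⟨q.2.1, q.2.2.trans hr.2.le⟩]
        rfl
      rw [hsum, add_assoc, add_assoc, ← add_assoc (∫ t' in ((i : ℕ) * h)..t, _), key,
        hdiff (HT.inv_rightLim_mem _) (HT.inv_rightLim_mem _), hj1]
      have := U.inner i _ hr
      rw [sub_add_cancel] at this
      rw [this, HT.inv_rightLim hr.1]
      change _ = Q.y i.succ (rightLim Q.sigma 0) + (Q.y i.succ (Q.sigma _)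
        - Q.y i.succ (rightLim Q.sigma 0))
      abel
    · rw [U.terminal, hjend]
  exact ⟨⟨x, _, _, U.bounded_variation, Q.isImpulsiveControl hh, _, T⟩,
    ⟨M, fun r _ i => Q.attached_ae_eq hh r i, U.inner, _, T, fun r _ i s _ => hj r i s⟩⟩

end Reparam

end ImpulsiveDelay

/-! ### The right inverse `η` of `φ` as a time change -/

namespace ImpulsiveDelay

/-- The right inverse of a strictly increasing, right-continuous function whose increments dominate
those of the identity is a time change, whose right inverse is the given function. -/
lemma isTimeChange_rightInverse {φ : ℝ → ℝ} {S h : ℝ} (hh : 0 < h) (h0 : ∀ r ≤ 0, φ r = 0)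
    (h1 : ∀ r, h ≤ r → φ r = S)
    (hinc : ∀ r r', 0 ≤ r → r ≤ r' → r' ≤ h → r' - r ≤ φ r' - φ r)
    (hrc : ∀ r ∈ Ioo 0 h, ∀ s, (∀ r' ∈ Ioo r h, s ≤ φ r') → s ≤ φ r) :
    IsTimeChange (rightInverse φ h S) S h ∧ rightInverse (rightInverse φ h S) S h = φ := by
  have hS : 0 < S := by
    have := hinc 0 h le_rfl hh.le le_rfl
    rw [h0 0 le_rfl, h1 h le_rfl] at this
    linarith
  have hmono : ∀ {r r'}, 0 ≤ r → r ≤ r' → r' ≤ h → φ r ≤ φ r' := fun a b c => by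
    linarith [hinc _ _ a b c]
  have hin : ∀ r ∈ Ioo 0 h, φ r ∈ Ioo 0 S := fun r hr => by
    have e1 := hinc 0 r le_rfl hr.1.le hr.2.le
    have e2 := hinc r h hr.1.le hr.2.le le_rfl
    rw [h0 0 le_rfl] at e1
    rw [h1 h le_rfl] at e2
    exact ⟨by linarith [hr.1], by linarith [hr.2]⟩
  set η := rightInverse φ h S with hη
  -- The Galois connection between `η` and `φ`. One implication uses right continuity in the form
  -- `hrc`, the other the strict increase of `φ`.
  have gal : ∀ r ∈ Ioo 0 h, ∀ s ∈ Icc 0 S, η s ≤ r ↔ s ≤ φ r := by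
    intro r hr s hs
    rcases hs.1.eq_or_lt with rfl | hs0
    · rw [hη, rightInverse_of_nonpos le_rfl]
      exact ⟨fun _ => (hin r hr).1.le, fun _ => hr.1.le⟩
    rcases hs.2.eq_or_lt with rfl | hsS
    · rw [hη, rightInverse_of_ge hS le_rfl]
      exact ⟨fun h => absurd h (not_le.2 hr.2), fun h => absurd h (not_le.2 (hin r hr).2)⟩
    have hbdd : BddBelow {r | r ∈ Icc 0 h ∧ s < φ r} := ⟨0, fun _ hs => hs.1.1⟩
    have hne : {r | r ∈ Icc 0 h ∧ s < φ r}.Nonempty := ⟨h, ⟨hh.le, le_rfl⟩, by rwa [h1 h le_rfl]⟩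
    rw [hη, rightInverse_of_mem ⟨hs0, hsS⟩]
    constructor
    · intro hle
      refine hrc r hr s fun r' hr' => ?_
      obtain ⟨q, hq, hqr⟩ := exists_lt_of_csInf_lt hne (hle.trans_lt hr'.1)
      exact hq.2.le.trans (hmono hq.1.1 hqr.le hr'.2.le)
    · intro hle
      refine le_of_forall_gt_imp_ge_of_dense fun r' hr' => ?_
      rcases le_or_gt h r' with h2 | h2
      · exact (csInf_le hbdd ⟨⟨hh.le, le_rfl⟩, by rwa [h1 h le_rfl]⟩).trans h2
      · have := hinc r r' hr.1.le hr'.le h2.le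
        exact csInf_le hbdd ⟨⟨hr.1.le.trans hr'.le, h2.le⟩, by linarith⟩
  have hmem : ∀ s ∈ Icc 0 S, η s ∈ Icc 0 h := by
    intro s hs
    rcases hs.1.eq_or_lt with rfl | hs0
    · rw [hη, rightInverse_of_nonpos le_rfl]; exact ⟨le_rfl, hh.le⟩
    rcases hs.2.eq_or_lt with rfl | hsS
    · rw [hη, rightInverse_of_ge hS le_rfl]; exact ⟨hh.le, le_rfl⟩
    rw [hη, rightInverse_of_mem ⟨hs0, hsS⟩]
    have hhm : h ∈ {r | r ∈ Icc 0 h ∧ s < φ r} := ⟨⟨hh.le, le_rfl⟩, by rwa [h1 h le_rfl]⟩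
    exact ⟨le_csInf ⟨h, hhm⟩ fun _ hr => hr.1.1, csInf_le ⟨0, fun _ hr => hr.1.1⟩ hhm⟩
  have hm : MonotoneOn η (Icc 0 S) := by
    intro s hs t ht hst
    by_contra! hlt
    obtain ⟨r, hr1, hr2⟩ := exists_between hlt
    have hr : r ∈ Ioo 0 h := ⟨(hmem t ht).1.trans_lt hr1, hr2.trans_le (hmem s hs).2⟩
    have := (gal r hr s hs).2 (hst.trans ((gal r hr t ht).1 hr1.le))
    linarith
  -- Since `φ` grows at least at unit speed, `η` grows at most at unit speed; this is where its
  -- continuity comes from.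
  have hlip : ∀ s ∈ Icc 0 S, ∀ t ∈ Icc 0 S, s ≤ t → η t ≤ η s + (t - s) := by
    intro s hs t ht hst
    refine le_of_forall_gt_imp_ge_of_dense fun r hr => ?_
    rcases le_or_gt h r with h2 | h2
    · exact (hmem t ht).2.trans h2
    have h3 : η s < r - (t - s) := by linarith
    obtain ⟨q, hq1, hq2⟩ := exists_between h3
    have hq : q ∈ Ioo 0 h := ⟨(hmem s hs).1.trans_lt hq1, by linarith⟩
    have hr' : r ∈ Ioo 0 h := ⟨by linarith [hq.1], h2⟩
    have h4 := (gal q hq s hs).1 hq1.le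
    have h5 := hinc q r hq.1.le (by linarith) h2.le
    exact (gal r hr' t ht).2 (by linarith)
  refine ⟨⟨hS, hh, ?_, hm, rightInverse_of_nonpos le_rfl, rightInverse_of_ge hS le_rfl⟩, ?_⟩
  · have : LipschitzOnWith 1 η (Icc 0 S) := by
      refine LipschitzOnWith.of_dist_le_mul fun s hs t ht => ?_
      rw [Real.dist_eq, Real.dist_eq, NNReal.coe_one, one_mul]
      rcases le_total s t with hst | hst
      · rw [abs_sub_comm, abs_sub_comm s, abs_of_nonneg (sub_nonneg.2 hst),
          abs_of_nonneg (sub_nonneg.2 (hm hs ht hst))]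
        linarith [hlip s hs t ht hst]
      · rw [abs_of_nonneg (sub_nonneg.2 hst), abs_of_nonneg (sub_nonneg.2 (hm ht hs hst))]
        linarith [hlip t ht s hs hst]
    exact this.continuousOn
  · funext r
    rcases le_or_gt r 0 with h2 | h2
    · rw [rightInverse_of_nonpos h2, h0 r h2]
    rcases le_or_gt h r with h3 | h3
    · rw [rightInverse_of_ge hh h3, h1 r h3]
    · exact rightInverse_eq_of_forall ⟨h2, h3⟩ ⟨(hin r ⟨h2, h3⟩).1.le, (hin r ⟨h2, h3⟩).2⟩
        (gal r ⟨h2, h3⟩)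

section Phi

variable {N : ℕ} {h : ℝ} {μ : Measure ℝ} {w : ℝ → Fin N → ℝ → ℝ}

instance isFiniteMeasure_phiMeasure [IsFiniteMeasure μ] : IsFiniteMeasure (phiMeasure h μ w) := by
  refine ⟨?_⟩
  rw [phiMeasure, Measure.add_apply, Measure.finsetSum_apply]
  exact ENNReal.add_lt_top.2 ⟨measure_lt_top _ _, ENNReal.sum_lt_top.2 fun i _ => measure_lt_top _ _⟩

lemma segMeasure_compl (hh : 0 < h) (i : Fin N) : segMeasure h μ w i (Icc 0 h)ᶜ = 0 := by
  have h0 : (0 : ℝ) ∉ (Icc 0 h)ᶜ := fun hn => hn ⟨le_rfl, hh.le⟩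
  have h1 : h ∉ (Icc 0 h)ᶜ := fun hn => hn ⟨hh.le, le_rfl⟩
  rw [segMeasure_apply measurableSet_Icc.compl, indicator_of_notMem h0, indicator_of_notMem h1]
  have : (fun t => t - (i : ℕ) * h) ⁻¹' (Icc 0 h)ᶜ ∩ Ioo ((i : ℕ) * h) (((i : ℕ) + 1) * h) = ∅ := by
    ext t
    simp only [mem_inter_iff, mem_preimage, mem_compl_iff, mem_Icc, mem_Ioo, mem_empty_iff_false,
      iff_false]
    rintro ⟨h2, h3, h4⟩
    exact h2 ⟨by linarith, by linarith⟩
  rw [this]; simp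

lemma phiMeasure_compl (hh : 0 < h) : phiMeasure h μ w (Icc 0 h)ᶜ = 0 := by
  rw [phiMeasure, Measure.add_apply, Measure.finsetSum_apply,
    Measure.restrict_apply measurableSet_Icc.compl]
  simp [segMeasure_compl hh]

lemma phi_of_nonpos {r : ℝ} (hr : r ≤ 0) : phi h μ w r = 0 := by rw [phi, if_pos hr]

lemma phi_of_ge (hh : 0 < h) {r : ℝ} (hr : h ≤ r) : phi h μ w r = phi h μ w h := by
  rw [phi, phi, if_neg (not_le.2 (hh.trans_le hr)), if_neg (not_le.2 hh), min_eq_right hr, min_self]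
  congr 1
  refine Finset.sum_congr rfl fun i _ => ?_
  rw [Measure.real, Measure.real]
  congr 1
  refine le_antisymm ?_ (measure_mono (Icc_subset_Icc_right hr))
  calc segMeasure h μ w i (Icc 0 r)
      ≤ segMeasure h μ w i (Icc 0 h ∪ (Icc 0 h)ᶜ) := measure_mono (by simp)
    _ ≤ segMeasure h μ w i (Icc 0 h) + segMeasure h μ w i (Icc 0 h)ᶜ := measure_union_le _ _
    _ = segMeasure h μ w i (Icc 0 h) := by rw [segMeasure_compl hh, add_zero]

lemma sub_le_phi_sub [IsFiniteMeasure μ] {r r' : ℝ} (h0 : 0 ≤ r) (hrr : r ≤ r') (h1 : r' ≤ h) :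
    r' - r ≤ phi h μ w r' - phi h μ w r := by
  have hm : ∑ i, (segMeasure h μ w i).real (Icc 0 r) ≤ ∑ i, (segMeasure h μ w i).real (Icc 0 r') :=
    Finset.sum_le_sum fun i _ => measureReal_mono (Icc_subset_Icc_right hrr)
  have hn : 0 ≤ ∑ i, (segMeasure h μ w i).real (Icc 0 r) :=
    Finset.sum_nonneg fun i _ => measureReal_nonneg
  rcases h0.eq_or_lt with rfl | h0
  · rw [phi_of_nonpos le_rfl]
    rcases hrr.eq_or_lt with rfl | hlt
    · rw [phi_of_nonpos le_rfl]
    · rw [phi, if_neg (not_le.2 hlt), min_eq_left h1]; linarith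
  · rw [phi, phi, if_neg (not_le.2 h0), if_neg (not_le.2 (h0.trans_le hrr)), min_eq_left h1,
      min_eq_left (hrr.trans h1)]
    linarith

lemma phi_mono [IsFiniteMeasure μ] (hh : 0 < h) : Monotone (phi h μ w) := by
  have key : ∀ r, phi h μ w r = phi h μ w (max 0 (min r h)) := by
    intro r
    rcases le_or_gt r 0 with h0 | h0
    · rw [phi_of_nonpos h0, min_eq_left (h0.trans hh.le), max_eq_left h0, phi_of_nonpos le_rfl]
    rcases le_or_gt h r with h1 | h1
    · rw [phi_of_ge hh h1, min_eq_right h1, max_eq_right hh.le]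
    · rw [min_eq_left h1.le, max_eq_right h0.le]
  intro r r' hr
  rw [key r, key r']
  have h1 : max 0 (min r h) ≤ max 0 (min r' h) := max_le_max le_rfl (min_le_min hr le_rfl)
  have := sub_le_phi_sub (μ := μ) (w := w) (le_max_left _ _) h1
    (max_le hh.le (min_le_right r' h))
  linarith

/-- Continuity of the finite measure `dφ` from above along the intervals `[0, q]`, `q ↓ r`. The
right limit matters only at `0`, where `φ 0 = 0` omits the atom of `dφ`. -/
lemma phiMeasure_Icc_eq_rightLim [IsFiniteMeasure μ] (hh : 0 < h) {r : ℝ} (hr : r ∈ Icc 0 h) :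
    (phiMeasure h μ w).real (Icc 0 r) = rightLim (phi h μ w) r := by
  rcases hr.2.eq_or_lt with rfl | h1
  · rw [phiMeasure_Icc _ _ _ ⟨hh, le_rfl⟩]
    refine le_antisymm ((phi_mono hh).le_rightLim le_rfl) ?_
    refine ((phi_mono hh).rightLim_le (lt_add_one r)).trans (phi_of_ge hh (by linarith)).le
  · have hlim := tendsto_measure_biInter_gt (μ := phiMeasure h μ w) (s := fun r => Icc 0 r) (a := r)
      (fun _ _ => measurableSet_Icc.nullMeasurableSet)
      (fun i j _ hij => Icc_subset_Icc_right hij) ⟨r + 1, by simp, measure_ne_top _ _⟩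
    have e : (⋂ q > r, Icc 0 q) = Icc 0 r := by
      ext s
      simp only [mem_iInter, mem_Icc]
      constructor
      · intro H
        exact ⟨(H (r + 1) (by simp)).1, le_of_forall_gt_imp_ge_of_dense fun q hq => (H q hq).2⟩
      · rintro ⟨h2, h3⟩ q hq
        exact ⟨h2, h3.trans (le_of_lt hq)⟩
    rw [e] at hlim
    have hlim2 := (ENNReal.tendsto_toReal (measure_ne_top (phiMeasure h μ w) _)).comp hlim
    refine tendsto_nhds_unique (hlim2.congr' ?_) ((phi_mono hh).tendsto_rightLim r)
    filter_upwards [Ioo_mem_nhdsGT h1] with q hq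
    exact phiMeasure_Icc h μ w ⟨hr.1.trans_lt hq.1, hq.2.le⟩

lemma isTimeChange_eta [IsFiniteMeasure μ] (hh : 0 < h) :
    IsTimeChange (eta h μ w) (phi h μ w h) h
      ∧ rightInverse (eta h μ w) (phi h μ w h) h = phi h μ w := by
  refine isTimeChange_rightInverse hh (fun _ => phi_of_nonpos) (fun _ => phi_of_ge hh)
    (fun _ _ => sub_le_phi_sub) fun r hr s H => ?_
  rw [← phiMeasure_Icc h μ w ⟨hr.1, hr.2.le⟩, phiMeasure_Icc_eq_rightLim hh ⟨hr.1.le, hr.2.le⟩]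
  refine ge_of_tendsto ((phi_mono hh).tendsto_rightLim r) ?_
  filter_upwards [Ioo_mem_nhdsGT hr.2] with q hq using H q hq

/-- The image of Lebesgue measure under `η` is `dφ`. -/
lemma pushDensity_eta [IsFiniteMeasure μ] (hh : 0 < h) :
    pushDensity (eta h μ w) (fun _ => 1) (phi h μ w h) = phiMeasure h μ w := by
  obtain ⟨HT, e⟩ := isTimeChange_eta (μ := μ) (w := w) hh
  have := isFiniteMeasure_pushDensity HT.aemeasurable (isRate_one (phi h μ w h))
  have hc1 := pushDensity_compl (β := fun _ => 1) HT.aemeasurable measurableSet_Icc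
    fun s hs => HT.maps hs
  have hc2 := phiMeasure_compl (μ := μ) (w := w) hh
  have key : ∀ m : Measure ℝ, m (Icc 0 h)ᶜ = 0 → ∀ r, m (Iic r) = if r < 0 then 0 else
      m (Icc 0 (min r h)) := by
    intro m hm r
    split_ifs with h0
    · refine measure_mono_null ?_ hm
      intro t ht ht'
      have : t ≤ r := ht
      linarith [ht'.1]
    · refine le_antisymm ?_ (measure_mono fun t ht => ht.2.trans (min_le_left _ _))
      calc m (Iic r) ≤ m (Icc 0 (min r h) ∪ (Icc 0 h)ᶜ) := measure_mono (by
            intro t ht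
            by_cases h3 : t ∈ Icc 0 h
            · exact Or.inl ⟨h3.1, le_min ht h3.2⟩
            · exact Or.inr h3)
        _ ≤ m (Icc 0 (min r h)) + m (Icc 0 h)ᶜ := measure_union_le _ _
        _ = m (Icc 0 (min r h)) := by rw [hm, add_zero]
  refine Measure.ext_of_Iic _ _ fun r => ?_
  rw [key _ hc1, key _ hc2]
  split_ifs with h0
  · rfl
  have hm : min r h ∈ Icc 0 h := ⟨le_min (not_lt.1 h0) hh.le, min_le_right _ _⟩
  refine (measureReal_eq_measureReal_iff).1 ?_
  rw [pushDensity_real HT.aemeasurable (isRate_one _) measurableSet_Icc, HT.preimage_Icc hm, e,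
    phiMeasure_Icc_eq_rightLim hh hm]
  have : 0 ≤ rightLim (phi h μ w) (min r h) := by
    have := (HT.inv_rightLim_mem (min r h)).1
    rwa [e] at this
  simp [this]

end Phi

end ImpulsiveDelay

/-! ### Controls of the reparameterized process built from an impulsive control -/

namespace ImpulsiveDelay

lemma aemeasurable_Icc_of_Icc_zero_one {E : Type*} [MeasurableSpace E] {a b : ℝ} (hab : a < b)
    {G : ℝ → E} (hG : AEMeasurable G (volume.restrict (Icc (0 : ℝ) 1))) :
    AEMeasurable (fun s => G ((s - a) / (b - a))) (volume.restrict (Icc a b)) :=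
  ⟨fun s => hG.mk G ((s - a) / (b - a)), hG.measurable_mk.comp (by fun_prop),
    ae_Icc_of_ae_Icc_zero_one hab hG.ae_eq_mk⟩

namespace IsTimeChange

variable {ψ : ℝ → ℝ} {S h : ℝ} (H : IsTimeChange ψ S h)
include H

lemma eq_jumps_union : Icc 0 S = (⋃ r ∈ {r | r ∈ Icc 0 h ∧
      leftLim (rightInverse ψ S h) r < rightLim (rightInverse ψ S h) r},
      Icc (leftLim (rightInverse ψ S h) r) (rightLim (rightInverse ψ S h) r)) ∪
    {s | s ∈ Icc 0 S ∧ ¬ leftLim (rightInverse ψ S h) (ψ s) < rightLim (rightInverse ψ S h) (ψ s)} := by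
  rw [← H.preimage_inter_eq_biUnion fun r hr => hr.1]
  ext s
  simp only [mem_union, mem_inter_iff, mem_preimage, mem_ofPred_eq]
  constructor
  · intro hs
    by_cases h1 : leftLim (rightInverse ψ S h) (ψ s) < rightLim (rightInverse ψ S h) (ψ s)
    · exact Or.inl ⟨⟨H.maps hs, h1⟩, hs⟩
    · exact Or.inr ⟨hs, h1⟩
  · rintro (h1 | h1)
    exacts [h1.2, h1.1]

lemma countable_jumps_Icc : {r | r ∈ Icc 0 h ∧
    leftLim (rightInverse ψ S h) r < rightLim (rightInverse ψ S h) r}.Countable :=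
  H.countable_jumps.mono fun _ hr => hr.2

lemma measurableSet_continuity : MeasurableSet {s | s ∈ Icc 0 S ∧
    ¬ leftLim (rightInverse ψ S h) (ψ s) < rightLim (rightInverse ψ S h) (ψ s)} := by
  have h1 := H.measurableSet_preimage_of_countable (B := {r | r ∈ Icc 0 h ∧
      leftLim (rightInverse ψ S h) r < rightLim (rightInverse ψ S h) r}) (fun r hr => hr.1)
    H.countable_jumps_Icc
  convert (measurableSet_Icc (a := (0 : ℝ)) (b := S)).diff h1 using 1
  ext s
  simp only [mem_ofPred_eq, Set.mem_sdiff, mem_inter_iff, mem_preimage, not_and]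
  constructor
  · rintro ⟨h1, h2⟩; exact ⟨h1, fun h3 => absurd h3.2 h2⟩
  · rintro ⟨h1, h2⟩; exact ⟨h1, fun h3 => h2 ⟨H.maps h1, h3⟩ h1⟩

/-- A property holds almost everywhere when it does so on every flat part and off the flat parts. -/
lemma ae_of_ae {p : ℝ → Prop}
    (hj : ∀ r ∈ Icc 0 h, leftLim (rightInverse ψ S h) r < rightLim (rightInverse ψ S h) r →
      ∀ᵐ s ∂volume.restrict
        (Icc (leftLim (rightInverse ψ S h) r) (rightLim (rightInverse ψ S h) r)), p s)
    (ho : ∀ᵐ s ∂volume.restrict (Icc 0 S),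
      ¬ leftLim (rightInverse ψ S h) (ψ s) < rightLim (rightInverse ψ S h) (ψ s) → p s) :
    ∀ᵐ s ∂volume.restrict (Icc 0 S), p s := by
  rw [H.eq_jumps_union, ae_restrict_union_iff, ae_restrict_biUnion_iff _ H.countable_jumps_Icc]
  refine ⟨fun r hr => hj r hr.1 hr.2, ?_⟩
  rw [ae_restrict_iff' H.measurableSet_continuity]
  rw [ae_restrict_iff' measurableSet_Icc] at ho
  filter_upwards [ho] with s h1 h2 using h1 h2.1 h2.2

lemma aestronglyMeasurable_of {E : Type*} [NormedAddCommGroup E] {F G : ℝ → E}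
    (hj : ∀ r ∈ Icc 0 h, leftLim (rightInverse ψ S h) r < rightLim (rightInverse ψ S h) r →
      AEStronglyMeasurable F (volume.restrict
        (Icc (leftLim (rightInverse ψ S h) r) (rightLim (rightInverse ψ S h) r))))
    (hG : AEStronglyMeasurable G (volume.restrict (Icc 0 S)))
    (ho : ∀ᵐ s ∂volume.restrict (Icc 0 S),
      ¬ leftLim (rightInverse ψ S h) (ψ s) < rightLim (rightInverse ψ S h) (ψ s) → G s = F s) :
    AEStronglyMeasurable F (volume.restrict (Icc 0 S)) := by
  have := H.countable_jumps_Icc.to_subtype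
  rw [H.eq_jumps_union, biUnion_eq_iUnion, aestronglyMeasurable_union_iff,
    aestronglyMeasurable_iUnion_iff]
  refine ⟨fun r => hj r r.2.1 r.2.2, ?_⟩
  refine (hG.mono_measure (Measure.restrict_mono (fun s hs => hs.1) le_rfl)).congr ?_
  rw [EventuallyEq, ae_restrict_iff' H.measurableSet_continuity]
  rw [ae_restrict_iff' measurableSet_Icc] at ho
  filter_upwards [ho] with s h1 h2 using h1 h2.1 h2.2

end IsTimeChange

instance (m : Measure ℝ) [IsFiniteMeasure m] : IsFiniteMeasure (contPart m) := by
  rw [contPart]; infer_instance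

lemma contPart_sum_le {N : ℕ} {h : ℝ} {μ : Measure ℝ} {w : ℝ → Fin N → ℝ → ℝ} :
    ∑ i, contPart (segMeasure h μ w i) ≤ phiMeasure h μ w := by
  rw [phiMeasure]
  calc ∑ i, contPart (segMeasure h μ w i) ≤ ∑ i, segMeasure h μ w i :=
        Finset.sum_le_sum fun i _ => Measure.restrict_le_self
    _ ≤ _ := Measure.le_add_left le_rfl

lemma contPart_le_phiMeasure {N : ℕ} {h : ℝ} {μ : Measure ℝ} {w : ℝ → Fin N → ℝ → ℝ} (i : Fin N) :
    contPart (segMeasure h μ w i) ≤ phiMeasure h μ w :=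
  (Finset.single_le_sum (f := fun i => contPart (segMeasure h μ w i)) (fun _ _ => Measure.zero_le _)
    (Finset.mem_univ i)).trans contPart_sum_le

/-- The sum of the continuous parts is dominated by `dφ`, so the sum of their densities has integral
over any measurable set at most the measure of that set. -/
lemma sum_contDensity_le_one {N : ℕ} {h : ℝ} {μ : Measure ℝ} {w : ℝ → Fin N → ℝ → ℝ}
    [IsFiniteMeasure μ] : ∀ᵐ r ∂phiMeasure h μ w, ∑ i, contDensity h μ w i r ≤ 1 := by
  have hac : ∀ i, (phiMeasure h μ w).withDensity
      ((contPart (segMeasure h μ w i)).rnDeriv (phiMeasure h μ w)) = contPart (segMeasure h μ w i) :=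
    fun i => Measure.withDensity_rnDeriv_eq _ _ (contPart_le_phiMeasure i).absolutelyContinuous
  have hfin : ∀ i, ∀ᵐ r ∂phiMeasure h μ w,
      (contPart (segMeasure h μ w i)).rnDeriv (phiMeasure h μ w) r < ⊤ := fun i => Measure.rnDeriv_lt_top _ _
  have hle : (fun r => ∑ i, (contPart (segMeasure h μ w i)).rnDeriv (phiMeasure h μ w) r)
      ≤ᵐ[phiMeasure h μ w] fun _ => 1 := by
    refine ae_le_of_forall_setLIntegral_le_of_sigmaFinite
      (Finset.measurable_fun_sum _ fun i _ => Measure.measurable_rnDeriv _ _) fun E hE _ => ?_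
    rw [lintegral_finsetSum _ fun i _ => Measure.measurable_rnDeriv _ _, setLIntegral_one]
    have : ∀ i, ∫⁻ r in E, (contPart (segMeasure h μ w i)).rnDeriv (phiMeasure h μ w) r
        ∂phiMeasure h μ w = contPart (segMeasure h μ w i) E := fun i => by
      rw [← withDensity_apply _ hE, hac]
    simp only [this]
    rw [← Measure.finsetSum_apply]
    exact contPart_sum_le E
  filter_upwards [hle, ae_all_iff.2 hfin] with r h1 h2
  simp only [contDensity]
  rw [← ENNReal.toReal_sum fun i _ => (h2 i).ne]
  exact ENNReal.toReal_le_of_le_ofReal zero_le_one (by simpa using h1)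

namespace IsImpulsiveControl

variable {N : ℕ} {h : ℝ} {μ : Measure ℝ} {w : ℝ → Fin N → ℝ → ℝ}

lemma integral_nonneg (H : IsImpulsiveControl N h μ w) {r : ℝ} (hr : r ∈ Icc 0 h) (i : Fin N) :
    0 ≤ ∫ s in (0 : ℝ)..1, w r i s :=
  intervalIntegral.integral_nonneg zero_le_one fun s hs => H.nonneg r hr i s hs

lemma segMeasure_singleton (H : IsImpulsiveControl N h μ w) (hh : 0 < h) {r : ℝ} (hr : r ∈ Icc 0 h)
    (i : Fin N) : (segMeasure h μ w i).real {r} = ∫ s in (0 : ℝ)..1, w r i s := by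
  have := H.finite
  rw [Measure.real, segMeasure_apply (measurableSet_singleton r)]
  have hset : ∀ r ∈ Icc 0 h, (fun t => t - (i : ℕ) * h) ⁻¹' {r}
      ∩ Ioo ((i : ℕ) * h) (((i : ℕ) + 1) * h) = if r ∈ Ioo 0 h then {r + (i : ℕ) * h} else ∅ := by
    intro r hr
    split_ifs with h1
    · ext t
      simp only [mem_inter_iff, mem_preimage, mem_singleton_iff, mem_Ioo]
      constructor
      · rintro ⟨h2, _⟩; linarith
      · rintro rfl; exact ⟨by ring, by linarith [h1.1], by linarith [h1.2]⟩
    · ext t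
      simp only [mem_inter_iff, mem_preimage, mem_singleton_iff, mem_Ioo, mem_empty_iff_false,
        iff_false]
      rintro ⟨h2, h3, h4⟩
      exact h1 ⟨by linarith, by linarith⟩
  rw [hset r hr]
  rcases hr.1.eq_or_lt with rfl | h0
  · simp [hh.ne', H.integral_nonneg hr i]
  rcases hr.2.eq_or_lt with rfl | h1
  · simp [hh.ne, H.integral_nonneg hr i]
  · rw [if_pos ⟨h0, h1⟩, H.atom_interior r ⟨h0, h1⟩ i]
    simp [h0.ne, h1.ne', Measure.real]

variable (H : IsImpulsiveControl N h μ w) (hh : 0 < h)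
include H hh

/-- Both sides are the atom of `dφ` at `r`: Lebesgue measure does not contribute, and the atom of
each `μ_i` is the integral of its attached control, at the nodes as well. -/
lemma rightLim_sub_leftLim_phi {r : ℝ} (hr : r ∈ Icc 0 h) :
    rightLim (phi h μ w) r - leftLim (phi h μ w) r = ∑ i, ∫ s in (0 : ℝ)..1, w r i s := by
  have := H.finite
  obtain ⟨HT, e⟩ := isTimeChange_eta (μ := μ) (w := w) hh
  have h1 := HT.pushDensity_singleton (isRate_one _) hr
  rw [pushDensity_eta hh, e, intervalIntegral.integral_const, smul_eq_mul, mul_one] at h1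
  rw [← h1, Measure.real, phiMeasure, Measure.add_apply, Measure.finsetSum_apply,
    measure_mono_null (t := {r}) le_rfl (by simp), zero_add,
    ENNReal.toReal_sum fun i _ => measure_ne_top _ _]
  exact Finset.sum_congr rfl fun i _ => H.segMeasure_singleton hh hr i

/-- Without a jump the almost everywhere constant sum of the nonnegative attached controls is zero,
so each of them vanishes. -/
lemma ae_eq_zero {r : ℝ} (hr : r ∈ Icc 0 h)
    (hn : ¬ leftLim (phi h μ w) r < rightLim (phi h μ w) r) (i : Fin N) :
    ∀ᵐ s ∂volume.restrict (Icc (0 : ℝ) 1), w r i s = 0 := by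
  have := H.finite
  have h0 : ∑ i, ∫ s in (0 : ℝ)..1, w r i s = 0 := by
    rw [← H.rightLim_sub_leftLim_phi hh hr,
      le_antisymm (not_lt.1 hn) ((phi_mono hh).leftLim_le_rightLim le_rfl),
      sub_self]
  filter_upwards [H.sum_const r hr, ae_restrict_mem measurableSet_Icc] with s h1 h2
  rw [h0] at h1
  exact (Finset.sum_eq_zero_iff_of_nonneg fun i _ => H.nonneg r hr i s h2).1 h1 i (Finset.mem_univ i)

/-- The controls of the reparameterized process. -/
lemma exists_isMatching : ∃ α : Fin N → ℝ → ℝ, IsMatching h μ w (phi h μ w h) α ∧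
    ∀ r ∈ Icc 0 h, ∀ i, ∀ᵐ s ∂volume.restrict (Icc (0 : ℝ) 1),
      w r i s = (rightLim (phi h μ w) r - leftLim (phi h μ w) r)
        * α i (leftLim (phi h μ w) r + s * (rightLim (phi h μ w) r - leftLim (phi h μ w) r)) := by
  classical
  have hμ := H.finite
  obtain ⟨HT, e⟩ := isTimeChange_eta (μ := μ) (w := w) hh
  set S := phi h μ w h with hS
  set η := eta h μ w with hη
  set φ := phi h μ w with hφ
  -- The level `η s` tells which flat part contains `s`; there the rescaled attached control is
  -- used, elsewhere the density of the continuous part.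
  set α : Fin N → ℝ → ℝ := fun i s => if leftLim φ (η s) < rightLim φ (η s) then
    (rightLim φ (η s) - leftLim φ (η s))⁻¹
      * w (η s) i ((s - leftLim φ (η s)) / (rightLim φ (η s) - leftLim φ (η s)))
    else contDensity h μ w i (η s) with hα
  have hlev : ∀ r ∈ Icc 0 h, ∀ s ∈ Icc (leftLim φ r) (rightLim φ r), η s = r := by
    intro r hr s hs
    have hsub := HT.Icc_inv_subset r
    have := HT.eq_iff hr (s := s)
    rw [e] at this hsub
    exact (this (hsub hs)).2 hs
  have hon : ∀ r ∈ Icc 0 h, leftLim φ r < rightLim φ r → ∀ i,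
      ∀ s ∈ Icc (leftLim φ r) (rightLim φ r), α i s = (rightLim φ r - leftLim φ r)⁻¹
        * w r i ((s - leftLim φ r) / (rightLim φ r - leftLim φ r)) := by
    intro r hr hlt i s hs
    simp only [hα, hlev r hr s hs, if_pos hlt]
  have hoff : ∀ i s, ¬ leftLim φ (η s) < rightLim φ (η s) → α i s = contDensity h μ w i (η s) :=
    fun i s hn => if_neg hn
  have hae1 : ∀ {p : ℝ → Prop}, (∀ᵐ r ∂phiMeasure h μ w, p r) →
      ∀ᵐ s ∂volume.restrict (Icc 0 S), p (η s) := by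
    intro p hp
    rw [← pushDensity_eta hh, pushDensity_one] at hp
    exact ae_of_ae_map HT.aemeasurable hp
  have hae : ∀ {p : ℝ → Prop}, (∀ r ∈ Icc 0 h, leftLim φ r < rightLim φ r →
      ∀ᵐ s ∂volume.restrict (Icc (leftLim φ r) (rightLim φ r)), p s) →
      (∀ᵐ s ∂volume.restrict (Icc 0 S), ¬ leftLim φ (η s) < rightLim φ (η s) → p s) →
      ∀ᵐ s ∂volume.restrict (Icc 0 S), p s := by
    intro p h1 h2
    refine HT.ae_of_ae ?_ ?_
    · rwa [e]
    · rwa [e]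
  have hnn : ∀ᵐ s ∂volume.restrict (Icc 0 S), ∀ i, 0 ≤ α i s := by
    refine hae (fun r hr hlt => ?_) ?_
    · filter_upwards [ae_Icc_of_ae_Icc_zero_one hlt (ae_restrict_mem measurableSet_Icc),
        ae_restrict_mem measurableSet_Icc] with s h1 h2 i
      rw [hon r hr hlt i s h2]
      exact mul_nonneg (inv_nonneg.2 (sub_pos.2 hlt).le) (H.nonneg r hr i _ h1)
    · refine Eventually.of_forall fun s hn i => ?_
      rw [hoff i s hn]
      exact ENNReal.toReal_nonneg
  -- On a flat part the sum is exactly one, since the attached controls add up to the height of the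
  -- jump; elsewhere the bound on the sum of the densities applies.
  have hsum : ∀ᵐ s ∂volume.restrict (Icc 0 S), ∑ i, α i s ≤ 1 := by
    refine hae (fun r hr hlt => ?_) ?_
    · filter_upwards [ae_Icc_of_ae_Icc_zero_one hlt (H.sum_const r hr),
        ae_restrict_mem measurableSet_Icc] with s h1 h2
      rw [Finset.sum_congr rfl fun i _ => hon r hr hlt i s h2, ← Finset.mul_sum, h1,
        ← H.rightLim_sub_leftLim_phi hh hr, inv_mul_cancel₀ (sub_pos.2 hlt).ne']
    · filter_upwards [hae1 sum_contDensity_le_one] with s h1 hn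
      rwa [Finset.sum_congr rfl fun i _ => hoff i s hn]
  have hmeas : ∀ i, AEStronglyMeasurable (α i) (volume.restrict (Icc 0 S)) := by
    intro i
    refine HT.aestronglyMeasurable_of (G := fun s => contDensity h μ w i (η s)) ?_ ?_ ?_
    · rw [e]
      intro r hr hlt
      refine ((aemeasurable_Icc_of_Icc_zero_one hlt (H.measurable r hr i)).const_mul
        (rightLim φ r - leftLim φ r)⁻¹).aestronglyMeasurable.congr ?_
      filter_upwards [ae_restrict_mem measurableSet_Icc] with s hs
      rw [hon r hr hlt i s hs]
    · exact ((Measure.measurable_rnDeriv _ _).ennreal_toReal.comp_aemeasurable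
        HT.aemeasurable).aestronglyMeasurable
    · rw [e]
      exact Eventually.of_forall fun s hn => (hoff i s hn).symm
  have hrate : ∀ i, IsRate (α i) S := fun i =>
    ⟨(hmeas i).aemeasurable, hnn.mono fun s hs => hs i, by
      filter_upwards [hnn, hsum] with s h1 h2
      exact (Finset.single_le_sum (f := fun i => α i s) (fun j _ => h1 j)
        (Finset.mem_univ i)).trans h2⟩
  have hu : IsRate (fun s => 1 - ∑ i, α i s) S :=
    ⟨aemeasurable_const.sub (Finset.aemeasurable_fun_sum _ fun i _ => (hrate i).meas),
      hsum.mono fun s hs => sub_nonneg.2 hs, hnn.mono fun s hs => by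
        have := Finset.sum_nonneg fun i (_ : i ∈ Finset.univ) => hs i
        linarith⟩
  have hctl : ∀ r ∈ Icc 0 h, ∀ i, ∀ᵐ s ∂volume.restrict (Icc (0 : ℝ) 1),
      w r i s = (rightLim φ r - leftLim φ r)
        * α i (leftLim φ r + s * (rightLim φ r - leftLim φ r)) := by
    intro r hr i
    by_cases hlt : leftLim φ r < rightLim φ r
    · filter_upwards [ae_restrict_mem measurableSet_Icc] with s hs
      have hd := sub_pos.2 hlt
      rw [hon r hr hlt i _ ⟨by nlinarith [hs.1], by nlinarith [hs.2]⟩, ← mul_assoc,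
        mul_inv_cancel₀ hd.ne', one_mul, add_sub_cancel_left, mul_div_cancel_right₀ _ hd.ne']
    · filter_upwards [H.ae_eq_zero hh hr hlt i] with s hs
      rw [hs, le_antisymm (not_lt.1 hlt) ((phi_mono hh).leftLim_le_rightLim le_rfl), sub_self,
        zero_mul]
  set A : Set ℝ := {r | r ∈ Icc 0 h ∧ leftLim φ r < rightLim φ r} with hA
  have hAc : A.Countable := by
    have := HT.countable_jumps_Icc
    rwa [e] at this
  -- Equality is checked separately on the countable jump set, atom by atom, and on its complement,
  -- where `μ_i` is its continuous part and has density `contDensity` with respect to the image `dφ`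
  -- of Lebesgue measure.
  have hpush : ∀ i, segMeasure h μ w i = pushDensity η (α i) S := by
    intro i
    have hfp := isFiniteMeasure_pushDensity HT.aemeasurable (hrate i)
    have hsing : ∀ r ∈ A, segMeasure h μ w i {r} = pushDensity η (α i) S {r} := by
      intro r hr
      refine (measureReal_eq_measureReal_iff).1 ?_
      rw [H.segMeasure_singleton hh hr.1, HT.pushDensity_singleton (hrate i) hr.1, e]
      have e2 := intervalIntegral.smul_integral_comp_add_mul (a := 0) (b := 1) (α i)
        (rightLim φ r - leftLim φ r) (leftLim φ r)
      rw [smul_eq_mul, mul_zero, add_zero, mul_one, add_sub_cancel] at e2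
      rw [← e2, ← intervalIntegral.integral_const_mul, intervalIntegral.integral_of_le zero_le_one,
        intervalIntegral.integral_of_le zero_le_one]
      refine integral_congr_ae (ae_restrict_of_ae_restrict_of_subset Ioc_subset_Icc_self ?_)
      filter_upwards [hctl r hr.1 i] with s hs
      rw [hs, mul_comm s]
    have hzero : ∀ r ∉ A, segMeasure h μ w i {r} = 0 := by
      intro r hr
      have h1 : segMeasure h μ w i {r} ≤ phiMeasure h μ w {r} := by
        rw [phiMeasure, Measure.add_apply, Measure.finsetSum_apply]
        exact (Finset.single_le_sum (f := fun i => segMeasure h μ w i {r}) (fun _ _ => zero_le)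
          (Finset.mem_univ i)).trans le_add_self
      refine le_antisymm (h1.trans ?_) (zero_le)
      by_cases hrI : r ∈ Icc 0 h
      · rw [← pushDensity_eta hh, HT.pushDensity_singleton_eq_zero]
        rw [e]
        exact fun hlt => hr ⟨hrI, hlt⟩
      · exact (measure_mono_null (singleton_subset_iff.2 hrI) (phiMeasure_compl hh)).le
    have hcont := contPart_eq_restrict_compl hAc hzero
    ext E hE
    rw [← measure_inter_add_sdiff E hAc.measurableSet,
      ← measure_inter_add_sdiff (μ := pushDensity η (α i) S) E hAc.measurableSet]
    have hEAc : (E ∩ A).Countable := hAc.mono inter_subset_right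
    congr 1
    · rw [← biUnion_of_singleton (E ∩ A),
        measure_biUnion hEAc (fun a _ b _ hab => by simpa [Function.onFun] using hab)
          fun a _ => measurableSet_singleton a,
        measure_biUnion hEAc (fun a _ b _ hab => by simpa [Function.onFun] using hab)
          fun a _ => measurableSet_singleton a]
      exact tsum_congr fun r => hsing r r.2.2
    · have hEm : MeasurableSet (E \ A) := hE.diff hAc.measurableSet
      have e1 : segMeasure h μ w i (E \ A) = contPart (segMeasure h μ w i) (E \ A) := by
        rw [hcont, Measure.restrict_apply hEm]
        congr 1
        ext s; simp only [Set.mem_sdiff, mem_inter_iff, mem_compl_iff]; tauto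
      rw [e1, ← Measure.withDensity_rnDeriv_eq (contPart (segMeasure h μ w i)) (phiMeasure h μ w)
          (contPart_le_phiMeasure i).absolutelyContinuous, withDensity_apply _ hEm,
        ← lintegral_indicator hEm, ← pushDensity_eta hh, ← lintegral_indicator_one hEm,
        lintegral_pushDensity HT.aemeasurable (hrate i) (measurable_one.indicator hEm),
        lintegral_pushDensity HT.aemeasurable (isRate_one S)
          ((Measure.measurable_rnDeriv _ _).indicator hEm)]
      refine lintegral_congr_ae ?_
      filter_upwards [hae1 (Measure.rnDeriv_lt_top (contPart (segMeasure h μ w i))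
        (phiMeasure h μ w)), ae_restrict_mem measurableSet_Icc] with s h1 h2
      by_cases h3 : η s ∈ E \ A
      · rw [indicator_of_mem h3, indicator_of_mem h3,
          hoff i s fun hlt => h3.2 ⟨HT.maps h2, hlt⟩, contDensity, ENNReal.ofReal_toReal h1.ne,
          pushDensity_eta hh]
        simp
      · rw [indicator_of_notMem h3, indicator_of_notMem h3]; simp
  -- The images of all weights add up to `dφ`, which is Lebesgue measure plus the `μ_i`; cancelling
  -- the finite measures `μ_i` leaves Lebesgue measure.
  have hclk : pushDensity η (fun s => 1 - ∑ i, α i s) S = volume.restrict (Icc 0 h) := by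
    have h1 := pushDensity_add_sum HT.aemeasurable hrate hu
    rw [pushDensity_eta hh, phiMeasure] at h1
    simp only [← hpush] at h1
    ext E hE
    have h2 := congrArg (fun m : Measure ℝ => m E) h1
    simp only [Measure.add_apply] at h2
    refine (ENNReal.add_left_inj ?_).1 h2
    rw [Measure.finsetSum_apply]
    exact ENNReal.sum_ne_top.2 fun i _ => measure_ne_top _ _
  -- So far the time change was `η`; the definition of matching requires the primitive of the clock
  -- rate. By `hclk` the rate has integral `η s` up to the right end of the level set of `s`, and no
  -- mass on the level set itself.
  have hprim : EqOn (primitive fun s => 1 - ∑ i, α i s) η (Icc 0 S) := by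
    intro s hs
    have hr := HT.maps hs
    have hlr := (HT.eq_iff hr hs).1 rfl
    have h0 : (0 : ℝ) ∈ Icc 0 S := HT.zero_mem
    have h1 := pushDensity_real HT.aemeasurable hu (measurableSet_Icc (a := (0 : ℝ)) (b := η s))
    rw [hclk, HT.preimage_Icc hr, Measure.real, Measure.restrict_apply measurableSet_Icc,
      inter_eq_left.2 (Icc_subset_Icc_right hr.2), Real.volume_Icc, sub_zero,
      ENNReal.toReal_ofReal hr.1, integral_Icc_eq_integral_Ioc,
      ← intervalIntegral.integral_of_le (HT.inv_rightLim_mem _).1] at h1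
    have h2 := HT.pushDensity_singleton hu hr
    rw [hclk, Measure.real, measure_mono_null (t := {η s}) le_rfl (by simp),
      ENNReal.toReal_zero] at h2
    have h3 := intervalIntegral.integral_add_adjacent_intervals (hu.intervalIntegrable h0 hs)
      (hu.intervalIntegrable hs (HT.inv_rightLim_mem (η s)))
    have h4 := intervalIntegral.integral_add_adjacent_intervals
      (hu.intervalIntegrable (HT.inv_leftLim_mem (η s)) hs)
      (hu.intervalIntegrable hs (HT.inv_rightLim_mem (η s)))
    have hpos : ∀ {a b}, a ∈ Icc 0 S → b ∈ Icc 0 S → a ≤ b →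
        0 ≤ ∫ t in a..b, (1 - ∑ i, α i t) := by
      intro a b ha hb hab
      rw [intervalIntegral.integral_of_le hab]
      exact setIntegral_rate_nonneg hu fun t ht => ⟨ha.1.trans ht.1.le, ht.2.trans hb.2⟩
    have h5 := hpos (HT.inv_leftLim_mem (η s)) hs hlr.1
    have h6 := hpos hs (HT.inv_rightLim_mem (η s)) hlr.2
    rw [primitive]
    linarith
  refine ⟨α, ⟨hμ, hrate, ⟨hu, HT.S_pos, hh, ?_⟩, fun i => ?_⟩, hctl⟩
  · exact (hprim HT.end_mem).trans HT.map_end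
  · rw [hpush, pushDensity, pushDensity]
    refine Measure.map_congr ?_
    refine (withDensity_absolutelyContinuous _ _).ae_le ?_
    filter_upwards [ae_restrict_mem measurableSet_Icc] with s hs using (hprim hs).symm

end IsImpulsiveControl

end ImpulsiveDelay

/-! ### From extended to reparameterized processes -/

namespace ImpulsiveDelay

section ToReparam

variable {n N : ℕ} {h : ℝ} {f g : State n × State n → State n} {x₀ ξ₀ : State n}

/-- The right-hand side of the differential equations of the jump functions. -/
noncomputable def jumpField (g : State n × State n → State n) (w : ℝ → Fin N → ℝ → ℝ)
    (ζ : ℝ → Fin (N + 1) → ℝ → State n) (r : ℝ) (i : Fin N) (s : ℝ) : State n :=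
  w r i s • g (ζ r i.succ s, ζ r i.castSucc s)

lemma norm_jumpField_le {μ : Measure ℝ} {w : ℝ → Fin N → ℝ → ℝ}
    (H : IsImpulsiveControl N h μ w) {C : ℝ} (hgC : ∀ p, ‖g p‖ ≤ C)
    (ζ : ℝ → Fin (N + 1) → ℝ → State n) {r : ℝ} (hr : r ∈ Icc 0 h) (i : Fin N) :
    ∀ᵐ s ∂volume.restrict (Icc (0 : ℝ) 1),
      ‖jumpField g w ζ r i s‖ ≤ (∑ i, ∫ s' in (0 : ℝ)..1, w r i s') * C := by
  filter_upwards [H.sum_const r hr, ae_restrict_mem measurableSet_Icc] with s h1 h2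
  rw [jumpField, norm_smul, Real.norm_of_nonneg (H.nonneg r hr i s h2), ← h1]
  refine mul_le_mul ?_ (hgC _) (norm_nonneg _)
    (Finset.sum_nonneg fun j _ => H.nonneg r hr j s h2)
  exact Finset.single_le_sum (f := fun i => w r i s) (fun j _ => H.nonneg r hr j s h2)
    (Finset.mem_univ i)

/-- The velocity along the reparameterized arcs. -/
noncomputable def arcField (f g : State n × State n → State n) (h S : ℝ) (α : Fin N → ℝ → ℝ)
    (x : ℝ → State n) (w : ℝ → Fin N → ℝ → ℝ) (ζ : ℝ → Fin (N + 1) → ℝ → State n) (i : Fin N)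
    (s : ℝ) : State n :=
  open scoped Classical in
  let ψ := primitive fun s => 1 - ∑ i, α i s
  let σ := rightInverse ψ S h
  if leftLim σ (ψ s) < rightLim σ (ψ s) then
    (rightLim σ (ψ s) - leftLim σ (ψ s))⁻¹ •
      jumpField g w ζ (ψ s) i ((s - leftLim σ (ψ s)) / (rightLim σ (ψ s) - leftLim σ (ψ s)))
  else (1 - ∑ j, α j s) • f (x (ψ s + (i : ℕ) * h), x (ψ s + (i : ℕ) * h - h))
    + α i s • g (x (ψ s + (i : ℕ) * h), x (ψ s + (i : ℕ) * h - h))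

/-- An extended process is linked to a reparameterized process. -/
lemma PreExtendedProcess.exists_isLinked (P : PreExtendedProcess N h f g x₀ ξ₀)
    (hh : 0 < h) (hf : Continuous f) (hg : Continuous g) {C : ℝ} (hfC : ∀ p, ‖f p‖ ≤ C)
    (hgC : ∀ p, ‖g p‖ ≤ C) : ∃ Q : PreReparamProcess N h f g x₀ ξ₀, IsLinked P Q := by
  classical
  obtain ⟨ζ, T⟩ := P.trajectory
  obtain ⟨α, M, hctl⟩ := P.control.exists_isMatching hh
  have hC : 0 ≤ C := (norm_nonneg _).trans (hfC 0)
  have h0m : (0 : ℝ) ∈ Icc 0 h := ⟨le_rfl, hh.le⟩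
  have hhm : h ∈ Icc 0 h := ⟨hh.le, le_rfl⟩
  rw [M.phi_eq] at hctl
  set S := phi h P.μ P.w h with hS
  have HT := M.clock.isTimeChange
  set ψ := primitive fun s => 1 - ∑ i, α i s with hψ
  set σ := rightInverse ψ S h with hσ
  -- The velocity is expressed through the trajectory and its jump functions alone, so the arcs can
  -- be defined by integration. That it is the required vector field along these arcs is verified
  -- afterwards, in `hfield`.
  set F := arcField f g h S α P.x P.w ζ with hF
  have hlev : ∀ r ∈ Icc 0 h, ∀ s ∈ Icc (leftLim σ r) (rightLim σ r), ψ s = r := fun r hr s hs =>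
    (HT.eq_iff hr (HT.Icc_inv_subset r hs)).2 hs
  have hσle : ∀ r, leftLim σ r ≤ rightLim σ r := HT.leftLim_le_rightLim
  have hFon : ∀ r ∈ Icc 0 h, leftLim σ r < rightLim σ r → ∀ i,
      ∀ s ∈ Icc (leftLim σ r) (rightLim σ r), F i s = (rightLim σ r - leftLim σ r)⁻¹ •
        jumpField g P.w ζ r i ((s - leftLim σ r) / (rightLim σ r - leftLim σ r)) := by
    intro r hr hlt i s hs
    simp only [hF, arcField, ← hψ, ← hσ, hlev r hr s hs, if_pos hlt]
  have hFoff : ∀ i s, ¬ leftLim σ (ψ s) < rightLim σ (ψ s) →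
      F i s = (1 - ∑ j, α j s) • f (P.x (ψ s + (i : ℕ) * h), P.x (ψ s + (i : ℕ) * h - h))
        + α i s • g (P.x (ψ s + (i : ℕ) * h), P.x (ψ s + (i : ℕ) * h - h)) := by
    intro i s hn
    simp only [hF, arcField, ← hψ, ← hσ, if_neg hn]
  have hΔ : ∀ r ∈ Icc 0 h, rightLim σ r - leftLim σ r = ∑ i, ∫ s' in (0 : ℝ)..1, P.w r i s' := by
    intro r hr
    rw [← P.control.rightLim_sub_leftLim_phi hh hr, M.phi_eq]
  have hode : ∀ r ∈ Icc 0 h, ∀ i, ∀ᵐ s ∂volume.restrict (Icc (0 : ℝ) 1),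
      HasDerivAt (ζ r i.succ) (jumpField g P.w ζ r i s) s := fun r hr i => T.jumps.ode r hr i
  have hJint : ∀ r ∈ Icc 0 h, ∀ i, IntegrableOn (jumpField g P.w ζ r i) (Icc 0 1) := fun r hr i =>
    integrableOn_of_ae_hasDerivAt (hode r hr i) (norm_jumpField_le P.control hgC ζ hr i)
  have hFmeas : ∀ i, AEStronglyMeasurable (F i) (volume.restrict (Icc 0 S)) := by
    intro i
    obtain ⟨x', hx'm, hx'⟩ := exists_measurable_eqOn
      (show -h ≤ N * h by nlinarith [Nat.cast_nonneg (α := ℝ) N]) P.bounded_variation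
    refine HT.aestronglyMeasurable_of (G := fun s => (1 - ∑ j, α j s) •
      f (x' (ψ s + (i : ℕ) * h), x' (ψ s + (i : ℕ) * h - h))
        + α i s • g (x' (ψ s + (i : ℕ) * h), x' (ψ s + (i : ℕ) * h - h))) ?_ ?_ ?_
    · intro r hr hlt
      refine (((aemeasurable_Icc_of_Icc_zero_one hlt
        (hJint r hr i).aestronglyMeasurable.aemeasurable).const_smul
          (rightLim σ r - leftLim σ r)⁻¹).aestronglyMeasurable).congr ?_
      filter_upwards [ae_restrict_mem measurableSet_Icc] with s hs
      rw [hFon r hr hlt i s hs]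
      rfl
    · have hp : AEMeasurable (fun s => (x' (ψ s + (i : ℕ) * h), x' (ψ s + (i : ℕ) * h - h)))
          (volume.restrict (Icc 0 S)) :=
        (hx'm.comp_aemeasurable (HT.aemeasurable.add_const _)).prodMk
          (hx'm.comp_aemeasurable ((HT.aemeasurable.add_const _).sub_const _))
      exact ((M.clock.meas.smul (hf.measurable.comp_aemeasurable hp)).add
        ((M.rate i).meas.smul (hg.measurable.comp_aemeasurable hp))).aestronglyMeasurable
    · filter_upwards [ae_restrict_mem measurableSet_Icc] with s hs hn
      have h1 := HT.maps hs
      have h2 : P.x (ψ s + (i : ℕ) * h) = x' (ψ s + (i : ℕ) * h) := by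
        refine hx' ?_
        have := segment_subset hh.le i (show ψ s + (i : ℕ) * h ∈
          Icc ((i : ℕ) * h) (((i : ℕ) + 1) * h) from ⟨by linarith [h1.1], by linarith [h1.2]⟩)
        exact ⟨by linarith [this.1], this.2⟩
      have h3 : P.x (ψ s + (i : ℕ) * h - h) = x' (ψ s + (i : ℕ) * h - h) := by
        refine hx' ?_
        have := segment_subset hh.le i (show ψ s + (i : ℕ) * h ∈
          Icc ((i : ℕ) * h) (((i : ℕ) + 1) * h) from ⟨by linarith [h1.1], by linarith [h1.2]⟩)
        exact ⟨by linarith [this.1], by linarith [this.2]⟩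
      rw [hFoff i s hn, h2, h3]
  have hFC : ∀ i, ∀ᵐ s ∂volume.restrict (Icc 0 S), ‖F i s‖ ≤ C + C := by
    intro i
    refine HT.ae_of_ae (fun r hr hlt => ?_) ?_
    · filter_upwards [ae_Icc_of_ae_Icc_zero_one hlt (norm_jumpField_le P.control hgC ζ hr i),
        ae_restrict_mem measurableSet_Icc] with s h1 h2
      have hd := sub_pos.2 hlt
      rw [← hΔ r hr] at h1
      rw [hFon r hr hlt i s h2, norm_smul, norm_inv, Real.norm_of_nonneg hd.le]
      calc _ ≤ (rightLim σ r - leftLim σ r)⁻¹ * ((rightLim σ r - leftLim σ r) * C) :=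
            mul_le_mul_of_nonneg_left h1 (inv_nonneg.2 hd.le)
        _ = C := inv_mul_cancel_left₀ hd.ne' C
        _ ≤ C + C := by linarith
    · filter_upwards [M.clock.norm_le, (M.rate i).norm_le] with s h1 h2 hn
      rw [hFoff i s hn]
      refine (norm_add_le _ _).trans (add_le_add ?_ ?_)
      · rw [norm_smul]
        exact (mul_le_mul h1 (hfC _) (norm_nonneg _) zero_le_one).trans (one_mul C).le
      · rw [norm_smul]
        exact (mul_le_mul h2 (hgC _) (norm_nonneg _) zero_le_one).trans (one_mul C).le
  have hFint : ∀ i, IntegrableOn (F i) (Icc 0 S) := fun i =>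
    Integrable.of_bound (hFmeas i) (C + C) (hFC i)
  have hFI : ∀ i {a b}, a ∈ Icc 0 S → b ∈ Icc 0 S → IntervalIntegrable (F i) volume a b := by
    intro i a b ha hb
    rw [intervalIntegrable_iff]
    exact (hFint i).mono_set
      (uIoc_subset_uIcc.trans ((convex_Icc 0 S).ordConnected.uIcc_subset ha hb))
  set Y : Fin N → ℝ → State n := fun i s => ζ 0 i.succ 0 + ∫ t in (0 : ℝ)..s, F i t with hY
  have h0S : (0 : ℝ) ∈ Icc 0 S := HT.zero_mem
  have hYlip : ∀ i, LipschitzOnWith (C + C).toNNReal (Y i) (Icc 0 S) := fun i =>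
    lipschitzOnWith_add_integral _ (hFint i) (hFC i)
  have hYsub : ∀ i {a b}, a ∈ Icc 0 S → b ∈ Icc 0 S → Y i a + ∫ t in a..b, F i t = Y i b := by
    intro i a b ha hb
    simp only [hY]
    rw [add_assoc, intervalIntegral.integral_add_adjacent_intervals (hFI i h0S ha) (hFI i ha hb)]
  have hpt : ∀ r, ∀ t ∈ Icc (0 : ℝ) 1,
      leftLim σ r + t * (rightLim σ r - leftLim σ r) ∈ Icc (leftLim σ r) (rightLim σ r) := by
    intro r t ht
    have := hσle r
    exact ⟨by nlinarith [ht.1], by nlinarith [ht.2]⟩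
  -- Integrating the velocity over part of a level interval reproduces the increment of the jump
  -- function; for a degenerate interval the attached control vanishes almost everywhere and both
  -- sides are zero.
  have hjump : ∀ r ∈ Icc 0 h, ∀ i, ∀ t ∈ Icc (0 : ℝ) 1,
      ∫ s in leftLim σ r..(leftLim σ r + t * (rightLim σ r - leftLim σ r)), F i s
        = ζ r i.succ t - ζ r i.succ 0 := by
    intro r hr i t ht
    have e1 := intervalIntegral.smul_integral_comp_add_mul (a := 0) (b := t) (F i)
      (rightLim σ r - leftLim σ r) (leftLim σ r)
    rw [mul_zero, add_zero, mul_comm _ t] at e1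
    rw [eq_add_integral_of_ae_hasDerivAt zero_le_one (T.jumps.abs_cont r hr i) (hode r hr i)
      (norm_jumpField_le P.control hgC ζ hr i) ht, add_sub_cancel_left, ← e1,
      ← intervalIntegral.integral_smul, intervalIntegral.integral_of_le ht.1,
      intervalIntegral.integral_of_le ht.1]
    refine integral_congr_ae (ae_restrict_of_ae_restrict_of_subset (s := Ioc 0 t) (t := Icc 0 1)
      (fun s hs => ⟨hs.1.le, hs.2.trans ht.2⟩) ?_)
    filter_upwards [hctl r hr i, ae_restrict_mem measurableSet_Icc] with s h1 h2
    by_cases hlt : leftLim σ r < rightLim σ r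
    · have hd := sub_pos.2 hlt
      rw [mul_comm _ s, hFon r hr hlt i _ (hpt r s h2), smul_smul, mul_inv_cancel₀ hd.ne', one_smul,
        add_sub_cancel_left, mul_div_cancel_right₀ _ hd.ne']
    · have hz : rightLim σ r - leftLim σ r = 0 := by linarith [hσle r, not_lt.1 hlt]
      rw [jumpField, h1, hz, zero_smul, zero_mul, zero_smul]
  have hlim0 : leftLim σ 0 = 0 := IsTimeChange.inv_leftLim_zero
  have hlimh : rightLim σ h = S := HT.inv_rightLim_end
  have hY0 : ∀ i, Y i 0 = ζ 0 i.succ 0 := fun i => by simp [hY]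
  -- The jump at `r = 0` carries `Y i` from time `0` to `σ⁺(0)`; from there on the integral equation
  -- of the trajectory is the integral of `F`.
  have hinner : ∀ i : Fin N, ∀ r ∈ Ioo 0 h, P.x (r + (i : ℕ) * h) = Y i (σ r) := by
    intro i r hr
    have h1 := M.inside_eq hf hg hfC hgC P.bounded_variation (hFint i) hψ
      (Eventually.of_forall fun s hn => hFoff i s hn) ⟨hr.1.le, hr.2⟩
    rw [T.inside i (r + (i : ℕ) * h) ⟨by linarith [hr.1], by linarith [hr.2]⟩]
    have h2 : ∑' q : Ioc 0 (r + (i : ℕ) * h - (i : ℕ) * h),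
        (ζ q i.succ 1 - leftLim P.x (q + (i : ℕ) * h))
        = ∑' q : Ioc 0 r, ∫ s in leftLim σ q..rightLim σ q, F i s := by
      rw [add_sub_cancel_right]
      refine tsum_congr fun q => ?_
      have hq : (q : ℝ) ∈ Ioc 0 h := ⟨q.2.1, q.2.2.trans hr.2.le⟩
      have := hjump q ⟨hq.1.le, hq.2⟩ i 1 ⟨zero_le_one, le_rfl⟩
      rw [one_mul, add_sub_cancel] at this
      rw [this, T.jumps.init_pos q hq i]
    have h3 := hjump 0 h0m i 1 ⟨zero_le_one, le_rfl⟩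
    rw [one_mul, add_sub_cancel, hlim0, ← hY0] at h3
    have h4 := hYsub i h0S (HT.inv_rightLim_mem 0)
    rw [h3] at h4
    have h5 : ζ 0 i.succ 1 = Y i (rightLim σ 0) := by rw [← h4]; abel
    rw [h2, add_assoc, add_assoc, ← add_assoc (∫ t' in _.._, _), h1, h5,
      hYsub i (HT.inv_rightLim_mem 0) (HT.inv_rightLim_mem r), HT.inv_rightLim hr.1]
  -- The increments agree by `hjump`. The initial values agree because for `r > 0` the left limit of
  -- the trajectory is, by `hinner`, the arc at the start of the flat part.
  have hζ : ∀ r ∈ Icc 0 h, ∀ i : Fin N, ∀ t ∈ Icc (0 : ℝ) 1,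
      ζ r i.succ t = Y i (leftLim σ r + t * (rightLim σ r - leftLim σ r)) := by
    intro r hr i t ht
    have h1 : ζ r i.succ 0 = Y i (leftLim σ r) := by
      rcases hr.1.eq_or_lt with rfl | hr0
      · rw [hlim0, hY0]
      · rw [T.jumps.init_pos r ⟨hr0, hr.2⟩ i]
        exact HT.leftLim_of_comp_inv (hYlip i).continuousOn (hinner i) ⟨hr0, hr.2⟩
    rw [← hYsub i (HT.inv_leftLim_mem r) (HT.Icc_inv_subset r (hpt r t ht)), hjump r hr i t ht, h1]
    abel
  set y : Fin (N + 1) → ℝ → State n :=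
    Fin.cases (fun s => if s = S then x₀ else ξ₀) Y with hy
  have hy0 : ∀ s, y 0 s = if s = S then x₀ else ξ₀ := fun s => rfl
  have hyS : ∀ i : Fin N, y i.succ = Y i := fun i => rfl
  have hlink : ∀ i : Fin N, y i.succ 0 = y i.castSucc S := by
    intro i
    rw [hyS, hY0, T.jumps.init_zero i]
    obtain h0 | ⟨j, hj⟩ := i.castSucc.eq_zero_or_eq_succ
    · rw [h0, hy0, if_pos rfl, T.jumps.zero h hhm 1 ⟨zero_le_one, le_rfl⟩, if_pos ⟨rfl, rfl⟩]
    · rw [hj, hyS, hζ h hhm j 1 ⟨zero_le_one, le_rfl⟩, one_mul, add_sub_cancel, hlimh]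
  -- On flat parts the jump functions are the arcs, off them the trajectory is; in both cases the
  -- delayed argument is the preceding arc at the same `s`. The endpoint `S` is discarded because
  -- the zeroth arc takes the value `x₀` there.
  have hfield : ∀ i : Fin N, ∀ᵐ s ∂volume.restrict (Icc 0 S),
      F i s = (1 - ∑ j, α j s) • f (y i.succ s, y i.castSucc s)
        + α i s • g (y i.succ s, y i.castSucc s) := by
    intro i
    have hneS : ∀ {A : Set ℝ}, ∀ᵐ s ∂volume.restrict A, s ≠ S := fun {A} =>
      ae_restrict_of_ae (Measure.ae_ne volume S)
    refine HT.ae_of_ae (fun r hr hlt => ?_) ?_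
    · have hd := sub_pos.2 hlt
      filter_upwards [M.clock.ae_eq_zero hr, ae_restrict_mem measurableSet_Icc,
        ae_Icc_of_ae_Icc_zero_one hlt (hctl r hr i), hneS] with s h1 h2 h3 h4
      have ht : (s - leftLim σ r) / (rightLim σ r - leftLim σ r) ∈ Icc (0 : ℝ) 1 :=
        ⟨div_nonneg (by linarith [h2.1]) hd.le, (div_le_one hd).2 (by linarith [h2.2])⟩
      have hs : leftLim σ r + (s - leftLim σ r) / (rightLim σ r - leftLim σ r)
          * (rightLim σ r - leftLim σ r) = s := by
        rw [div_mul_cancel₀ _ hd.ne', add_sub_cancel]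
      rw [hs] at h3
      have e1 : ζ r i.succ ((s - leftLim σ r) / (rightLim σ r - leftLim σ r)) = y i.succ s := by
        rw [hζ r hr i _ ht, hs, hyS]
      have e2 : ζ r i.castSucc ((s - leftLim σ r) / (rightLim σ r - leftLim σ r))
          = y i.castSucc s := by
        obtain h0 | ⟨j, hj⟩ := i.castSucc.eq_zero_or_eq_succ
        · rw [h0, hy0, if_neg h4, T.jumps.zero r hr _ ht, if_neg]
          rintro ⟨h5, rfl⟩
          rw [h5, one_mul, add_sub_cancel, hlimh] at hs
          exact h4 hs.symm
        · rw [hj, hζ r hr j _ ht, hs, hyS]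
      rw [h1, zero_smul, zero_add, hFon r hr hlt i s h2, jumpField, e1, e2, h3, smul_smul,
        inv_mul_cancel_left₀ hd.ne']
    · filter_upwards [ae_restrict_mem measurableSet_Icc, hneS,
        ae_restrict_of_ae (Measure.ae_ne volume 0)] with s h1 h2 h3 hn
      have hs : s ∈ Ioo 0 S := ⟨h1.1.lt_of_ne h3.symm, h1.2.lt_of_ne h2⟩
      have hr := HT.comp_mem_Ioo hs hn
      have e0 : σ (ψ s) = s := HT.inv_comp h1 hn
      have e1 : ∀ i : Fin N, P.x (ψ s + (i : ℕ) * h) = y i.succ s := fun i => by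
        rw [hinner i _ hr, e0, hyS]
      have e2 : P.x (ψ s + (i : ℕ) * h - h) = y i.castSucc s := by
        obtain h0 | ⟨j, hj⟩ := i.castSucc.eq_zero_or_eq_succ
        · have hi : (i : ℕ) = 0 := by simpa using congrArg Fin.val h0
          rw [h0, hy0, if_neg h2, hi]
          exact T.history _ ⟨by simp; linarith [hr.1], by simp; linarith [hr.2]⟩
        · have hi : (i : ℕ) = (j : ℕ) + 1 := by simpa using congrArg Fin.val hj
          rw [hj, ← e1 j, hi]
          congr 1
          push_cast; ring
      rw [hFoff i s hn, e1, e2]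
  let Q : PreReparamProcess N h f g x₀ ξ₀ :=
    { S := S
      y := y
      α := α
      S_pos := HT.S_pos
      essBdd := fun i => memLp_top_of_bound (M.rate i).meas.aestronglyMeasurable 1 (M.rate i).norm_le
      nonneg := ae_all_iff.2 fun i => (M.rate i).nonneg
      sum_le := M.clock.nonneg.mono fun s hs => sub_nonneg.1 hs
      abs_cont := fun i => by
        have := hYlip i
        rw [← uIcc_of_le HT.S_pos.le] at this
        exact this.absolutelyContinuousOnInterval
      ode := fun i => by
        filter_upwards [hfield i, ae_hasDerivAt_add_integral (ζ 0 i.succ 0) HT.S_pos.le (hFint i)]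
          with s h1 h2
        rw [← h1]
        exact h2
      y_zero := fun s hs => by rw [hy0, if_neg hs.2.ne]
      y_zero_end := by rw [hy0, if_pos rfl]
      link := hlink
      time := M.clock.time }
  exact ⟨Q, M, hctl, hinner, ζ, T, hζ⟩

end ToReparam

end ImpulsiveDelay

/-! ### The correspondence on equivalence classes -/

namespace ImpulsiveDelay

section Correspondence

variable {n N : ℕ} {h C : ℝ} {f g : State n × State n → State n} {x₀ ξ₀ : State n}

lemma existsUnique_reparamOf (hh : 0 < h) (hf : ContDiff ℝ 1 f) (hg : ContDiff ℝ 1 g)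
    (hfC : ∀ p, ‖f p‖ ≤ C) (hgC : ∀ p, ‖g p‖ ≤ C) (p : ExtendedProcess N h f g x₀ ξ₀) :
    ∃! q, ReparamOf p q := by
  obtain ⟨P, rfl⟩ := Quotient.exists_rep p
  obtain ⟨Q, L⟩ := P.exists_isLinked hh hf.continuous hg.continuous hfC hgC
  refine ⟨Quotient.mk _ Q, ⟨P, Q, rfl, rfl, L.isReparamOf hh⟩, ?_⟩
  rintro q ⟨P', Q', hP, rfl, H⟩
  exact (Quotient.sound (IsReparamOf.equiv hf hg hfC hgC hh (L.isReparamOf hh) H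
    (Quotient.exact hP.symm) L.matching.countable_phiJumps)).symm

lemma existsUnique_extendedOf (hN : 0 < N) (hh : 0 < h) (hf : ContDiff ℝ 1 f)
    (hg : ContDiff ℝ 1 g) (hfC : ∀ p, ‖f p‖ ≤ C) (hgC : ∀ p, ‖g p‖ ≤ C)
    (q : ReparamProcess N h f g x₀ ξ₀) : ∃! p, ExtendedOf q p := by
  obtain ⟨Q, rfl⟩ := Quotient.exists_rep q
  obtain ⟨P, L⟩ := Q.exists_isLinked hN hh hf.continuous hg.continuous hfC hgC
  refine ⟨Quotient.mk _ P, ⟨Q, P, rfl, rfl, L.isExtendedOf hN hh⟩, ?_⟩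
  rintro p ⟨Q', P', hQ, rfl, H⟩
  exact (Quotient.sound (IsExtendedOf.equiv hN hh (L.isExtendedOf hN hh) H
    (Quotient.exact hQ.symm))).symm

/-- A linked pair belongs to both relations. Given one relation between `p` and `q`, a process
linked to one of them must by uniqueness represent the other, and the link then gives the second
relation. -/
lemma reparamOf_iff_extendedOf (hN : 0 < N) (hh : 0 < h) (hf : ContDiff ℝ 1 f)
    (hg : ContDiff ℝ 1 g) (hfC : ∀ p, ‖f p‖ ≤ C) (hgC : ∀ p, ‖g p‖ ≤ C)
    (p : ExtendedProcess N h f g x₀ ξ₀) (q : ReparamProcess N h f g x₀ ξ₀) :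
    ReparamOf p q ↔ ExtendedOf q p := by
  constructor
  · intro H
    obtain ⟨P, rfl⟩ := Quotient.exists_rep p
    obtain ⟨Q, L⟩ := P.exists_isLinked hh hf.continuous hg.continuous hfC hgC
    rw [(existsUnique_reparamOf hh hf hg hfC hgC _).unique H ⟨P, Q, rfl, rfl, L.isReparamOf hh⟩]
    exact ⟨Q, P, rfl, rfl, L.isExtendedOf hN hh⟩
  · intro H
    obtain ⟨Q, rfl⟩ := Quotient.exists_rep q
    obtain ⟨P, L⟩ := Q.exists_isLinked hN hh hf.continuous hg.continuous hfC hgC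
    rw [(existsUnique_extendedOf hN hh hf hg hfC hgC _).unique H
      ⟨Q, P, rfl, rfl, L.isExtendedOf hN hh⟩]
    exact ⟨P, Q, rfl, rfl, L.isReparamOf hh⟩

end Correspondence

end ImpulsiveDelay

theorem corollary3p5 (n N : ℕ) (h : ℝ)
    (f g : ImpulsiveDelay.State n × ImpulsiveDelay.State n → ImpulsiveDelay.State n)
    (x₀ ξ₀ : ImpulsiveDelay.State n) (hN : 0 < N) (hh : 0 < h)
    (hf : ContDiff ℝ 1 f) (hg : ContDiff ℝ 1 g)
    (hfb : ∃ C : ℝ, ∀ p, ‖f p‖ ≤ C) (hgb : ∃ C : ℝ, ∀ p, ‖g p‖ ≤ C) :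
    ∃ I : ImpulsiveDelay.ExtendedProcess N h f g x₀ ξ₀ ≃
        ImpulsiveDelay.ReparamProcess N h f g x₀ ξ₀,
      (∀ p q, ImpulsiveDelay.ReparamOf p q ↔ q = I p) ∧
      (∀ q p, ImpulsiveDelay.ExtendedOf q p ↔ p = I.symm q) := by
  obtain ⟨C₁, hC₁⟩ := hfb
  obtain ⟨C₂, hC₂⟩ := hgb
  have hfC : ∀ p, ‖f p‖ ≤ max C₁ C₂ := fun p => (hC₁ p).trans (le_max_left _ _)
  have hgC : ∀ p, ‖g p‖ ≤ max C₁ C₂ := fun p => (hC₂ p).trans (le_max_right _ _)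
  have hR := ImpulsiveDelay.existsUnique_reparamOf (x₀ := x₀) (ξ₀ := ξ₀) (N := N) hh hf hg hfC hgC
  have hE := ImpulsiveDelay.existsUnique_extendedOf (x₀ := x₀) (ξ₀ := ξ₀) hN hh hf hg hfC hgC
  have hRE := ImpulsiveDelay.reparamOf_iff_extendedOf (x₀ := x₀) (ξ₀ := ξ₀) hN hh hf hg hfC hgC
  choose I hI hIu using hR
  choose J hJ hJu using hE
  -- Each inverse law transfers the defining relation of one map to the other by `hRE` and applies
  -- uniqueness.
  refine ⟨⟨I, J, fun p => ?_, fun q => ?_⟩, fun p q => ⟨fun H => hIu p q H, ?_⟩,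
    fun q p => ⟨fun H => hJu q p H, ?_⟩⟩
  · exact (hJu _ _ ((hRE _ _).1 (hI p))).symm
  · exact (hIu _ _ ((hRE _ _).2 (hJ q))).symm
  · rintro rfl; exact hI p
  · rintro rfl; exact hJ q
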